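/- **Setting.** Let $d$ be a positive integer and put $k^*:=2d+1-k$ for $1\le k\le 2d$. Let $I(d,2d)$ be the set of $d$-element subsets of $\{1,\dots,2d\}$, partially ordered by $u\le w$ iff $u_i\le w_i$ for all $i$, where $u=\{u_1<\dots<u_d\}$ and $w=\{w_1<\dots<w_d\}$. Let $I(d)\subseteq I(d,2d)$ consist of those $u$ that contain exactly one of $k,k^*$ for each $k$ and have an even number of entries exceeding $d$. Fix $v\in I(d)$. Let $$\mathfrak N=\{(r,c): 1\le r\le 2d,\ r\notin v,\ c\in v,\ r>c\},\qquad \mathfrak{ON}=\{(r,c)\in\mathfrak N: r<c^*\}.$$ For $\alpha=(r,c)$ put $p_v(\alpha)=(c^*,c)$, $p_h(\alpha)=(r,r^*)$, $\alpha^\#=(c^*,r^*)$. Write $(R,C)>(r,c)$ if $R>r$ and $C<c$. A *monomial* in a set is a finite multiset of its elements; its *degree* is the number of its elements counted with multiplicity; unions of monomials add multiplicities, and $\#$ acts on monomials elementwise. A *$v$-chain* in a monomial is a (possibly empty) sequence $\alpha_1>\alpha_2>\cdots>\alpha_\ell$ of its elements; $\alpha_\ell$ is its *tail* and $\ell$ its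 *length*. The *depth* of $\alpha$ in a monomial $\mathfrak S$ of $\mathfrak N$ is the largest length of a $v$-chain in $\mathfrak S$ with tail $\alpha$. A monomial $\mathfrak D$ in $\mathfrak N$ is *distinguished* if it is multiplicity free and any two distinct elements $(R,C),(r,c)$ of it satisfy $R\ne r$, $C\ne c$, and, if $R>r$, then $r<C$ or $C<c$. The element of $I(d,2d)$ *attached* to a distinguished $\mathfrak D$ is obtained from $v$ by removing the column indices $c$ and adding the row indices $r$ of all $(r,c)\in\mathfrak D$. **Domination.** Consecutive elements $(r,c)>(r',c')$ of a $v$-chain $C$ in $\mathfrak{ON}$ are *connected* if $r^*\ge c'$ and $r'>r^*$; the classes of the equivalence relation that this generates on $C$ are the *connected components*. For a connected $C:\alpha_1>\dots>\alpha_\ell$ let $\mathfrak S_C$ be $\{p_v(\alpha_1),\dots,p_v(\alpha_\ell)\}$ if $\ell$ is even, $\{p_v(\alpha_1),\dots,p_v(\alpha_\ell),p_h(\alpha_\ell)\}$ if $\ell$ is odd and $p_h(\alpha_\ell)\in\mathfrak N$, and $\{p_v(\alpha_1),\dots,p_v(\alpha_{\ell-1}),\alpha_\ell,\alpha_\ell^\#\}$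 if $\ell$ is odd and $p_h(\alpha_\ell)\notin\mathfrak N$. In the last case $\alpha_\ell$ is said to be *of type S*. For general $C$, $\mathfrak S_C$ is the union over the connected components; it is distinguished, and $w(C)$ denotes the attached element, which lies in $I(d)$. An element $w\in I(d)$ *$\mathfrak O$-dominates* a monomial $\mathfrak S$ in $\mathfrak{ON}$ if $w\ge w(C)$ for every $v$-chain $C$ in $\mathfrak S$. **$\mathfrak O$-depth.** The $\mathfrak O$-depth of $\alpha$ in a $v$-chain $C$ is the depth in $\mathfrak S_C$ of $\alpha$ if $\alpha$ is of type S in its component, and of $p_v(\alpha)$ otherwise. The $\mathfrak O$-depth of $\alpha$ in a monomial $\mathfrak S$ of $\mathfrak{ON}$ is the maximum of its $\mathfrak O$-depths in the $v$-chains in $\mathfrak S$ containing it. **The map $\pi$.** Let $\mathfrak S$ be a monomial in $\mathfrak N$. For each $k$, arrange its elements of depth $k$ (with multiplicity; no two are comparable) in ascending order of both row and column indices, and cut this sequence between successive elements $(r,c),(R,C)$ whenever $(r,C)\notin\mathfrak N$. The resulting pieces are the *blocks* of $\mathfrak S$. For a block $\mathfrak B:(r_1,c_1),\dots,(r_m,c_m)$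 let $w(\mathfrak B)=(r_m,c_1)$ and $\mathfrak B'=\{(r_1,c_2),\dots,(r_{m-1},c_m)\}$. Then $\pi(\mathfrak S)=(w,\mathfrak S')$, where $\mathfrak S'$ is the union of the $\mathfrak B'$ and $w$ is attached to the distinguished monomial $\mathfrak S_w=\{w(\mathfrak B)\}$, over all blocks $\mathfrak B$ of $\mathfrak S$. **The map $\pi_{\mathfrak O}$.** Let $\mathfrak S$ be a non-empty monomial in $\mathfrak{ON}$ and let $\mathfrak S_k^{\rm pr}$ be the monomial of its elements of $\mathfrak O$-depth $k$; no two elements of it are comparable. For odd $j$ let $\mathfrak P=\mathfrak S_j^{\rm pr}\cup\mathfrak S_{j+1}^{\rm pr}$ and let $\sigma_j$ be the last element of $\mathfrak S_j^{\rm pr}$ in ascending order of row and column indices. Put $$\mathfrak S_{j,j+1}=\begin{cases}(\mathfrak P\setminus\{\sigma_j\})\cup(\mathfrak P\setminus\{\sigma_j\})^\#\cup\{p_v(\sigma_j),p_h(\sigma_j)\}&\text{if }\sigma_j\text{ exists and }p_h(\sigma_j)\in\mathfrak N,\\ \mathfrak P\cup\mathfrak P^\#&\text{otherwise,}\end{cases}$$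 where $\mathfrak P\setminus\{\sigma_j\}$ omits one copy of $\sigma_j$. Let $\mathfrak S_j$ and $\mathfrak S_{j+1}$ be the submonomials of the elements of depth $1$ and $2$, respectively, in $\mathfrak S_{j,j+1}$. Write $\pi(\mathfrak S_k)=(w(k),\mathfrak S_k')$. Then $\pi_{\mathfrak O}(\mathfrak S)=(w,\mathfrak S')$, where $w$ is attached to $\bigcup_k\mathfrak S_{w(k)}$, which is a distinguished monomial, and $\mathfrak S'$ is the intersection of $\bigcup_k\mathfrak S_k'$ with $\mathfrak{ON}$. **Proposition.** Let $\mathfrak S$ be a non-empty monomial in $\mathfrak{ON}$ and let $\pi_{\mathfrak O}(\mathfrak S)=(w,\mathfrak S')$. Then: 1. $w\ge v$; 2. $\tfrac12|v\setminus w|+\deg\mathfrak S'=\deg\mathfrak S$ (the number $\tfrac12|v\setminus w|$ is the *$v$-degree* of $w$); 3. $w$ $\mathfrak O$-dominates $\mathfrak S'$; 4. $w$ is the least element of $I(d)$ that $\mathfrak O$-dominates $\mathfrak S$; in particular $w\in I(d)$. -/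

import Mathlib

/-!
Combinatorics of the orthogonal Grassmannian of isotropic `d`-dimensional subspaces of a
`2d`-dimensional quadratic space: the index set `I(d)`, `v`-chains, orthogonal domination,
orthogonal depth, and the map `π_O` on monomials.

Points `(r, c)` are pairs of natural numbers (row index, column index); monomials are multisets of
points.
-/

namespace OrthoGrass

/-- A point `(row index, column index)`. -/
abbrev Pt : Type := ℕ × ℕ

/-! ### The index sets and their order -/

/-- `k* = 2d + 1 - k`, used for `1 ≤ k ≤ 2d` only. -/
def star (d k : ℕ) : ℕ := 2 * d + 1 - k

/-- `I(d, 2d)`: the `d`-element subsets of `{1, …, 2d}`. -/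
def subsetsI (d : ℕ) : Finset (Finset ℕ) := (Finset.Icc 1 (2 * d)).powersetCard d

/-- `I(d)`: those elements of `I(d, 2d)` that contain exactly one of `k`, `k*` for each `k`, and an
even number of entries exceeding `d`. -/
def orthoI (d : ℕ) : Set (Finset ℕ) :=
  {u | u ∈ subsetsI d ∧ (∀ k ∈ Finset.Icc 1 (2 * d), Xor (k ∈ u) (star d k ∈ u)) ∧
    Even (u.filter (fun k => d < k)).card}

/-- The partial order on `I(d, 2d)`: entrywise comparison of the entries in ascending order. -/
def Le (u w : Finset ℕ) : Prop :=
  List.Forall₂ (· ≤ ·) (u.sort (· ≤ ·)) (w.sort (· ≤ ·))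

/-! ### The sets of points attached to `v` -/

/-- `R(v)`: all pairs `(r, c)` with `1 ≤ r, c ≤ 2d`, `r` not an entry and `c` an entry of `v`. -/
def roots (d : ℕ) (v : Finset ℕ) : Finset Pt := (Finset.Icc 1 (2 * d) \ v) ×ˢ v

/-- `N(v)`: the points of `R(v)` with `r > c`. -/
def pos (d : ℕ) (v : Finset ℕ) : Finset Pt := (roots d v).filter (fun a => a.2 < a.1)

/-- `ON(v)`: the points of `R(v)` with `r > c` and `r < c*`. -/
def orthoPos (d : ℕ) (v : Finset ℕ) : Finset Pt :=
  (roots d v).filter (fun a => a.2 < a.1 ∧ a.1 < star d a.2)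

/-- Vertical projection `p_v(r, c) = (c*, c)`. -/
def vProj (d : ℕ) (a : Pt) : Pt := (star d a.2, a.2)

/-- Horizontal projection `p_h(r, c) = (r, r*)`. -/
def hProj (d : ℕ) (a : Pt) : Pt := (a.1, star d a.1)

/-- Reflection in the diagonal: `(r, c)^# = (c*, r*)`. -/
def hash (d : ℕ) (a : Pt) : Pt := (star d a.2, star d a.1)

/-- The relation `(R, C) > (r, c)`: `R > r` and `C < c`. -/
def Gt (a b : Pt) : Prop := b.1 < a.1 ∧ a.2 < b.2

/-! ### Depth in a monomial -/

/-- `C` is a chain `α₁ > α₂ > ⋯` (possibly empty) of elements of the monomial `S`. -/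
def IsChainIn (S : Multiset Pt) (C : List Pt) : Prop :=
  C.Pairwise Gt ∧ ∀ a ∈ C, a ∈ S

/-- The depth of `a` in `S`: the largest length of a chain in `S` with tail `a`. (A chain has no
repeated elements, so the lengths are bounded by the degree of `S`.) -/
noncomputable def depth (S : Multiset Pt) (a : Pt) : ℕ :=
  sSup {n | ∃ C : List Pt, IsChainIn S C ∧ C.getLast? = some a ∧ C.length = n}

open scoped Classical in
/-- The submonomial of the elements of depth `k` of `S`. -/
noncomputable def depthPart (S : Multiset Pt) (k : ℕ) : Multiset Pt :=
  S.filter (fun a => depth S a = k)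

/-! ### The monomial `S_C` of a `v`-chain `C`, orthogonal domination -/

/-- The element of `I(d, 2d)` attached to a distinguished subset `S` of `N(v)`: remove from `v` the
column indices of `S` and add the row indices of `S`. -/
def assoc (v : Finset ℕ) (S : Multiset Pt) : Finset ℕ :=
  (v \ (S.map Prod.snd).toFinset) ∪ (S.map Prod.fst).toFinset

/-- Consecutive elements `a > b` of a `v`-chain are connected: with `a = (r, c)`, `b = (r', c')`,
`r* ≥ c'` and `(r', r*)` belongs to `N(v)`. -/
def Connected (d : ℕ) (v : Finset ℕ) (a b : Pt) : Prop :=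
  b.2 ≤ star d a.1 ∧ (b.1, star d a.1) ∈ pos d v

instance (d : ℕ) (v : Finset ℕ) (a b : Pt) : Decidable (Connected d v a b) := by
  unfold Connected; infer_instance

/-- The connected components of a `v`-chain: its maximal runs of successively connected elements. -/
def components (d : ℕ) (v : Finset ℕ) (C : List Pt) : List (List Pt) :=
  C.splitBy (fun a b => decide (Connected d v a b))

/-- `S_C` for a connected `v`-chain `C`. -/
def connectedMonomial (d : ℕ) (v : Finset ℕ) (C : List Pt) : Multiset Pt :=
  match C.getLast? with
  | none => 0
  | some a =>
    if Even C.length then (C.map (vProj d) : Multiset Pt)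
    else if hProj d a ∈ pos d v then (C.map (vProj d) : Multiset Pt) + {hProj d a}
    else (C.dropLast.map (vProj d) : Multiset Pt) + {a, hash d a}

/-- `S_C` for a `v`-chain `C`: the union over the connected components. -/
def chainMonomial (d : ℕ) (v : Finset ℕ) (C : List Pt) : Multiset Pt :=
  ((components d v C).map (connectedMonomial d v)).sum

/-- `w(C)`, the element attached to a `v`-chain `C`. -/
def chainElt (d : ℕ) (v : Finset ℕ) (C : List Pt) : Finset ℕ :=
  assoc v (chainMonomial d v C)

/-- `w` orthogonally dominates the monomial `S` of `ON(v)`: `w ≥ w(C)` for every `v`-chain `C`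
in `S`. -/
def Dominates (d : ℕ) (v w : Finset ℕ) (S : Multiset Pt) : Prop :=
  ∀ C : List Pt, IsChainIn S C → Le (chainElt d v C) w

/-! ### Orthogonal depth -/

/-- The element `a` of the `v`-chain `C` is of type S: it is the last element of its connected
component, the component has odd cardinality, and `p_h(a)` is not in `N(v)`. -/
def IsTypeS (d : ℕ) (v : Finset ℕ) (C : List Pt) (a : Pt) : Prop :=
  ∃ D ∈ components d v C, D.getLast? = some a ∧ Odd D.length ∧ hProj d a ∉ pos d v

open scoped Classical in
/-- `q_{C,a}`: it is `a` if `a` is of type S in `C`, and `p_v(a)` otherwise. -/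
noncomputable def chainPt (d : ℕ) (v : Finset ℕ) (C : List Pt) (a : Pt) : Pt :=
  if IsTypeS d v C a then a else vProj d a

/-- The orthogonal depth of `a` in the `v`-chain `C`: the depth of `q_{C,a}` in `S_C`. -/
noncomputable def chainODepth (d : ℕ) (v : Finset ℕ) (C : List Pt) (a : Pt) : ℕ :=
  depth (chainMonomial d v C) (chainPt d v C a)

/-- The orthogonal depth of `a` in the monomial `S`: the maximum of its orthogonal depths in the
(finitely many) `v`-chains in `S` that contain it. -/
noncomputable def oDepth (d : ℕ) (v : Finset ℕ) (S : Multiset Pt) (a : Pt) : ℕ :=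
  sSup {n | ∃ C : List Pt, IsChainIn S C ∧ a ∈ C ∧ chainODepth d v C a = n}

open scoped Classical in
/-- `S_k^pr`: the elements of `S` of orthogonal depth `k`. -/
noncomputable def prPart (d : ℕ) (v : Finset ℕ) (S : Multiset Pt) (k : ℕ) : Multiset Pt :=
  S.filter (fun a => oDepth d v S a = k)

/-! ### The map `π` of the Grassmannian case -/

/-- The elements of a monomial in lexicographic order. If no two elements are comparable for
`>`, this is the arrangement in ascending order of both row and column indices. -/
def arrange (T : Multiset Pt) : List Pt :=
  ((T.map toLex).sort (· ≤ ·)).map ofLex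

/-- The blocks of a monomial `T` without comparable elements: the maximal runs, in the ascending
arrangement, in which `(r, C)` belongs to `N(v)` for any successive `(r, c)`, `(R, C)`. -/
def blocks (d : ℕ) (v : Finset ℕ) (T : Multiset Pt) : List (List Pt) :=
  (arrange T).splitBy (fun a b => decide ((a.1, b.2) ∈ pos d v))

/-- `w(B) = (r_m, c_1)` for a (non-empty) block `B = (r_1, c_1), …, (r_m, c_m)`. -/
def blockTop (B : List Pt) : Pt := ((B.getLastD (0, 0)).1, (B.headD (0, 0)).2)

/-- `B' = (r_1, c_2), …, (r_{m-1}, c_m)` for a block `B = (r_1, c_1), …, (r_m, c_m)`. -/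
def blockRest (B : List Pt) : List Pt := List.zipWith (fun a b => (a.1, b.2)) B B.tail

/-- The blocks of an arbitrary monomial `S` in `N(v)`: those of its depth parts. -/
noncomputable def allBlocks (d : ℕ) (v : Finset ℕ) (S : Multiset Pt) : List (List Pt) :=
  (List.range (S.card + 1)).flatMap (fun k => blocks d v (depthPart S k))

/-- The distinguished monomial `S_w` of the pair `π(S) = (w, S')`: the elements `w(B)`, for the
blocks `B` of `S`. The first component `w` of `π(S)` is the element attached to `S_w`. -/
noncomputable def piTop (d : ℕ) (v : Finset ℕ) (S : Multiset Pt) : Multiset Pt :=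
  ((allBlocks d v S).map blockTop : Multiset Pt)

/-- The monomial `S'` of the pair `π(S) = (w, S')`: the union of the `B'`, for the blocks `B`. -/
noncomputable def piRest (d : ℕ) (v : Finset ℕ) (S : Multiset Pt) : Multiset Pt :=
  ((allBlocks d v S).flatMap blockRest : Multiset Pt)

/-! ### The map `π_O` -/

/-- `S_{j,j+1}`, for odd `j`. Here `σ_j` is the last element of `S_j^pr` in ascending order of row
and column indices, and `S` is truly orthogonal at `j` when `σ_j` exists and `p_h(σ_j)` belongs to
`N(v)`; in that case one copy of `σ_j` is replaced. -/
noncomputable def symPart (d : ℕ) (v : Finset ℕ) (S : Multiset Pt) (j : ℕ) : Multiset Pt :=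
  let P := prPart d v S j + prPart d v S (j + 1)
  match (arrange (prPart d v S j)).getLast? with
  | none => P + P.map (hash d)
  | some σ =>
    if hProj d σ ∈ pos d v then
      P.erase σ + (P.erase σ).map (hash d) + {vProj d σ, hProj d σ}
    else P + P.map (hash d)

/-- `S_k`: for `k = j` odd the elements of depth `1`, and for `k = j + 1` even the elements of
depth `2`, of `S_{j,j+1}`. -/
noncomputable def oPart (d : ℕ) (v : Finset ℕ) (S : Multiset Pt) (k : ℕ) : Multiset Pt :=
  if Odd k then depthPart (symPart d v S k) 1 else depthPart (symPart d v S (k - 1)) 2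

/-- The map `π_O`, for a non-empty monomial `S` in `ON(v)`. Its value is `(w, S')`, where `w` is
attached to the union of the distinguished monomials of the `π(S_k)`, and `S'` is the intersection
with `ON(v)` of the union of the second components of the `π(S_k)`. As orthogonal depths in `S` are
at most `2 deg S`, the monomial `S_k` is empty for `k > 2 deg S + 1`. -/
noncomputable def opi (d : ℕ) (v : Finset ℕ) (S : Multiset Pt) : Finset ℕ × Multiset Pt :=
  (assoc v (∑ k ∈ Finset.Icc 1 (2 * S.card + 1), piTop d v (oPart d v S k)),
    (∑ k ∈ Finset.Icc 1 (2 * S.card + 1), piRest d v (oPart d v S k)).filter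
      (fun a => a ∈ orthoPos d v))

/-- The `v`-degree of `w`: one half of the cardinality of `v \ w`. -/
def vDegree (v w : Finset ℕ) : ℚ := ((v \ w).card : ℚ) / 2

end OrthoGrass

/-!
Say that a point `(r, c)` straddles a threshold `t` if `c < t ≤ r`. Passing from `v` to the element
attached to a distinguished monomial `D` raises the number of entries `≥ t` by the number of points
of `D` that straddle `t`, so all comparisons in `I(d, 2d)` become comparisons of straddling numbers
(`IsSymmDistinct.le_assoc_iff`). All monomials that occur are symmetric under `#`, whence it
suffices to consider `t ≤ d + 1`, and the attached element lies in `I(d)` as soon as an even number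
of points straddles `d + 1` (`IsSymmDistinct.assoc_mem_orthoI`).

Orthogonal depth is governed by a local rule (`step`, `chainODepth_eq`): it increases by one along a
chain `a > b`, and by two exactly if `a` has odd depth and `p_h(a) > p_v(b)`. Hence
`oDepth d v S b` is `1` or the maximum of the values of `step` over the `a > b` in `S`
(`step_le_oDepth`, `exists_oDepth_eq_step`). For a chain `C` with tail `a`, and `t ≤ d + 1`
straddled by `a`, the number of elements of `S_C` straddling `t` is the depth of `a`, plus one if
that depth is odd and `p_h(a)` straddles `t`; this is `height`. For a general chain the straddling
number is at most the height of one of its elements, and this remains true for any function on the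
chain that grows at least as fast as `step` prescribes (`countP_straddles_chainMonomial_le`).

The monomial `S_k` consists of elements of orthogonal depth `k`, their reflections, and at most one
projection on the diagonal (`IsLayer`). Its blocks amount to the connected components of the set of
thresholds straddled by its elements, so each such threshold is straddled by exactly one `w(B)`
(`countP_straddles_tops`). By the rule for depths these sets of thresholds are nested, even with
their boundary points (`exists_straddles_of_mem_oPart`). Therefore the union of the `S_{w(k)}` has
distinct rows and columns, and its straddling number at `t ≤ d + 1` is the maximum of the heights of
the elements of `S` that straddle `t` (`Covers.le_countP_opiTop`, `covers_countP_opiTop`). By the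
preceding paragraph this is the maximum of the straddling numbers of the `S_C`, which says that `w`
is the least element that dominates `S`. It has the right parity because for odd `j` the thresholds
of `S_j` and `S_{j+1}` agree at the centre (`even_countP_opiTop`).

For domination of `S'`, an element of `S'` that comes from `S_k` is given the level `k`. These levels
grow along chains as `step` prescribes (`step_le_of_lowerRest`), so the bound for chains applies to
them. The degree formula is a count: a block with `m` elements has `m - 1` elements in `B'`, the
`S_k` have `2 deg S` elements in all, and half of the elements of each `S_k'` lie in `ON(v)`
(`Centered.filter_piRest_sym`).
-/

namespace OrthoGrass

variable {d : ℕ} {v : Finset ℕ}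

/-! ### The points of `N(v)` and `ON(v)` -/

lemma Gt.trans {a b c : Pt} (h : Gt a b) (h' : Gt b c) : Gt a c :=
  ⟨h'.1.trans h.1, h.2.trans h'.2⟩

lemma Gt.irrefl (a : Pt) : ¬ Gt a a := fun h => lt_irrefl _ h.1

lemma star_mem_iff (hv : v ∈ orthoI d) {k : ℕ} (h1 : 1 ≤ k) (h2 : k ≤ 2 * d) :
    star d k ∈ v ↔ k ∉ v := by
  have := hv.2.1 k (Finset.mem_Icc.2 ⟨h1, h2⟩)
  unfold Xor at this
  tauto

lemma mem_Icc_of_mem (hv : v ∈ orthoI d) {k : ℕ} (h : k ∈ v) : 1 ≤ k ∧ k ≤ 2 * d := by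
  have := (Finset.mem_powersetCard.1 hv.1).1 h
  exact Finset.mem_Icc.1 this

lemma mem_pos_iff (hv : v ∈ orthoI d) {a : Pt} :
    a ∈ pos d v ↔ 1 ≤ a.2 ∧ a.2 < a.1 ∧ a.1 ≤ 2 * d ∧ a.1 ∉ v ∧ a.2 ∈ v := by
  simp only [pos, roots, Finset.mem_filter, Finset.mem_product, Finset.mem_sdiff, Finset.mem_Icc]
  constructor
  · rintro ⟨⟨⟨⟨h1, h2⟩, h3⟩, h4⟩, h5⟩
    exact ⟨(mem_Icc_of_mem hv h4).1, h5, h2, h3, h4⟩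
  · rintro ⟨h1, h2, h3, h4, h5⟩
    exact ⟨⟨⟨⟨by omega, h3⟩, h4⟩, h5⟩, h2⟩

lemma mem_orthoPos_iff (hv : v ∈ orthoI d) {a : Pt} :
    a ∈ orthoPos d v ↔ 1 ≤ a.2 ∧ a.2 < a.1 ∧ a.1 + a.2 ≤ 2 * d ∧ a.1 ∉ v ∧ a.2 ∈ v := by
  rw [orthoPos, roots, Finset.mem_filter, Finset.mem_product, Finset.mem_sdiff,
    Finset.mem_Icc, star]
  constructor
  · rintro ⟨⟨⟨⟨h1, h2⟩, h3⟩, h4⟩, h5, h6⟩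
    exact ⟨(mem_Icc_of_mem hv h4).1, h5, by omega, h3, h4⟩
  · rintro ⟨h1, h2, h3, h4, h5⟩
    exact ⟨⟨⟨⟨by omega, by omega⟩, h4⟩, h5⟩, h2, by omega⟩

lemma orthoPos_subset_pos (hv : v ∈ orthoI d) {a : Pt} (h : a ∈ orthoPos d v) : a ∈ pos d v := by
  rw [mem_orthoPos_iff hv] at h
  rw [mem_pos_iff hv]
  exact ⟨h.1, h.2.1, by omega, h.2.2.2⟩

lemma star_star {k : ℕ} (h : k ≤ 2 * d + 1) : star d (star d k) = k := by
  unfold star; omega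

lemma hash_mem_pos (hv : v ∈ orthoI d) {a : Pt} (h : a ∈ pos d v) : hash d a ∈ pos d v := by
  rw [mem_pos_iff hv] at h ⊢
  obtain ⟨h1, h2, h3, h4, h5⟩ := h
  have e1 := star_mem_iff hv (k := a.1) (by omega) h3
  have e2 := star_mem_iff hv (k := a.2) h1 (by omega)
  refine ⟨?_, ?_, ?_, ?_, ?_⟩ <;> simp only [hash]
  · unfold star; omega
  · unfold star; omega
  · unfold star; omega
  · simpa [e2] using h5
  · simpa [e1] using h4

lemma hash_hash (hv : v ∈ orthoI d) {a : Pt} (h : a ∈ pos d v) : hash d (hash d a) = a := by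
  rw [mem_pos_iff hv] at h
  obtain ⟨h1, h2, h3, h4, h5⟩ := h
  simp only [hash]
  rw [star_star (by omega), star_star (by omega)]

lemma vProj_mem_pos (hv : v ∈ orthoI d) {a : Pt} (h : a ∈ orthoPos d v) :
    vProj d a ∈ pos d v := by
  rw [mem_orthoPos_iff hv] at h
  rw [mem_pos_iff hv]
  obtain ⟨h1, h2, h3, h4, h5⟩ := h
  have e2 := star_mem_iff hv (k := a.2) h1 (by omega)
  refine ⟨h1, ?_, ?_, ?_, h5⟩ <;> simp only [vProj]
  · unfold star; omega
  · unfold star; omega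
  · simpa [e2] using h5

lemma hProj_mem_pos_iff (hv : v ∈ orthoI d) {a : Pt} (h : a ∈ orthoPos d v) :
    hProj d a ∈ pos d v ↔ d < a.1 := by
  rw [mem_orthoPos_iff hv] at h
  rw [mem_pos_iff hv]
  obtain ⟨h1, h2, h3, h4, h5⟩ := h
  have e1 := star_mem_iff hv (k := a.1) (by omega) (by omega)
  simp only [hProj]
  constructor
  · rintro ⟨_, h, _⟩
    unfold star at h; omega
  · intro h
    refine ⟨?_, ?_, by omega, h4, e1.2 h4⟩ <;> unfold star <;> omega

/-- Rows never coincide with reflected rows, since the latter are entries of `v`. -/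
lemma row_add_row_ne (hv : v ∈ orthoI d) {a b : Pt} (ha : a ∈ orthoPos d v)
    (hb : b ∈ orthoPos d v) : a.1 + b.1 ≠ 2 * d + 1 := by
  rw [mem_orthoPos_iff hv] at ha hb
  intro h
  have e1 := star_mem_iff hv (k := a.1) (by omega) (by omega)
  have : star d a.1 = b.1 := by unfold star; omega
  rw [this] at e1
  exact hb.2.2.2.1 (e1.2 ha.2.2.2.1)

/-- Since `r*` is an entry of `v` whenever `r` is not, connectedness is a condition on indices only.
-/
lemma connected_iff (hv : v ∈ orthoI d) {a b : Pt} (ha : a ∈ orthoPos d v)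
    (hb : b ∈ orthoPos d v) :
    Connected d v a b ↔ a.1 + b.2 ≤ 2 * d + 1 ∧ 2 * d + 1 < a.1 + b.1 := by
  have ha' := (mem_orthoPos_iff hv).1 ha
  have hb' := (mem_orthoPos_iff hv).1 hb
  have e1 := star_mem_iff hv (k := a.1) (by omega) (by omega)
  unfold Connected
  rw [mem_pos_iff hv]
  constructor
  · rintro ⟨h1, h2, h3, h4, h5⟩
    simp only [star] at *
    omega
  · rintro ⟨h1, h2⟩
    refine ⟨?_, ?_, ?_, by simp only; omega, hb'.2.2.2.1, e1.2 ha'.2.2.2.1⟩ <;>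
      simp only [star] <;> omega

/-! ### The monomial of a chain, by recursion along the chain -/

/-- The contribution to `S_C` of the last element `a` of a connected component; `p` tells whether
it stands at an odd position of its component. -/
def tailMonomial (d : ℕ) (v : Finset ℕ) (p : Bool) (a : Pt) : Multiset Pt :=
  if p then (if hProj d a ∈ pos d v then {vProj d a, hProj d a} else {a, hash d a})
  else {vProj d a}

/-- `S_C` for a chain `C`, by recursion along `C`; `p` tells whether the first element of `C` counts
as standing at an odd position of its component. -/
def runMonomial (d : ℕ) (v : Finset ℕ) : Bool → List Pt → Multiset Pt
  | _, [] => 0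
  | p, [a] => tailMonomial d v p a
  | p, a :: b :: l =>
    if Connected d v a b then vProj d a ::ₘ runMonomial d v (!p) (b :: l)
    else tailMonomial d v p a + runMonomial d v true (b :: l)

/-- "`a` is of type S in `C`", by recursion along `C`; see `runMonomial` for `p`. -/
def runTypeS (d : ℕ) (v : Finset ℕ) : Bool → List Pt → Pt → Prop
  | _, [], _ => False
  | p, [x], a => x = a ∧ p = true ∧ hProj d x ∉ pos d v
  | p, x :: y :: l, a =>
    if Connected d v x y then runTypeS d v (!p) (y :: l) a
    else (x = a ∧ p = true ∧ hProj d x ∉ pos d v) ∨ runTypeS d v true (y :: l) a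

/-- The accumulators of `List.splitBy.loop` only prepend to its result; this gives the recursion
`splitBy_cons_cons` for `List.splitBy`. -/
lemma splitBy_loop_eq {α : Type*} (r : α → α → Bool) (l : List α) (a : α) (g : List α)
    (gs : List (List α)) :
    List.splitBy.loop r l a g gs =
      gs.reverse ++ (List.splitBy r (a :: l)).modifyHead (g.reverse ++ ·) := by
  induction l generalizing a g gs with
  | nil => simp [List.splitBy, List.splitBy.loop]
  | cons b l ih =>
    simp only [List.splitBy, List.splitBy.loop]
    cases h : r a b
    · simp only [ih]
      simp
    · simp only [ih]
      simp [List.modifyHead_modifyHead, Function.comp_def]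

lemma splitBy_singleton {α : Type*} (r : α → α → Bool) (a : α) : List.splitBy r [a] = [[a]] := rfl

lemma splitBy_cons_cons {α : Type*} (r : α → α → Bool) (a b : α) (l : List α) :
    List.splitBy r (a :: b :: l) =
      if r a b then (List.splitBy r (b :: l)).modifyHead (a :: ·)
      else [a] :: List.splitBy r (b :: l) := by
  rw [List.splitBy]
  simp only [List.splitBy.loop]
  cases h : r a b <;> simp only [splitBy_loop_eq] <;> cases List.splitBy r (b :: l) <;> simp

lemma components_cons_cons (a b : Pt) (l : List Pt) :
    components d v (a :: b :: l) =
      if Connected d v a b then (components d v (b :: l)).modifyHead (a :: ·)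
      else [a] :: components d v (b :: l) := by
  simp [components, splitBy_cons_cons]

/-- `S_C` for a connected chain `C` whose first element counts as standing at an odd position if
`p` is true, and at an even one if `p` is false. -/
def shiftedMonomial (d : ℕ) (v : Finset ℕ) (p : Bool) (C : List Pt) : Multiset Pt :=
  match C.getLast? with
  | none => 0
  | some a => (C.dropLast.map (vProj d) : Multiset Pt) +
      tailMonomial d v (if Even C.length then !p else p) a

lemma shiftedMonomial_true (C : List Pt) : shiftedMonomial d v true C = connectedMonomial d v C := by
  rcases List.eq_nil_or_concat C with rfl | ⟨D, a, rfl⟩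
  · rfl
  · simp only [shiftedMonomial, connectedMonomial, tailMonomial, List.concat_eq_append,
      List.getLast?_concat, List.dropLast_concat]
    split_ifs <;> simp_all [← Multiset.coe_add, ← Multiset.coe_singleton, add_assoc]
    rfl

lemma shiftedMonomial_cons (p : Bool) (a : Pt) {D : List Pt} (hD : D ≠ []) :
    shiftedMonomial d v p (a :: D) = vProj d a ::ₘ shiftedMonomial d v (!p) D := by
  rcases List.eq_nil_or_concat D with rfl | ⟨D, b, rfl⟩
  · exact absurd rfl hD
  · have : (a :: D.concat b).getLast? = some b := by
      simp [List.getLast?_cons]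
    have h2 : (a :: D.concat b).dropLast = a :: D := by
      rw [List.dropLast_cons_of_ne_nil (by simp)]; simp
    simp only [shiftedMonomial, this, h2]
    simp only [List.concat_eq_append, List.getLast?_concat, List.dropLast_concat]
    simp only [List.map_cons, ← Multiset.cons_coe, Multiset.cons_add, List.length_cons]
    congr 3
    simp only [Nat.even_add_one]
    split_ifs <;> simp_all

lemma runMonomial_eq (p : Bool) (C : List Pt) :
    runMonomial d v p C = match components d v C with
      | [] => 0
      | D :: Ds => shiftedMonomial d v p D + (Ds.map (connectedMonomial d v)).sum := by
  induction C generalizing p with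
  | nil => rfl
  | cons a l ih =>
    cases l with
    | nil =>
      simp [runMonomial, components, splitBy_singleton, shiftedMonomial]
    | cons b l =>
      rw [runMonomial, components_cons_cons]
      simp only [ih]
      have hne : components d v (b :: l) ≠ [] := by simp [components]
      have hne2 : ∀ D ∈ components d v (b :: l), D ≠ [] := fun D hD =>
        List.ne_nil_of_mem_splitBy hD
      rcases h : components d v (b :: l) with _ | ⟨D, Ds⟩
      · exact absurd h hne
      · split_ifs with hc
        · simp only [List.modifyHead_cons]
          rw [shiftedMonomial_cons _ _ (hne2 D (by simp [h])), Multiset.cons_add]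
        · simp only [shiftedMonomial_true, List.map_cons, List.sum_cons]
          simp [shiftedMonomial]

lemma chainMonomial_eq (C : List Pt) : chainMonomial d v C = runMonomial d v true C := by
  rw [runMonomial_eq, chainMonomial]
  rcases components d v C with _ | ⟨D, Ds⟩
  · rfl
  · simp [shiftedMonomial_true]

lemma runTypeS_eq (p : Bool) (C : List Pt) (a : Pt) :
    runTypeS d v p C a ↔ hProj d a ∉ pos d v ∧ match components d v C with
      | [] => False
      | D :: Ds => (D.getLast? = some a ∧ (Odd D.length ↔ p = true)) ∨
          ∃ D ∈ Ds, D.getLast? = some a ∧ Odd D.length := by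
  induction C generalizing p with
  | nil => simp [runTypeS, components]
  | cons x l ih =>
    cases l with
    | nil =>
      simp [runTypeS, components, splitBy_singleton]
      aesop
    | cons y l =>
      rw [runTypeS, components_cons_cons]
      simp only [ih]
      have hne : components d v (y :: l) ≠ [] := by simp [components]
      have hne2 : ∀ D ∈ components d v (y :: l), D ≠ [] := fun D hD =>
        List.ne_nil_of_mem_splitBy hD
      rcases h : components d v (y :: l) with _ | ⟨D, Ds⟩
      · exact absurd h hne
      · have hD := hne2 D (by simp [h])
        split_ifs with hc
        · simp only [List.modifyHead_cons, List.length_cons]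
          obtain ⟨z, hz⟩ : ∃ z, D.getLast? = some z := by
            rcases List.eq_nil_or_concat D with rfl | ⟨D, b, rfl⟩
            · exact absurd rfl hD
            · exact ⟨b, by simp⟩
          have : (x :: D).getLast? = D.getLast? := by simp [List.getLast?_cons, hz]
          rw [this]
          have : (Odd (D.length + 1) ↔ p = true) ↔ (Odd D.length ↔ (!p) = true) := by
            rw [Nat.odd_add_one]
            cases p <;> simp
          rw [this]
        · simp
          aesop

lemma isTypeS_iff (C : List Pt) (a : Pt) : IsTypeS d v C a ↔ runTypeS d v true C a := by
  rw [runTypeS_eq, IsTypeS]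
  rcases components d v C with _ | ⟨D, Ds⟩
  · simp
  · simp
    aesop

/-! ### Orthogonal depth along a chain -/

/-- The rule by which orthogonal depth propagates along a chain: if `a > b` are consecutive and `a`
has orthogonal depth `e`, then `b` has orthogonal depth `step d e a b`. The depth increases by two
exactly when `e` is odd and `p_h(a) > p_v(b)`. -/
def step (d e : ℕ) (a b : Pt) : ℕ := if Odd e ∧ 2 * d + 1 < a.1 + b.2 then e + 2 else e + 1

lemma step_mono {e e' : ℕ} (h : e ≤ e') (a b : Pt) : step d e a b ≤ step d e' a b := by
  unfold step
  split_ifs with h1 h2 h2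
  · omega
  · rcases h.eq_or_lt with rfl | h
    · exact absurd h1 h2
    · omega
  · omega
  · omega

lemma lt_step (e : ℕ) (a b : Pt) : e < step d e a b := by
  unfold step; split_ifs <;> omega

lemma step_le (e : ℕ) (a b : Pt) : step d e a b ≤ e + 2 := by
  unfold step; split_ifs <;> omega

/-- The orthogonal depth of `a` in a chain whose first element is given depth `e`. -/
def depthAt (d : ℕ) : ℕ → List Pt → Pt → ℕ
  | e, [], _ => e
  | e, [_], _ => e
  | e, x :: y :: l, a => if x = a then e else depthAt d (step d e x y) (y :: l) a

/-- Compatibility of the position `p` of `b` in its component with its depth `e`: the parities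
agree. Nothing is required when `b.1 ≤ d`, since then `b` is not connected to a later element and
`p_h(b)` is not in `N(v)`, so that the parity of `e` has no further influence. -/
def Compatible (d : ℕ) (p : Bool) (e : ℕ) (b : Pt) : Prop := d < b.1 → (p = true ↔ Odd e)

lemma lt_of_connected (hv : v ∈ orthoI d) {a b : Pt} (ha : a ∈ orthoPos d v)
    (hb : b ∈ orthoPos d v) (hab : Gt a b) (h : Connected d v a b) : d < a.1 := by
  rw [connected_iff hv ha hb] at h
  have := hab.1
  omega

lemma step_of_connected (hv : v ∈ orthoI d) {a b : Pt} (ha : a ∈ orthoPos d v)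
    (hb : b ∈ orthoPos d v) (h : Connected d v a b) (e : ℕ) : step d e a b = e + 1 := by
  rw [connected_iff hv ha hb] at h
  unfold step
  rw [if_neg (by omega)]

lemma Compatible.of_connected (hv : v ∈ orthoI d) {a b : Pt} (ha : a ∈ orthoPos d v)
    (hb : b ∈ orthoPos d v) (hab : Gt a b) (h : Connected d v a b) {p : Bool} {e : ℕ}
    (hc : Compatible d p e a) : Compatible d (!p) (step d e a b) b := by
  intro _
  have := hc (lt_of_connected hv ha hb hab h)
  rw [step_of_connected hv ha hb h, Nat.odd_add_one]
  cases p <;> simp_all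

/-- If consecutive elements `a > b` of a chain are not connected, either the interval of `b` lies
in the interval of `p_h(a)`, or it ends below it. -/
lemma not_connected (hv : v ∈ orthoI d) {a b : Pt} (ha : a ∈ orthoPos d v)
    (hb : b ∈ orthoPos d v) (h : ¬ Connected d v a b) :
    (2 * d + 1 < a.1 + b.2) ∨ (a.1 + b.1 < 2 * d + 1 ∧ ¬ 2 * d + 1 < a.1 + b.2) := by
  rw [connected_iff hv ha hb] at h
  have := row_add_row_ne hv ha hb
  have := ((mem_orthoPos_iff hv).1 hb).2.1
  omega

lemma Compatible.of_not_connected (hv : v ∈ orthoI d) {a b : Pt} (ha : a ∈ orthoPos d v)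
    (hb : b ∈ orthoPos d v) (hab : Gt a b) (h : ¬ Connected d v a b) {p : Bool} {e : ℕ}
    (hc : Compatible d p e a) : Compatible d true (step d e a b) b := by
  intro h'
  have h2 := hab.1
  have := hc (by omega)
  rcases not_connected hv ha hb h with h1 | ⟨h1, h3⟩
  · unfold step
    split_ifs with h4
    · simp [Nat.odd_add, h4.1]
    · have : ¬ Odd e := by tauto
      simpa [Nat.odd_add_one] using this
  · omega

/-- At an even position of a component the depth of the next element increases by one only. -/
lemma Compatible.of_false (hv : v ∈ orthoI d) {a b : Pt} (hb : b ∈ orthoPos d v) {e : ℕ}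
    (hc : Compatible d false e a) : step d e a b = e + 1 := by
  rw [mem_orthoPos_iff hv] at hb
  unfold step
  rw [if_neg]
  rintro ⟨h1, h2⟩
  have := hc (by omega)
  simp [h1] at this

lemma mem_tailMonomial_bounds (hv : v ∈ orthoI d) {a : Pt} (ha : a ∈ orthoPos d v) {p : Bool}
    {x : Pt} (hx : x ∈ tailMonomial d v p a) : a.2 ≤ x.2 ∧ x.1 + a.2 ≤ 2 * d + 1 := by
  have ha' := (mem_orthoPos_iff hv).1 ha
  unfold tailMonomial at hx
  split_ifs at hx <;> simp [vProj, hProj, hash, star] at hx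
  · rcases hx with rfl | rfl <;> simp <;> omega
  · rcases hx with rfl | rfl <;> simp <;> omega
  · rcases hx with rfl; simp; omega

/-- The points of `S_C` lie inside `p_v(b)`, where `b` is the first element of `C`. -/
lemma mem_runMonomial_bounds (hv : v ∈ orthoI d) (l : List Pt) (b : Pt) (p : Bool)
    (hC : ∀ a ∈ b :: l, a ∈ orthoPos d v) (hch : (b :: l).Pairwise Gt)
    {x : Pt} (hx : x ∈ runMonomial d v p (b :: l)) : b.2 ≤ x.2 ∧ x.1 + b.2 ≤ 2 * d + 1 := by
  induction l generalizing b p with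
  | nil => exact mem_tailMonomial_bounds hv (hC b (by simp)) hx
  | cons c l ih =>
    have hbc : Gt b c := List.rel_of_pairwise_cons hch (by simp)
    have hb := hC b (by simp)
    have hb' := (mem_orthoPos_iff hv).1 hb
    have h2 := hbc.2
    have key : ∀ p, x ∈ runMonomial d v p (c :: l) → b.2 ≤ x.2 ∧ x.1 + b.2 ≤ 2 * d + 1 := by
      intro p h
      have := ih c p (fun a ha => hC a (by simp [ha])) hch.of_cons h
      omega
    rw [runMonomial] at hx
    split_ifs at hx
    · rcases Multiset.mem_cons.1 hx with rfl | hx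
      · simp [vProj, star]; omega
      · exact key _ hx
    · rcases Multiset.mem_add.1 hx with hx | hx
      · exact mem_tailMonomial_bounds hv hb hx
      · exact key _ hx

lemma mem_of_runTypeS {p : Bool} {C : List Pt} {a : Pt} (h : runTypeS d v p C a) : a ∈ C := by
  induction C generalizing p with
  | nil => simp [runTypeS] at h
  | cons x l ih =>
    cases l with
    | nil => simp [runTypeS] at h; simp [h.1]
    | cons y l =>
      rw [runTypeS] at h
      split_ifs at h
      · exact List.mem_cons_of_mem _ (ih h)
      · rcases h with h | h
        · simp [h.1]
        · exact List.mem_cons_of_mem _ (ih h)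

open scoped Classical in
/-- The point of `S_C` in which the depth of `a` is measured; see `runMonomial` for `p`. -/
noncomputable def runPt (d : ℕ) (v : Finset ℕ) (p : Bool) (C : List Pt) (a : Pt) : Pt :=
  if runTypeS d v p C a then a else vProj d a

lemma runPt_snd (p : Bool) (C : List Pt) (a : Pt) : (runPt d v p C a).2 = a.2 := by
  unfold runPt; split_ifs <;> rfl

lemma chainPt_eq (C : List Pt) (a : Pt) : chainPt d v C a = runPt d v true C a := by
  unfold chainPt runPt; congr 1; exact propext (isTypeS_iff C a)

lemma runPt_head (hv : v ∈ orthoI d) (l : List Pt) (b : Pt) (p : Bool)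
    (hC : ∀ a ∈ b :: l, a ∈ orthoPos d v) (hch : (b :: l).Pairwise Gt) :
    runPt d v p (b :: l) b ∈ runMonomial d v p (b :: l) ∧
      (runPt d v p (b :: l) b).1 + b.2 ≤ 2 * d + 1 ∧
      (p = true → b.1 ≤ d → (runPt d v p (b :: l) b).1 ≤ b.1) := by
  have hb := hC b (by simp)
  have hb' := (mem_orthoPos_iff hv).1 hb
  have hbl : b ∉ l := fun h => Gt.irrefl b (List.rel_of_pairwise_cons hch h)
  have hh := hProj_mem_pos_iff hv hb
  cases l with
  | nil =>
    simp only [runPt, runTypeS, runMonomial, tailMonomial]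
    cases p <;> by_cases h : d < b.1 <;> simp [h, hh, vProj, star] <;> omega
  | cons c l =>
    have hbc : Gt b c := List.rel_of_pairwise_cons hch (by simp)
    have h1 : ∀ p, ¬ runTypeS d v p (c :: l) b := fun p h => hbl (mem_of_runTypeS h)
    simp only [runPt, runTypeS, runMonomial, tailMonomial, h1]
    by_cases hcon : Connected d v b c
    · have := lt_of_connected hv hb (hC c (by simp)) hbc hcon
      simp [hcon, vProj, star]; omega
    · cases p <;> by_cases h : d < b.1 <;> simp [h, hh, hcon, vProj, star] <;> omega

lemma runPt_cons (l : List Pt) (b c a : Pt) (p : Bool) (hab : a ≠ b) :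
    runPt d v p (b :: c :: l) a =
      runPt d v (if Connected d v b c then !p else true) (c :: l) a := by
  have : ¬ (b = a ∧ p = true ∧ hProj d b ∉ pos d v) := fun h => hab h.1.symm
  by_cases h : Connected d v b c
  · rw [if_pos h]
    unfold runPt
    congr 1
    rw [runTypeS, if_pos h]
  · rw [if_neg h]
    unfold runPt
    congr 1
    rw [runTypeS, if_neg h]
    simp only [this, false_or]

/-- A chain in `S_C` whose tail is the point attached to `a` and whose length is the depth predicted
by `step`. The bounds on its elements serve to extend it at the front. -/
lemma exists_chain_runMonomial (hv : v ∈ orthoI d) (a : Pt) (l : List Pt) (b : Pt) (p : Bool)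
    (e : ℕ) (hC : ∀ a ∈ b :: l, a ∈ orthoPos d v) (hch : (b :: l).Pairwise Gt)
    (hc : Compatible d p e b) (ha : a ∈ b :: l) :
    ∃ L : List Pt, L.Pairwise Gt ∧ (∀ x ∈ L, x ∈ runMonomial d v p (b :: l)) ∧
      L.getLast? = some (runPt d v p (b :: l) a) ∧
      L.length + e = depthAt d e (b :: l) a + 1 ∧
      ∀ x ∈ L, b.2 ≤ x.2 ∧ x.1 + b.2 ≤ 2 * d + 1 ∧ (p = true → b.1 ≤ d → x.1 ≤ b.1) := by
  induction l generalizing b p e with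
  | nil =>
    obtain rfl : a = b := by simpa using ha
    have := runPt_head hv [] a p hC hch
    refine ⟨[runPt d v p [a] a], by simp, by simpa using this.1, by simp,
      by simp [depthAt]; omega, ?_⟩
    simpa [runPt_snd] using this.2
  | cons c l ih =>
    have hb := hC b (by simp)
    have hc' := hC c (by simp)
    have hB := (mem_orthoPos_iff hv).1 hb
    by_cases hab : a = b
    · subst hab
      have := runPt_head hv _ a p hC hch
      refine ⟨[runPt d v p (a :: c :: l) a], by simp, by simpa using this.1, by simp,
        by simp [depthAt]; omega, ?_⟩
      simpa [runPt_snd] using this.2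
    · have ha' : a ∈ c :: l := by simpa [hab] using ha
      have hbc : Gt b c := List.rel_of_pairwise_cons hch (by simp)
      have hbc1 := hbc.1
      have hbc2 := hbc.2
      have hda : ∀ e, depthAt d e (b :: c :: l) a = depthAt d (step d e b c) (c :: l) a := by
        intro e
        rw [depthAt, if_neg (Ne.symm hab)]
      rw [runPt_cons _ _ _ _ _ hab, hda]
      have hl : ∀ (L : List Pt) (x y : Pt), L.getLast? = some x → (y :: L).getLast? = some x := by
        intro L x y h
        simp [List.getLast?_cons, h]
      by_cases hcon : Connected d v b c
      · -- Inside a component, `p_v(b)` is put in front.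
        obtain ⟨L, h1, h2, h3, h4, h5⟩ := ih c (!p) (step d e b c)
          (fun a ha => hC a (by simp [ha])) hch.of_cons
          (hc.of_connected hv hb hc' hbc hcon) ha'
        have hlt := lt_of_connected hv hb hc' hbc hcon
        rw [step_of_connected hv hb hc' hcon] at h4 ⊢
        rw [runMonomial, if_pos hcon, if_pos hcon]
        refine ⟨vProj d b :: L, List.pairwise_cons.2 ⟨fun x hx => ?_, h1⟩, ?_, hl _ _ _ h3, ?_, ?_⟩
        · have := h5 x hx
          simp [Gt, vProj, star]; omega
        · intro x hx
          rcases List.mem_cons.1 hx with rfl | hx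
          · simp
          · exact Multiset.mem_cons_of_mem (h2 x hx)
        · simp; omega
        · intro x hx
          rcases List.mem_cons.1 hx with rfl | hx
          · simp [vProj, star]; omega
          · have := h5 x hx
            omega
      · obtain ⟨L, h1, h2, h3, h4, h5⟩ := ih c true (step d e b c)
          (fun a ha => hC a (by simp [ha])) hch.of_cons
          (hc.of_not_connected hv hb hc' hbc hcon) ha'
        rw [runMonomial, if_neg hcon, if_neg hcon]
        have hh := hProj_mem_pos_iff hv hb
        have gv : ∀ x ∈ L, Gt (vProj d b) x := by
          intro x hx
          have := h5 x hx
          simp [Gt, vProj, star]; omega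
        cases p with
        | false =>
          rw [hc.of_false hv hc'] at h4 ⊢
          refine ⟨vProj d b :: L, List.pairwise_cons.2 ⟨gv, h1⟩, ?_, hl _ _ _ h3, ?_, ?_⟩
          · intro x hx
            rcases List.mem_cons.1 hx with rfl | hx
            · simp [tailMonomial]
            · exact Multiset.mem_add.2 (Or.inr (h2 x hx))
          · simp; omega
          · intro x hx
            rcases List.mem_cons.1 hx with rfl | hx
            · simp [vProj, star]; omega
            · have := h5 x hx
              refine ⟨by omega, by omega, by simp⟩
        | true =>
          by_cases hd : d < b.1
          · have he : Odd e := (hc hd).1 rfl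
            have htm : tailMonomial d v true b = {vProj d b, hProj d b} := by
              simp [tailMonomial, hh, hd]
            rw [htm]
            rcases not_connected hv hb hc' hcon with hj | ⟨hj, hj'⟩
            · -- The only case in which the depth increases by two: both `p_v(b)` and `p_h(b)` exceed
              -- the later points.
              have hs : step d e b c = e + 2 := by simp [step, he, hj]
              rw [hs] at h4 ⊢
              refine ⟨vProj d b :: hProj d b :: L, List.pairwise_cons.2
                ⟨?_, List.pairwise_cons.2 ⟨?_, h1⟩⟩, ?_, hl _ _ _ (hl _ _ _ h3), ?_, ?_⟩
              · intro x hx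
                rcases List.mem_cons.1 hx with rfl | hx
                · simp [Gt, vProj, hProj, star]; omega
                · exact gv x hx
              · intro x hx
                have := h5 x hx
                simp [Gt, hProj, star]; omega
              · intro x hx
                rcases List.mem_cons.1 hx with rfl | hx
                · simp
                rcases List.mem_cons.1 hx with rfl | hx
                · simp
                · exact Multiset.mem_add.2 (Or.inr (h2 x hx))
              · simp; omega
              · intro x hx
                rcases List.mem_cons.1 hx with rfl | hx
                · simp [vProj, star]; omega
                rcases List.mem_cons.1 hx with rfl | hx
                · simp [hProj, star]; omega
                · have := h5 x hx
                  refine ⟨by omega, by omega, by omega⟩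
            · have hs : step d e b c = e + 1 := by simp [step, hj']
              rw [hs] at h4 ⊢
              refine ⟨vProj d b :: L, List.pairwise_cons.2 ⟨gv, h1⟩, ?_, hl _ _ _ h3, ?_, ?_⟩
              · intro x hx
                rcases List.mem_cons.1 hx with rfl | hx
                · simp
                · exact Multiset.mem_add.2 (Or.inr (h2 x hx))
              · simp; omega
              · intro x hx
                rcases List.mem_cons.1 hx with rfl | hx
                · simp [vProj, star]; omega
                · have := h5 x hx
                  refine ⟨by omega, by omega, by omega⟩
          · -- Here `b` is of type S: it is put in front itself.
            have htm : tailMonomial d v true b = {b, hash d b} := by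
              simp [tailMonomial, hh, hd]
            have hC' := (mem_orthoPos_iff hv).1 hc'
            have hs : step d e b c = e + 1 := by
              rw [step, if_neg]; omega
            rw [hs] at h4 ⊢
            rw [htm]
            refine ⟨b :: L, List.pairwise_cons.2 ⟨?_, h1⟩, ?_, hl _ _ _ h3, ?_, ?_⟩
            · intro x hx
              have := h5 x hx
              have := this.2.2 rfl
              unfold Gt; omega
            · intro x hx
              rcases List.mem_cons.1 hx with rfl | hx
              · simp
              · exact Multiset.mem_add.2 (Or.inr (h2 x hx))
            · simp; omega
            · intro x hx
              rcases List.mem_cons.1 hx with rfl | hx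
              · omega
              · have := h5 x hx
                have := this.2.2 rfl
                refine ⟨by omega, by omega, by omega⟩

instance (a b : Pt) : Decidable (Gt a b) := by unfold Gt; infer_instance

lemma countP_tailMonomial_le (q : Pt → Prop) [DecidablePred q] (p : Bool) (b : Pt) :
    (tailMonomial d v p b).countP q ≤ 2 := by
  refine (Multiset.countP_le_card _ _).trans ?_
  unfold tailMonomial; split_ifs <;> simp

/-- At most `depthAt d e C a - e` elements of `S_C` exceed the point attached to `a`. Together with
`exists_chain_runMonomial` this determines the depth of that point, as all predecessors in a chain
exceed its tail. -/
lemma countP_runMonomial_le (hv : v ∈ orthoI d) (a : Pt) (l : List Pt) (b : Pt) (p : Bool)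
    (e : ℕ) (hC : ∀ a ∈ b :: l, a ∈ orthoPos d v) (hch : (b :: l).Pairwise Gt)
    (hc : Compatible d p e b) (ha : a ∈ b :: l) :
    (runMonomial d v p (b :: l)).countP (fun x => Gt x (runPt d v p (b :: l) a)) + e ≤
      depthAt d e (b :: l) a := by
  have head : ∀ l p, (∀ a ∈ b :: l, a ∈ orthoPos d v) → (b :: l).Pairwise Gt →
      (runMonomial d v p (b :: l)).countP (fun x => Gt x (runPt d v p (b :: l) b)) = 0 := by
    intro l p hC hch
    rw [Multiset.countP_eq_zero]
    intro x hx h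
    have := (mem_runMonomial_bounds hv l b p hC hch hx).1
    have := h.2
    rw [runPt_snd] at this
    omega
  induction l generalizing b p e with
  | nil =>
    obtain rfl : a = b := by simpa using ha
    rw [head _ _ hC hch]
    simp [depthAt]
  | cons c l ih =>
    have hb := hC b (by simp)
    have hc' := hC c (by simp)
    have hB := (mem_orthoPos_iff hv).1 hb
    by_cases hab : a = b
    · subst hab
      rw [head _ _ hC hch]
      simp [depthAt]
    · have ha' : a ∈ c :: l := by simpa [hab] using ha
      have hA := (mem_orthoPos_iff hv).1 (hC a ha)
      have hbc : Gt b c := List.rel_of_pairwise_cons hch (by simp)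
      have hbc1 := hbc.1
      have hac : a.1 ≤ c.1 := by
        rcases List.mem_cons.1 ha' with rfl | h
        · exact le_rfl
        · exact (List.rel_of_pairwise_cons hch.of_cons h).1.le
      have hda : ∀ e, depthAt d e (b :: c :: l) a = depthAt d (step d e b c) (c :: l) a := by
        intro e
        rw [depthAt, if_neg (Ne.symm hab)]
      rw [runPt_cons _ _ _ _ _ hab, hda]
      have head' : ∀ l p, (∀ a ∈ c :: l, a ∈ orthoPos d v) → (c :: l).Pairwise Gt →
          (runMonomial d v p (c :: l)).countP (fun x => Gt x (runPt d v p (c :: l) c)) = 0 := by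
        intro l p hC hch
        rw [Multiset.countP_eq_zero]
        intro x hx h
        have := (mem_runMonomial_bounds hv l c p hC hch hx).1
        have := h.2
        rw [runPt_snd] at this
        omega
      by_cases hcon : Connected d v b c
      · have := ih c (!p) (step d e b c)
          (fun a ha => hC a (by simp [ha])) hch.of_cons
          (hc.of_connected hv hb hc' hbc hcon) ha' head'
        rw [step_of_connected hv hb hc' hcon] at this ⊢
        rw [runMonomial, if_pos hcon, if_pos hcon]
        rw [Multiset.countP_cons]
        split_ifs <;> omega
      · have := ih c true (step d e b c)
          (fun a ha => hC a (by simp [ha])) hch.of_cons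
          (hc.of_not_connected hv hb hc' hbc hcon) ha' head'
        rw [runMonomial, if_neg hcon, if_neg hcon, Multiset.countP_add]
        have hh := hProj_mem_pos_iff hv hb
        set q := runPt d v true (c :: l) a with hq
        have hq2 : q.2 = a.2 := runPt_snd _ _ _
        -- The component ending in `b` contributes no more than the increase of the depth.
        suffices (tailMonomial d v p b).countP (fun x => Gt x q) + e ≤ step d e b c by omega
        cases p with
        | false =>
          rw [hc.of_false hv hc']
          have : (tailMonomial d v false b).countP (fun x => Gt x q) ≤ 1 :=
            (Multiset.countP_le_card _ _).trans (by simp [tailMonomial])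
          omega
        | true =>
          by_cases hd : d < b.1
          · have he : Odd e := (hc hd).1 rfl
            have htm : tailMonomial d v true b = vProj d b ::ₘ {hProj d b} := by
              simp [tailMonomial, hh, hd]
            rcases not_connected hv hb hc' hcon with hj | ⟨hj, hj'⟩
            · have hs : step d e b c = e + 2 := by simp [step, he, hj]
              have := countP_tailMonomial_le (d := d) (v := v) (fun x => Gt x q) true b
              omega
            · have hs : step d e b c = e + 1 := by simp [step, hj']
              have : ¬ Gt (hProj d b) q := by
                simp [Gt, hProj, star, hq2]; omega
              rw [htm, hs, Multiset.countP_cons, ← Multiset.cons_zero, Multiset.countP_cons,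
                if_neg this]
              split_ifs <;> simp; omega
          · have htm : tailMonomial d v true b = b ::ₘ {hash d b} := by
              simp [tailMonomial, hh, hd]
            have hC' := (mem_orthoPos_iff hv).1 hc'
            have hs : step d e b c = e + 1 := by
              rw [step, if_neg]; omega
            have : ¬ Gt (hash d b) q := by
              simp [Gt, hash, star, hq2]; omega
            rw [htm, hs, Multiset.countP_cons, ← Multiset.cons_zero, Multiset.countP_cons,
              if_neg this]
            split_ifs <;> simp; omega

/-! ### Depth and orthogonal depth -/

lemma IsChainIn.coe_le {S : Multiset Pt} {C : List Pt} (h : IsChainIn S C) :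
    (C : Multiset Pt) ≤ S := by
  have : C.Nodup := h.1.imp fun {a b} hab => by rintro rfl; exact Gt.irrefl _ hab
  rw [Multiset.le_iff_subset (Multiset.coe_nodup.2 this)]
  exact fun a ha => h.2 a ha

lemma IsChainIn.length_le {S : Multiset Pt} {C : List Pt} (h : IsChainIn S C) :
    C.length ≤ S.card := Multiset.card_le_card h.coe_le

lemma IsChainIn.length_le_countP {S : Multiset Pt} {C : List Pt} (h : IsChainIn S C) {a : Pt}
    (ha : C.getLast? = some a) : C.length ≤ S.countP (fun x => Gt x a) + 1 := by
  rcases List.eq_nil_or_concat C with rfl | ⟨D, b, rfl⟩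
  · simp
  · rw [List.concat_eq_append] at *
    obtain rfl : b = a := by simpa using ha
    have h1 := List.pairwise_append.1 h.1
    have : IsChainIn (S.filter (fun x => Gt x b)) D :=
      ⟨h1.1, fun x hx => Multiset.mem_filter.2 ⟨h.2 x (by simp [hx]), h1.2.2 x hx b (by simp)⟩⟩
    have := this.length_le
    rw [Multiset.countP_eq_card_filter]
    simpa using this

lemma IsChainIn.length_le_depth {S : Multiset Pt} {C : List Pt} (h : IsChainIn S C) {a : Pt}
    (ha : C.getLast? = some a) : C.length ≤ depth S a :=
  le_csSup ⟨S.card, by rintro n ⟨C, h, -, rfl⟩; exact h.length_le⟩ ⟨C, h, ha, rfl⟩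

lemma depth_eq_of_chain {S : Multiset Pt} {C : List Pt} (h : IsChainIn S C) {a : Pt}
    (ha : C.getLast? = some a) (hle : S.countP (fun x => Gt x a) + 1 ≤ C.length) :
    depth S a = C.length := by
  refine le_antisymm (csSup_le ⟨_, C, h, ha, rfl⟩ ?_) (h.length_le_depth ha)
  rintro n ⟨D, hD, hDa, rfl⟩
  exact (hD.length_le_countP hDa).trans hle

/-- Orthogonal depth in a chain is computed by the rule `step`. -/
lemma chainODepth_eq (hv : v ∈ orthoI d) {C : List Pt} (hC : ∀ a ∈ C, a ∈ orthoPos d v)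
    (hch : C.Pairwise Gt) {a : Pt} (ha : a ∈ C) : chainODepth d v C a = depthAt d 1 C a := by
  obtain ⟨b, l, rfl⟩ : ∃ b l, C = b :: l := List.exists_cons_of_ne_nil (List.ne_nil_of_mem ha)
  have hc : Compatible d true 1 b := fun _ => by simp
  obtain ⟨L, h1, h2, h3, h4, -⟩ := exists_chain_runMonomial hv a l b true 1 hC hch hc ha
  have h5 := countP_runMonomial_le hv a l b true 1 hC hch hc ha
  rw [chainODepth, chainMonomial_eq, chainPt_eq, depth_eq_of_chain ⟨h1, h2⟩ h3 (by omega)]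
  omega

/-- `Reach d S a e`: the rule `step` produces the value `e` at the tail `a` of some chain in `S`. -/
inductive Reach (d : ℕ) (S : Multiset Pt) : Pt → ℕ → Prop
  | single {a : Pt} (ha : a ∈ S) : Reach d S a 1
  | cons {a b : Pt} {e : ℕ} (h : Reach d S b e) (ha : a ∈ S) (hab : Gt b a) :
      Reach d S a (step d e b a)

lemma Reach.mem {S : Multiset Pt} {a : Pt} {e : ℕ} (h : Reach d S a e) : a ∈ S := by
  cases h <;> assumption

lemma reach_depthAt {S : Multiset Pt} {b : Pt} {l : List Pt} {e : ℕ} (hb : Reach d S b e)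
    (hC : IsChainIn S (b :: l)) {a : Pt} (ha : a ∈ b :: l) :
    Reach d S a (depthAt d e (b :: l) a) := by
  induction l generalizing b e with
  | nil =>
    obtain rfl : a = b := by simpa using ha
    exact hb
  | cons c l ih =>
    rw [depthAt]
    split_ifs with h
    · exact h ▸ hb
    · refine ih (hb.cons (hC.2 c (by simp)) (List.rel_of_pairwise_cons hC.1 (by simp)))
        ⟨hC.1.of_cons, fun x hx => hC.2 x (by simp [hx])⟩ ?_
      rcases List.mem_cons.1 ha with rfl | ha
      · exact absurd rfl h
      · exact ha

/-- The depth of the last element arises by `step` from that of the last but one. -/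
lemma depthAt_concat (e : ℕ) (C : List Pt) (b a : Pt) (hn : (C ++ [b, a]).Nodup) :
    depthAt d e (C ++ [b, a]) a = step d (depthAt d e (C ++ [b]) b) b a := by
  induction C generalizing e with
  | nil =>
    have : b ≠ a := by simpa using hn
    simp [depthAt, this]
  | cons x C ih =>
    have h1 := List.nodup_cons.1 hn
    have hxa : x ≠ a := by rintro rfl; simp at h1
    have hxb : x ≠ b := by rintro rfl; simp at h1
    cases C with
    | nil => simpa [depthAt, hxa, hxb] using ih (step d e x b) h1.2
    | cons y C => simpa [depthAt, hxa, hxb] using ih (step d e x y) h1.2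

lemma depthAt_le (e : ℕ) (C : List Pt) (a : Pt) (hC : C ≠ []) :
    depthAt d e C a + 2 ≤ e + 2 * C.length := by
  induction C generalizing e with
  | nil => exact absurd rfl hC
  | cons x C ih =>
    cases C with
    | nil => simp [depthAt]
    | cons y C =>
      rw [depthAt]
      split_ifs
      · simp
      · have := ih (step d e x y) (by simp)
        have := step_le (d := d) e x y
        simp at *
        omega

lemma Reach.exists_chain {S : Multiset Pt} {a : Pt} {e : ℕ} (h : Reach d S a e) :
    ∃ C, IsChainIn S (C ++ [a]) ∧ depthAt d 1 (C ++ [a]) a = e := by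
  induction h with
  | single ha => exact ⟨[], ⟨by simp, by simpa using ha⟩, by simp [depthAt]⟩
  | @cons a b e h ha hab ih =>
    obtain ⟨C, hC, he⟩ := ih
    have h1 := List.pairwise_append.1 hC.1
    have hlt : ∀ x ∈ C ++ [b], Gt x a := by
      intro x hx
      rcases List.mem_append.1 hx with hx | hx
      · exact (h1.2.2 x hx b (by simp)).trans hab
      · obtain rfl : x = b := by simpa using hx
        exact hab
    have hch : ((C ++ [b]) ++ [a]).Pairwise Gt :=
      List.pairwise_append.2 ⟨hC.1, by simp, fun x hx y hy => by
        obtain rfl : y = a := by simpa using hy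
        exact hlt x hx⟩
    refine ⟨C ++ [b], ⟨hch, ?_⟩, ?_⟩
    · intro x hx
      rcases List.mem_append.1 hx with hx | hx
      · exact hC.2 x hx
      · obtain rfl : x = a := by simpa using hx
        exact ha
    · have hn : (C ++ [b, a]).Nodup := by
        have : ((C ++ [b]) ++ [a]).Nodup :=
          hch.imp fun {a b} hab => by rintro rfl; exact Gt.irrefl _ hab
        simpa using this
      have := depthAt_concat (d := d) 1 C b a hn
      rw [he] at this
      simpa using this

lemma Reach.lt_two_mul_card {S : Multiset Pt} {a : Pt} {e : ℕ} (h : Reach d S a e) :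
    e < 2 * S.card := by
  obtain ⟨C, hC, rfl⟩ := h.exists_chain
  have h1 := hC.length_le
  have := depthAt_le (d := d) 1 (C ++ [a]) a (by simp)
  omega

/-- An element has the same depth in a chain as in the initial segment of the chain that ends in it;
so only chains ending in `a` matter. -/
lemma setOf_chainODepth_eq (hv : v ∈ orthoI d) {S : Multiset Pt} (hS : ∀ a ∈ S, a ∈ orthoPos d v) (a : Pt) :
    {n | ∃ C : List Pt, IsChainIn S C ∧ a ∈ C ∧ chainODepth d v C a = n} = {n | Reach d S a n} := by
  ext n
  constructor
  · rintro ⟨C, hC, ha, rfl⟩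
    rw [chainODepth_eq hv (fun x hx => hS x (hC.2 x hx)) hC.1 ha]
    obtain ⟨b, l, rfl⟩ : ∃ b l, C = b :: l := List.exists_cons_of_ne_nil (List.ne_nil_of_mem ha)
    exact reach_depthAt (.single (hC.2 b (by simp))) hC ha
  · intro h
    obtain ⟨C, hC, he⟩ := Reach.exists_chain h
    refine ⟨_, hC, by simp, ?_⟩
    rw [chainODepth_eq hv (fun x hx => hS x (hC.2 x hx)) hC.1 (by simp), he]

lemma Reach.le_oDepth (hv : v ∈ orthoI d) {S : Multiset Pt} (hS : ∀ a ∈ S, a ∈ orthoPos d v)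
    {a : Pt} {e : ℕ} (h : Reach d S a e) : e ≤ oDepth d v S a := by
  rw [oDepth, setOf_chainODepth_eq hv hS]
  exact le_csSup ⟨2 * S.card, fun n hn => (Reach.lt_two_mul_card hn).le⟩ h

lemma reach_oDepth (hv : v ∈ orthoI d) {S : Multiset Pt} (hS : ∀ a ∈ S, a ∈ orthoPos d v)
    {a : Pt} (ha : a ∈ S) : Reach d S a (oDepth d v S a) := by
  have := Nat.sSup_mem (s := {n | Reach d S a n}) ⟨1, Reach.single ha⟩
    ⟨2 * S.card, fun n hn => (Reach.lt_two_mul_card hn).le⟩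
  rw [oDepth, setOf_chainODepth_eq hv hS]
  exact this

lemma one_le_oDepth (hv : v ∈ orthoI d) {S : Multiset Pt} (hS : ∀ a ∈ S, a ∈ orthoPos d v)
    {a : Pt} (ha : a ∈ S) : 1 ≤ oDepth d v S a := (Reach.single ha).le_oDepth hv hS

lemma oDepth_lt (hv : v ∈ orthoI d) {S : Multiset Pt} (hS : ∀ a ∈ S, a ∈ orthoPos d v)
    {a : Pt} (ha : a ∈ S) : oDepth d v S a < 2 * S.card := (reach_oDepth hv hS ha).lt_two_mul_card

lemma step_le_oDepth (hv : v ∈ orthoI d) {S : Multiset Pt} (hS : ∀ a ∈ S, a ∈ orthoPos d v)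
    {a b : Pt} (ha : a ∈ S) (hb : b ∈ S) (hab : Gt a b) :
    step d (oDepth d v S a) a b ≤ oDepth d v S b :=
  ((reach_oDepth hv hS ha).cons hb hab).le_oDepth hv hS

/-- Together with `step_le_oDepth` and `one_le_oDepth`, a recursive description of orthogonal depth.
-/
lemma exists_oDepth_eq_step (hv : v ∈ orthoI d) {S : Multiset Pt}
    (hS : ∀ a ∈ S, a ∈ orthoPos d v) {b : Pt} (hb : b ∈ S) :
    oDepth d v S b = 1 ∨
      ∃ a ∈ S, Gt a b ∧ oDepth d v S b = step d (oDepth d v S a) a b := by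
  have h := reach_oDepth hv hS hb
  generalize hn : oDepth d v S b = n at h
  cases h with
  | single => exact Or.inl rfl
  | @cons _ a e h ha hab =>
    refine Or.inr ⟨a, h.mem, hab, le_antisymm (step_mono (h.le_oDepth hv hS) _ _) ?_⟩
    rw [← hn]
    exact step_le_oDepth hv hS h.mem hb hab

/-! ### The number of elements of `S_C` straddling a threshold -/

/-- The point `a = (r, c)` straddles `t` if `c < t ≤ r`. -/
def Straddles (t : ℕ) (a : Pt) : Prop := a.2 < t ∧ t ≤ a.1

instance (t : ℕ) (a : Pt) : Decidable (Straddles t a) := by unfold Straddles; infer_instance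

/-- The number of elements of `S_C` that straddle `t`, for a chain `C` ending in `a` where `a` has
depth `e` and straddles `t ≤ d + 1`: it is `e`, or `e + 1` when `p_h(a)` is present and straddles
`t`. -/
def height (d t e : ℕ) (a : Pt) : ℕ := if Odd e ∧ 2 * d + 1 < a.1 + t then e + 1 else e

lemma height_mono {e e' : ℕ} (h : e ≤ e') (t : ℕ) (a : Pt) : height d t e a ≤ height d t e' a := by
  unfold height
  split_ifs with h1 h2 h2
  · omega
  · rcases h.eq_or_lt with rfl | h
    · exact absurd h1 h2
    · omega
  · omega
  · omega

lemma le_height (t e : ℕ) (a : Pt) : e ≤ height d t e a := by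
  unfold height; split_ifs <;> omega

/-- Here `t ≤ d + 1` excludes `b^#` for `b` of type S, and `c < t` makes `p_v(b)` straddle `t`. -/
lemma countP_straddles_tailMonomial (hv : v ∈ orthoI d) {t : ℕ} (ht : t ≤ d + 1) {b : Pt}
    (hb : b ∈ orthoPos d v) (hbt : b.2 < t) (p : Bool) :
    (tailMonomial d v p b).countP (Straddles t) =
      if p = true then
        if d < b.1 then (if 2 * d + 1 < b.1 + t then 2 else 1) else (if t ≤ b.1 then 1 else 0)
      else 1 := by
  have hB := (mem_orthoPos_iff hv).1 hb
  have hh := hProj_mem_pos_iff hv hb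
  have h1 : Straddles t (vProj d b) := by simp [Straddles, vProj, star]; omega
  cases p with
  | false =>
    have : tailMonomial d v false b = vProj d b ::ₘ 0 := by simp [tailMonomial]
    rw [this, Multiset.countP_cons_of_pos _ h1]
    simp
  | true =>
    by_cases hd : d < b.1
    · have h2 : Straddles t (hProj d b) ↔ 2 * d + 1 < b.1 + t := by
        simp [Straddles, hProj, star]; omega
      have : tailMonomial d v true b = vProj d b ::ₘ hProj d b ::ₘ 0 := by
        simp [tailMonomial, hh, hd]
      rw [this]
      simp only [Multiset.countP_cons, Multiset.countP_zero, h1, h2, hd, if_true]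
      split_ifs <;> rfl
    · have h2 : ¬ Straddles t (hash d b) := by
        simp [Straddles, hash, star]; omega
      have h3 : Straddles t b ↔ t ≤ b.1 := by simp [Straddles, hbt]
      have : tailMonomial d v true b = b ::ₘ hash d b ::ₘ 0 := by
        simp [tailMonomial, hh, hd]
      rw [this]
      simp only [Multiset.countP_cons, Multiset.countP_zero, h2, h3, hd, if_true, if_false]
      split_ifs <;> rfl

lemma countP_straddles_runMonomial_eq_zero (hv : v ∈ orthoI d) {t : ℕ} (l : List Pt) (b : Pt)
    (p : Bool) (hC : ∀ a ∈ b :: l, a ∈ orthoPos d v) (hch : (b :: l).Pairwise Gt)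
    (h : ¬ b.2 < t) : (runMonomial d v p (b :: l)).countP (Straddles t) = 0 := by
  rw [Multiset.countP_eq_zero]
  intro x hx hs
  have := (mem_runMonomial_bounds hv l b p hC hch hx).1
  have := hs.1
  omega

/-- Upper bound for the number of elements of `S_C` straddling `t`, in terms of a function `κ` on
the points of `C` that grows along `C` at least as fast as orthogonal depth does. The second
alternative, in which `p_v(b)` straddles `t` but `b` does not, only occurs inside a component; it is
then accounted for by the difference between `height` and depth of the element before `b`. -/
lemma countP_straddles_runMonomial_le (hv : v ∈ orthoI d) {t : ℕ} (ht : t ≤ d + 1) (κ : Pt → ℕ)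
    (l : List Pt) (b : Pt) (p : Bool) (e : ℕ) (hC : ∀ a ∈ b :: l, a ∈ orthoPos d v)
    (hch : (b :: l).Pairwise Gt) (hc : Compatible d p e b) (he : e ≤ κ b)
    (hκ : ∀ x ∈ b :: l, ∀ y ∈ b :: l, Gt x y → step d (κ x) x y ≤ κ y) :
    (runMonomial d v p (b :: l)).countP (Straddles t) = 0 ∨
    (p = false ∧ b.1 < t ∧ (runMonomial d v p (b :: l)).countP (Straddles t) ≤ 1) ∨
    ∃ a ∈ b :: l, Straddles t a ∧
      (runMonomial d v p (b :: l)).countP (Straddles t) + e ≤ height d t (κ a) a + 1 := by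
  by_cases hbt : b.2 < t
  swap
  · exact Or.inl (countP_straddles_runMonomial_eq_zero hv l b p hC hch hbt)
  have hb := hC b (by simp)
  have hB := (mem_orthoPos_iff hv).1 hb
  have hbh := height_mono (d := d) he t b
  have htail := countP_straddles_tailMonomial hv ht hb hbt p
  induction l generalizing b p e with
  | nil =>
    rw [runMonomial, htail]
    by_cases htb : t ≤ b.1
    · refine Or.inr (Or.inr ⟨b, by simp, ⟨hbt, htb⟩, ?_⟩)
      have := le_height (d := d) t e b
      have h2 : p = true → d < b.1 → 2 * d + 1 < b.1 + t → height d t e b = e + 1 := by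
        intro h1 h2 h3
        rw [height, if_pos ⟨(hc h2).1 h1, h3⟩]
      split_ifs <;> first | omega | (have := h2 ‹_› ‹_› ‹_›; omega)
    · cases p
      · exact Or.inr (Or.inl ⟨rfl, by omega, by simp⟩)
      · left
        simp [htb]; omega
  | cons c l ih =>
    have hcO := hC c (by simp)
    have hCC := (mem_orthoPos_iff hv).1 hcO
    have hbc : Gt b c := List.rel_of_pairwise_cons hch (by simp)
    have hbc1 := hbc.1
    have hκc : step d e b c ≤ κ c :=
      (step_mono he b c).trans (hκ b (by simp) c (by simp) hbc)
    have hrec := fun p hcomp hct => ih c p (step d e b c) (fun a ha => hC a (by simp [ha]))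
      hch.of_cons hcomp hκc
      (fun x hx y hy => hκ x (List.mem_cons_of_mem _ hx) y (List.mem_cons_of_mem _ hy)) hct hcO hCC
      (height_mono hκc t c) (countP_straddles_tailMonomial hv ht hcO hct p)
    have hrec : ∀ p, Compatible d p (step d e b c) c →
        (runMonomial d v p (c :: l)).countP (Straddles t) = 0 ∨
        (p = false ∧ c.1 < t ∧ (runMonomial d v p (c :: l)).countP (Straddles t) ≤ 1) ∨
        ∃ a ∈ c :: l, Straddles t a ∧ (runMonomial d v p (c :: l)).countP (Straddles t) +
          step d e b c ≤ height d t (κ a) a + 1 := by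
      intro p hcomp
      by_cases hct : c.2 < t
      · exact hrec p hcomp hct
      · exact Or.inl (countP_straddles_runMonomial_eq_zero hv l c p
          (fun a ha => hC a (by simp [ha])) hch.of_cons hct)
    have hlt : ∀ a ∈ c :: l, a.1 ≤ c.1 := by
      intro a ha
      rcases List.mem_cons.1 ha with rfl | h
      · exact le_rfl
      · exact (List.rel_of_pairwise_cons hch.of_cons h).1.le
    have hbe := le_height (d := d) t e b
    by_cases hcon : Connected d v b c
    · have hd := lt_of_connected hv hb hcO hbc hcon
      have hcon' := (connected_iff hv hb hcO).1 hcon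
      have hv1 : Straddles t (vProj d b) := by simp [Straddles, vProj, star]; omega
      have hbs : Straddles t b := ⟨hbt, by omega⟩
      rw [runMonomial, if_pos hcon, Multiset.countP_cons_of_pos _ hv1]
      rcases hrec _ (hc.of_connected hv hb hcO hbc hcon) with h | ⟨h1, h2, h3⟩ | ⟨a, h1, h2, h3⟩
      · refine Or.inr (Or.inr ⟨b, by simp, hbs, by omega⟩)
      · -- `c` ends below `t` and is connected to `b`, so `p_h(b)` straddles `t`.
        refine Or.inr (Or.inr ⟨b, by simp, hbs, ?_⟩)
        have hp : p = true := by simpa using h1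
        have : height d t e b = e + 1 := by
          rw [height, if_pos ⟨(hc hd).1 hp, by omega⟩]
        omega
      · refine Or.inr (Or.inr ⟨a, by simp [List.mem_cons.1 h1], h2, ?_⟩)
        rw [step_of_connected hv hb hcO hcon] at h3
        omega
    · rw [runMonomial, if_neg hcon, Multiset.countP_add, htail]
      have r := hrec _ (hc.of_not_connected hv hb hcO hbc hcon)
      have r : (runMonomial d v true (c :: l)).countP (Straddles t) = 0 ∨
          ∃ a ∈ c :: l, Straddles t a ∧ (runMonomial d v true (c :: l)).countP (Straddles t) +
          step d e b c ≤ height d t (κ a) a + 1 := by simpa using r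
      cases p with
      | false =>
        simp only [Bool.false_eq_true, if_false]
        rcases r with h | ⟨a, h1, h2, h3⟩
        · rw [h]
          by_cases htb : t ≤ b.1
          · exact Or.inr (Or.inr ⟨b, by simp, ⟨hbt, htb⟩, by omega⟩)
          · exact Or.inr (Or.inl ⟨trivial, by omega, by simp⟩)
        · refine Or.inr (Or.inr ⟨a, by simp [List.mem_cons.1 h1], h2, ?_⟩)
          rw [hc.of_false hv hcO] at h3
          omega
      | true =>
        simp only [if_true]
        rcases r with h | ⟨a, h1, h2, h3⟩
        · rw [h]
          by_cases htb : t ≤ b.1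
          · refine Or.inr (Or.inr ⟨b, by simp, ⟨hbt, htb⟩, ?_⟩)
            have h2 : d < b.1 → 2 * d + 1 < b.1 + t → height d t e b = e + 1 := by
              intro h2 h3
              rw [height, if_pos ⟨(hc h2).1 rfl, h3⟩]
            split_ifs <;> omega
          · left
            rw [if_neg (by omega), if_neg htb]
        · refine Or.inr (Or.inr ⟨a, by simp [List.mem_cons.1 h1], h2, ?_⟩)
          have := hlt a h1
          have := h2.2
          have hlts := lt_step (d := d) e b c
          rcases not_connected hv hb hcO hcon with hj | ⟨hj, hj'⟩
          · have hs : Odd e → step d e b c = e + 2 := by intro he; simp [step, he, hj]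
            have : d < b.1 → Odd e := fun h => (hc h).1 rfl
            split_ifs with g1 g2
            · have := hs (this g1); omega
            all_goals omega
          · split_ifs <;> omega

/-- If `κ` grows along the chain `C` at least as fast as orthogonal depth does, then the number of
elements of `S_C` straddling `t` is at most `height d t (κ a) a` for some `a` in `C` that straddles
`t`, unless it is zero. -/
lemma countP_straddles_chainMonomial_le (hv : v ∈ orthoI d) {t : ℕ} (ht : t ≤ d + 1) (κ : Pt → ℕ)
    {C : List Pt} (hC : ∀ a ∈ C, a ∈ orthoPos d v) (hch : C.Pairwise Gt) (h1 : ∀ x ∈ C, 1 ≤ κ x)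
    (hκ : ∀ x ∈ C, ∀ y ∈ C, Gt x y → step d (κ x) x y ≤ κ y) :
    (chainMonomial d v C).countP (Straddles t) = 0 ∨
    ∃ a ∈ C, Straddles t a ∧
      (chainMonomial d v C).countP (Straddles t) ≤ height d t (κ a) a := by
  rw [chainMonomial_eq]
  cases C with
  | nil => simp [runMonomial]
  | cons b l =>
    have := countP_straddles_runMonomial_le hv ht κ l b true 1 hC hch (fun _ => by simp)
      (h1 b (by simp)) hκ
    simpa using this

/-- If the tail `a` of a chain `C` straddles `t`, then its height is the exact number of elements of
`S_C` straddling `t`. -/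
lemma countP_straddles_runMonomial_concat (hv : v ∈ orthoI d) {t : ℕ} (ht : t ≤ d + 1)
    {a : Pt} (hat : Straddles t a) (l : List Pt) (b : Pt) (p : Bool) (e : ℕ)
    (hC : ∀ a ∈ b :: l, a ∈ orthoPos d v)
    (hch : (b :: l).Pairwise Gt) (hc : Compatible d p e b) (hla : (b :: l).getLast? = some a) :
    (runMonomial d v p (b :: l)).countP (Straddles t) + e =
      height d t (depthAt d e (b :: l) a) a + 1 := by
  have hb := hC b (by simp)
  have hB := (mem_orthoPos_iff hv).1 hb
  induction l generalizing b p e with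
  | nil =>
    obtain rfl : b = a := by simpa using hla
    rw [runMonomial, countP_straddles_tailMonomial hv ht hb hat.1 p, depthAt, height]
    have h2 := hat.2
    by_cases hd : d < b.1
    · have := hc hd
      cases p
      · have he : ¬ Odd e := by simpa using this
        simp [he]; omega
      · have he : Odd e := by simpa using this
        simp only [he, hd, if_true, true_and]
        split_ifs <;> omega
    · have h3 : ¬ (Odd e ∧ 2 * d + 1 < b.1 + t) := fun h => by have := h.2; omega
      rw [if_neg h3]
      cases p <;> simp [hd, h2] <;> omega
  | cons c l ih =>
    have hcO := hC c (by simp)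
    have hCC := (mem_orthoPos_iff hv).1 hcO
    have hbc : Gt b c := List.rel_of_pairwise_cons hch (by simp)
    have hbc1 := hbc.1
    have hbc2 := hbc.2
    have hla' : (c :: l).getLast? = some a := by simpa [List.getLast?_cons] using hla
    have hmem : a ∈ c :: l := List.mem_of_getLast? hla'
    have hac : a.1 ≤ c.1 ∧ c.2 ≤ a.2 := by
      rcases List.mem_cons.1 hmem with rfl | h
      · exact ⟨le_rfl, le_rfl⟩
      · have := (List.rel_of_pairwise_cons hch.of_cons h)
        exact ⟨this.1.le, this.2.le⟩
    have hat1 := hat.1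
    have hat2 := hat.2
    have hba : b ≠ a := by rintro rfl; omega
    rw [depthAt, if_neg hba]
    have hrec := fun p hcomp => ih c p (step d e b c) (fun a ha => hC a (by simp [ha]))
      hch.of_cons hcomp hla' hcO hCC
    by_cases hcon : Connected d v b c
    · have hrec := hrec _ (hc.of_connected hv hb hcO hbc hcon)
      rw [← hrec]
      have hv1 : Straddles t (vProj d b) := by simp [Straddles, vProj, star]; omega
      rw [runMonomial, if_pos hcon, Multiset.countP_cons_of_pos _ hv1,
        step_of_connected hv hb hcO hcon]
      omega
    · have hrec := hrec _ (hc.of_not_connected hv hb hcO hbc hcon)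
      rw [← hrec, runMonomial, if_neg hcon, Multiset.countP_add,
        countP_straddles_tailMonomial hv ht hb (by omega)]
      cases p with
      | false =>
        rw [hc.of_false hv hcO]
        simp; omega
      | true =>
        rw [if_pos rfl]
        by_cases hd : d < b.1
        · have he : Odd e := (hc hd).1 rfl
          rcases not_connected hv hb hcO hcon with hj | ⟨hj, hj'⟩
          · have : step d e b c = e + 2 := by simp [step, he, hj]
            rw [this, if_pos hd, if_pos (by omega)]
            omega
          · have : step d e b c = e + 1 := by simp [step, hj']
            rw [this, if_pos hd, if_neg (by omega)]
            omega
        · have : step d e b c = e + 1 := by rw [step, if_neg (by omega)]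
          rw [this, if_neg hd, if_pos (by omega)]
          omega

lemma exists_chain_height_eq (hv : v ∈ orthoI d) {S : Multiset Pt}
    (hS : ∀ a ∈ S, a ∈ orthoPos d v) {t : ℕ} (ht : t ≤ d + 1) {a : Pt} (ha : a ∈ S)
    (hat : Straddles t a) :
    ∃ C, IsChainIn S C ∧
      (chainMonomial d v C).countP (Straddles t) = height d t (oDepth d v S a) a := by
  obtain ⟨C, hC, he⟩ := (reach_oDepth hv hS ha).exists_chain
  refine ⟨C ++ [a], hC, ?_⟩
  rw [chainMonomial_eq, ← he]
  obtain ⟨b, l, h⟩ : ∃ b l, C ++ [a] = b :: l := List.exists_cons_of_ne_nil (by simp)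
  have hl : (C ++ [a]).getLast? = some a := by simp
  rw [h] at hC hl ⊢
  have := countP_straddles_runMonomial_concat hv ht hat l b true 1
    (fun x hx => hS x (hC.2 x hx)) hC.1 (fun _ => by simp) hl
  omega

/-! ### Comparing elements of `I(d, 2d)` by counting -/

/-- Entrywise comparison of sorted lists of the same length by counting the entries above
thresholds. -/
lemma forall₂_le_iff_countP (l₁ l₂ : List ℕ) (h₁ : l₁.Pairwise (· ≤ ·)) (h₂ : l₂.Pairwise (· ≤ ·))
    (h : l₁.length = l₂.length) :
    List.Forall₂ (· ≤ ·) l₁ l₂ ↔ ∀ t, l₁.countP (t ≤ ·) ≤ l₂.countP (t ≤ ·) := by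
  constructor
  · intro h t
    clear h₁ h₂
    induction h with
    | nil => simp
    | @cons a b l₁ l₂ hab h ih =>
      simp only [List.countP_cons]
      have := ih (by simpa using h)
      by_cases h1 : t ≤ a
      · simp [h1, h1.trans hab, this]
      · simp [h1]; omega
  · intro hc
    induction l₁ generalizing l₂ with
    | nil =>
      rw [List.eq_nil_of_length_eq_zero h.symm]
      exact .nil
    | cons a s ih =>
      obtain ⟨b, r, rfl⟩ : ∃ b r, l₂ = b :: r :=
        List.exists_cons_of_ne_nil (by rintro rfl; simp at h)
      have hs := List.pairwise_cons.1 h₁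
      have hr := List.pairwise_cons.1 h₂
      have hlen : s.length = r.length := by simpa using h
      have full : ∀ (l : List ℕ) t, (∀ x ∈ l, t ≤ x) → l.countP (t ≤ ·) = l.length := by
        intro l t h
        rw [List.countP_eq_length]
        simpa using h
      have hab : a ≤ b := by
        by_contra hlt
        have h1 := hc a
        have h2 := full (a :: s) a (by simpa using hs.1)
        have h3 : r.countP (a ≤ ·) ≤ r.length := List.countP_le_length
        rw [h2, List.countP_cons_of_neg (by simpa using hlt)] at h1
        simp at h1
        omega
      refine .cons hab (ih r hs.2 hr.2 hlen fun t => ?_)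
      by_cases hta : t ≤ a
      · rw [full s t fun x hx => hta.trans (hs.1 x hx),
          full r t fun x hx => hta.trans (hab.trans (hr.1 x hx)), hlen]
      · by_cases htb : t ≤ b
        · rw [full r t fun x hx => htb.trans (hr.1 x hx), ← hlen]
          exact List.countP_le_length
        · have := hc t
          rwa [List.countP_cons_of_neg (by simpa using hta),
            List.countP_cons_of_neg (by simpa using htb)] at this

lemma le_iff_card_filter {u w : Finset ℕ} (h : u.card = w.card) :
    Le u w ↔ ∀ t, (u.filter (t ≤ ·)).card ≤ (w.filter (t ≤ ·)).card := by
  have key : ∀ (u : Finset ℕ) (t : ℕ), (u.sort (· ≤ ·)).countP (t ≤ ·) =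
      (u.filter (t ≤ ·)).card := by
    intro u t
    have h1 : (u.filter (t ≤ ·)).card = Multiset.countP (t ≤ ·) u.val := by
      rw [Multiset.countP_eq_card_filter]; rfl
    rw [h1]
    conv_rhs => rw [← Finset.sort_eq u (· ≤ ·), Multiset.coe_countP]
  rw [Le, forall₂_le_iff_countP _ _ (Finset.pairwise_sort _ _) (Finset.pairwise_sort _ _)
    (by simpa using h)]
  simp only [key]

/-- A monomial in `N(v)` that is symmetric under `#`. -/
structure IsSymm (d : ℕ) (v : Finset ℕ) (D : Multiset Pt) : Prop where
  mem_pos : ∀ x ∈ D, x ∈ pos d v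
  map_hash : D.map (hash d) = D

/-- A monomial in `N(v)` with distinct columns, whose rows are the reflections of its columns and
whose straddling numbers are symmetric about the centre. This is what is needed to see that the
attached element lies in `I(d)` up to a parity condition. -/
structure IsSymmDistinct (d : ℕ) (v : Finset ℕ) (D : Multiset Pt) : Prop where
  mem_pos : ∀ x ∈ D, x ∈ pos d v
  map_fst : D.map Prod.fst = (D.map Prod.snd).map (star d)
  nodup_snd : (D.map Prod.snd).Nodup
  reflect : ∀ t ≤ 2 * d + 2, D.countP (Straddles (2 * d + 2 - t)) = D.countP (Straddles t)

lemma IsSymm.map_fst (hv : v ∈ orthoI d) {D : Multiset Pt} (h : IsSymm d v D) :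
    D.map Prod.fst = (D.map Prod.snd).map (star d) := by
  conv_rhs => rw [← h.map_hash]
  simp only [Multiset.map_map, Function.comp_def, hash]
  refine Multiset.map_congr rfl fun x hx => ?_
  have := (mem_pos_iff hv).1 (h.mem_pos x hx)
  rw [star_star (by omega)]

lemma IsSymmDistinct.nodup_fst (hv : v ∈ orthoI d) {D : Multiset Pt} (h : IsSymmDistinct d v D) :
    (D.map Prod.fst).Nodup := by
  rw [h.map_fst]
  refine Multiset.Nodup.map_on ?_ h.nodup_snd
  intro x hx y hy hxy
  obtain ⟨a, ha, rfl⟩ := Multiset.mem_map.1 hx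
  obtain ⟨b, hb, rfl⟩ := Multiset.mem_map.1 hy
  have := (mem_pos_iff hv).1 (h.mem_pos a ha)
  have := (mem_pos_iff hv).1 (h.mem_pos b hb)
  unfold star at hxy
  omega

/-- Passing from `v` to the attached element replaces each column `c` by the row `r` of the same
point, which raises the number of entries `≥ t` by one exactly when the point straddles `t`. -/
lemma IsSymmDistinct.card_filter_assoc (hv : v ∈ orthoI d) {D : Multiset Pt}
    (h : IsSymmDistinct d v D) (t : ℕ) :
    ((assoc v D).filter (t ≤ ·)).card = (v.filter (t ≤ ·)).card + D.countP (Straddles t) := by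
  have key : ∀ f : Pt → ℕ, (D.map f).Nodup →
      ((D.map f).toFinset.filter (t ≤ ·)).card = D.countP (fun x => t ≤ f x) := by
    intro f hf
    rw [← Multiset.toFinset_filter, Multiset.toFinset_card_of_nodup (hf.filter _),
      ← Multiset.countP_eq_card_filter, Multiset.countP_map, Multiset.countP_eq_card_filter]
  have h1 := key _ h.nodup_snd
  have h2 := key _ (h.nodup_fst hv)
  have h3 : D.countP (fun x => t ≤ x.1) = D.countP (fun x => t ≤ x.2) + D.countP (Straddles t) := by
    have hlt : ∀ x ∈ D, x.2 < x.1 := fun x hx => ((mem_pos_iff hv).1 (h.mem_pos x hx)).2.1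
    clear h1 h2 key h
    induction D using Multiset.induction with
    | empty => simp
    | cons a D ih =>
      have ih := ih fun x hx => hlt x (by simp [hx])
      have := hlt a (by simp)
      simp only [Multiset.countP_cons, ih]
      by_cases g1 : t ≤ a.2
      · have g2 : ¬ Straddles t a := fun h => by have := h.1; omega
        rw [if_pos (by omega), if_pos g1, if_neg g2]; omega
      · by_cases g3 : t ≤ a.1
        · have g2 : Straddles t a := ⟨by omega, g3⟩
          rw [if_pos g3, if_neg g1, if_pos g2]; omega
        · have g2 : ¬ Straddles t a := fun h => g3 h.2
          rw [if_neg g3, if_neg g1, if_neg g2]; omega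
  have hdisj : Disjoint ((v \ (D.map Prod.snd).toFinset).filter (t ≤ ·))
      ((D.map Prod.fst).toFinset.filter (t ≤ ·)) := by
    refine Finset.disjoint_filter_filter (Finset.disjoint_left.2 fun k hk hk' => ?_)
    obtain ⟨x, hx, rfl⟩ := Multiset.mem_map.1 (Multiset.mem_toFinset.1 hk')
    exact ((mem_pos_iff hv).1 (h.mem_pos x hx)).2.2.2.1 (Finset.mem_sdiff.1 hk).1
  have hsub : (D.map Prod.snd).toFinset.filter (t ≤ ·) ⊆ v.filter (t ≤ ·) := by
    refine Finset.filter_subset_filter _ fun k hk => ?_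
    obtain ⟨x, hx, rfl⟩ := Multiset.mem_map.1 (Multiset.mem_toFinset.1 hk)
    exact ((mem_pos_iff hv).1 (h.mem_pos x hx)).2.2.2.2
  have hsd : (v \ (D.map Prod.snd).toFinset).filter (t ≤ ·) =
      v.filter (t ≤ ·) \ (D.map Prod.snd).toFinset.filter (t ≤ ·) := by
    ext k; simp only [Finset.mem_filter, Finset.mem_sdiff]; tauto
  rw [assoc, Finset.filter_union, Finset.card_union_of_disjoint hdisj, hsd,
    Finset.card_sdiff_of_subset hsub]
  have := Finset.card_le_card hsub
  omega

lemma card_of_mem_orthoI (hv : v ∈ orthoI d) : v.card = d := (Finset.mem_powersetCard.1 hv.1).2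

lemma IsSymmDistinct.card_assoc (hv : v ∈ orthoI d) {D : Multiset Pt}
    (h : IsSymmDistinct d v D) : (assoc v D).card = d := by
  have := h.card_filter_assoc hv 0
  have h0 : D.countP (Straddles 0) = 0 := by
    rw [Multiset.countP_eq_zero]; intro a _ h; exact absurd h.1 (by omega)
  simpa [h0, card_of_mem_orthoI hv] using this

lemma IsSymmDistinct.le_assoc_iff (hv : v ∈ orthoI d) {D E : Multiset Pt}
    (hD : IsSymmDistinct d v D) (hE : IsSymmDistinct d v E) :
    Le (assoc v D) (assoc v E) ↔ ∀ t, D.countP (Straddles t) ≤ E.countP (Straddles t) := by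
  rw [le_iff_card_filter (by rw [hD.card_assoc hv, hE.card_assoc hv])]
  simp only [hD.card_filter_assoc hv, hE.card_filter_assoc hv, add_le_add_iff_left]

lemma straddles_hash (hv : v ∈ orthoI d) {x : Pt} (hx : x ∈ pos d v) {t : ℕ} (ht : t ≤ 2 * d + 2) :
    Straddles (2 * d + 2 - t) (hash d x) ↔ Straddles t x := by
  have := (mem_pos_iff hv).1 hx
  simp only [Straddles, hash, star]
  omega

lemma IsSymm.countP_straddles_reflect (hv : v ∈ orthoI d) {D : Multiset Pt}
    (h : IsSymm d v D) {t : ℕ} (ht : t ≤ 2 * d + 2) :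
    D.countP (Straddles (2 * d + 2 - t)) = D.countP (Straddles t) := by
  conv_lhs => rw [← h.map_hash]
  rw [Multiset.countP_map, ← Multiset.countP_eq_card_filter]
  exact Multiset.countP_congr rfl fun x hx => propext (straddles_hash hv (h.mem_pos x hx) ht)

lemma IsSymm.isSymmDistinct (hv : v ∈ orthoI d) {D : Multiset Pt} (h : IsSymm d v D)
    (hn : (D.map Prod.snd).Nodup) : IsSymmDistinct d v D :=
  ⟨h.mem_pos, h.map_fst hv, hn, fun _ ht => h.countP_straddles_reflect hv ht⟩

/-- For symmetric monomials it suffices to compare at thresholds up to the centre. -/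
lemma IsSymmDistinct.countP_straddles_le (hv : v ∈ orthoI d) {D E : Multiset Pt}
    (hD : IsSymmDistinct d v D) (hE : IsSymmDistinct d v E)
    (h : ∀ t ≤ d + 1, D.countP (Straddles t) ≤ E.countP (Straddles t)) (t : ℕ) :
    D.countP (Straddles t) ≤ E.countP (Straddles t) := by
  by_cases h1 : t ≤ d + 1
  · exact h t h1
  by_cases h2 : t ≤ 2 * d + 2
  · rw [← hD.reflect t h2, ← hE.reflect t h2]
    exact h _ (by omega)
  · have : D.countP (Straddles t) = 0 := by
      rw [Multiset.countP_eq_zero]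
      intro x hx hs
      have := (mem_pos_iff hv).1 (hD.mem_pos x hx)
      have := hs.2
      omega
    omega

/-- The number of entries exceeding `d` differs from that of `v` by the number of points straddling
`d + 1`. -/
lemma IsSymmDistinct.assoc_mem_orthoI (hv : v ∈ orthoI d) {D : Multiset Pt}
    (h : IsSymmDistinct d v D) (he : Even (D.countP (Straddles (d + 1)))) :
    assoc v D ∈ orthoI d := by
  have hcol : ∀ k ∈ D.map Prod.snd, k ∈ v := by
    intro k hk
    obtain ⟨x, hx, rfl⟩ := Multiset.mem_map.1 hk
    exact ((mem_pos_iff hv).1 (h.mem_pos x hx)).2.2.2.2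
  have hrow : ∀ k, 1 ≤ k → k ≤ 2 * d → (k ∈ D.map Prod.fst ↔ star d k ∈ D.map Prod.snd) := by
    intro k h1 h2
    rw [h.map_fst, Multiset.mem_map]
    constructor
    · rintro ⟨c, hc, rfl⟩
      have := mem_Icc_of_mem hv (hcol c hc)
      rwa [star_star (by omega)]
    · intro hk
      exact ⟨_, hk, star_star (by omega)⟩
  refine ⟨Finset.mem_powersetCard.2 ⟨?_, h.card_assoc hv⟩, ?_, ?_⟩
  · intro k hk
    rw [Finset.mem_Icc]
    rcases Finset.mem_union.1 hk with hk | hk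
    · exact mem_Icc_of_mem hv (Finset.mem_sdiff.1 hk).1
    · obtain ⟨x, hx, rfl⟩ := Multiset.mem_map.1 (Multiset.mem_toFinset.1 hk)
      have := (mem_pos_iff hv).1 (h.mem_pos x hx)
      omega
  · intro k hk
    obtain ⟨h1, h2⟩ := Finset.mem_Icc.1 hk
    have e1 := star_mem_iff hv h1 h2
    have e2 := hrow k h1 h2
    have e3 := hrow (star d k) (by unfold star; omega) (by unfold star; omega)
    rw [star_star (by omega)] at e3
    have e4 := hcol k
    have e5 := hcol (star d k)
    simp only [assoc, Finset.mem_union, Finset.mem_sdiff, Multiset.mem_toFinset]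
    unfold Xor
    tauto
  · have h1 := h.card_filter_assoc hv (d + 1)
    have h2 := hv.2.2
    have h3 : ∀ u : Finset ℕ, u.filter (fun k => d < k) = u.filter (d + 1 ≤ ·) := fun u => rfl
    rw [h3] at h2 ⊢
    rw [h1]
    exact h2.add he

/-! ### The monomial of a chain is symmetric and distinguished -/

lemma hash_vProj (hv : v ∈ orthoI d) {a : Pt} (ha : a ∈ orthoPos d v) :
    hash d (vProj d a) = vProj d a := by
  have := (mem_orthoPos_iff hv).1 ha
  simp only [hash, vProj]
  rw [star_star (by omega)]

lemma hash_hProj (hv : v ∈ orthoI d) {a : Pt} (ha : a ∈ orthoPos d v) :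
    hash d (hProj d a) = hProj d a := by
  have := (mem_orthoPos_iff hv).1 ha
  simp only [hash, hProj]
  rw [star_star (by omega)]

lemma isSymm_tailMonomial (hv : v ∈ orthoI d) {a : Pt} (ha : a ∈ orthoPos d v) (p : Bool) :
    IsSymm d v (tailMonomial d v p a) ∧ ((tailMonomial d v p a).map Prod.snd).Nodup := by
  have h1 := vProj_mem_pos hv ha
  have h2 := orthoPos_subset_pos hv ha
  have h3 := hash_mem_pos hv h2
  have h4 := hash_vProj hv ha
  have h5 := hash_hProj hv ha
  have h6 := hash_hash hv h2
  have h7 := (mem_orthoPos_iff hv).1 ha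
  unfold tailMonomial
  split_ifs with g1 g2
  · refine ⟨⟨by simp [h1, g2], by simp [h4, h5]⟩, ?_⟩
    simp [vProj, hProj, star]; omega
  · refine ⟨⟨by simp [h2, h3], ?_⟩, ?_⟩
    · simp [h6]; exact Multiset.pair_comm _ _
    · simp [hash, star]; omega
  · exact ⟨⟨by simp [h1], by simp [h4]⟩, by simp⟩

lemma tailMonomial_snd (a : Pt) (p : Bool) {k : ℕ}
    (hk : k ∈ (tailMonomial d v p a).map Prod.snd) : k = a.2 ∨ k = star d a.1 := by
  unfold tailMonomial at hk
  split_ifs at hk <;> simp [vProj, hProj, hash] at hk <;> tauto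

/-- Column indices of `S_C` are column indices or reflected row indices of `C`. -/
lemma runMonomial_snd (l : List Pt) (b : Pt) (p : Bool) {k : ℕ}
    (hk : k ∈ (runMonomial d v p (b :: l)).map Prod.snd) :
    ∃ y ∈ b :: l, k = y.2 ∨ k = star d y.1 := by
  induction l generalizing b p with
  | nil => exact ⟨b, by simp, tailMonomial_snd b p hk⟩
  | cons c l ih =>
    have key : ∀ p, k ∈ (runMonomial d v p (c :: l)).map Prod.snd →
        ∃ y ∈ b :: c :: l, k = y.2 ∨ k = star d y.1 := by
      intro p h
      obtain ⟨y, hy, h⟩ := ih c p h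
      exact ⟨y, List.mem_cons_of_mem _ hy, h⟩
    rw [runMonomial] at hk
    split_ifs at hk
    · rw [Multiset.map_cons, Multiset.mem_cons] at hk
      rcases hk with hk | hk
      · exact ⟨b, by simp, Or.inl hk⟩
      · exact key _ hk
    · rw [Multiset.map_add, Multiset.mem_add] at hk
      rcases hk with hk | hk
      · exact ⟨b, by simp, tailMonomial_snd b p hk⟩
      · exact key _ hk

lemma isSymm_runMonomial (hv : v ∈ orthoI d) (l : List Pt) (b : Pt) (p : Bool)
    (hC : ∀ a ∈ b :: l, a ∈ orthoPos d v) (hch : (b :: l).Pairwise Gt) :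
    IsSymm d v (runMonomial d v p (b :: l)) ∧
      ((runMonomial d v p (b :: l)).map Prod.snd).Nodup := by
  induction l generalizing b p with
  | nil => exact isSymm_tailMonomial hv (hC b (by simp)) p
  | cons c l ih =>
    have hb := hC b (by simp)
    have hcO := hC c (by simp)
    have hB := (mem_orthoPos_iff hv).1 hb
    have hbc : Gt b c := List.rel_of_pairwise_cons hch (by simp)
    have hbc2 := hbc.2
    have hbc1 := hbc.1
    have hr := fun p => ih c p (fun a ha => hC a (by simp [ha])) hch.of_cons
    have hcols : ∀ p k, k ∈ (runMonomial d v p (c :: l)).map Prod.snd → b.2 < k := by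
      intro p k hk
      obtain ⟨x, hx, rfl⟩ := Multiset.mem_map.1 hk
      have := (mem_runMonomial_bounds hv l c p (fun a ha => hC a (by simp [ha])) hch.of_cons hx).1
      omega
    rw [runMonomial]
    split_ifs with hcon
    · obtain ⟨h, hn⟩ := hr (!p)
      refine ⟨⟨?_, ?_⟩, ?_⟩
      · intro x hx
        rcases Multiset.mem_cons.1 hx with rfl | hx
        · exact vProj_mem_pos hv hb
        · exact h.mem_pos x hx
      · rw [Multiset.map_cons, hash_vProj hv hb, h.map_hash]
      · rw [Multiset.map_cons, Multiset.nodup_cons]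
        exact ⟨fun hk => lt_irrefl _ (hcols _ _ hk), hn⟩
    · obtain ⟨h, hn⟩ := hr true
      obtain ⟨h', hn'⟩ := isSymm_tailMonomial hv hb p
      refine ⟨⟨?_, ?_⟩, ?_⟩
      · intro x hx
        rcases Multiset.mem_add.1 hx with hx | hx
        · exact h'.mem_pos x hx
        · exact h.mem_pos x hx
      · rw [Multiset.map_add, h.map_hash, h'.map_hash]
      · rw [Multiset.map_add, Multiset.nodup_add]
        refine ⟨hn', hn, Multiset.disjoint_left.2 fun {k} hk hk' => ?_⟩
        rcases tailMonomial_snd b p hk with rfl | rfl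
        · exact lt_irrefl _ (hcols _ _ hk')
        · obtain ⟨y, hy, he⟩ := runMonomial_snd l c true hk'
          have hyO := (mem_orthoPos_iff hv).1 (hC y (by simp [List.mem_cons.1 hy]))
          have hyc : y.1 ≤ c.1 ∧ c.2 ≤ y.2 := by
            rcases List.mem_cons.1 hy with rfl | h
            · exact ⟨le_rfl, le_rfl⟩
            · have := (List.rel_of_pairwise_cons hch.of_cons h)
              exact ⟨this.1.le, this.2.le⟩
          have := not_connected hv hb hcO hcon
          unfold star at he
          omega

lemma isSymmDistinct_chainMonomial (hv : v ∈ orthoI d) {C : List Pt}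
    (hC : ∀ a ∈ C, a ∈ orthoPos d v) (hch : C.Pairwise Gt) :
    IsSymmDistinct d v (chainMonomial d v C) := by
  rw [chainMonomial_eq]
  cases C with
  | nil =>
    have : IsSymm d v 0 := ⟨by simp, by simp⟩
    exact this.isSymmDistinct hv (by simp)
  | cons b l =>
    obtain ⟨h, hn⟩ := isSymm_runMonomial hv l b true hC hch
    exact h.isSymmDistinct hv hn

/-! ### Blocks of an ascending list -/

/-- Ascending in both row and column indices. -/
abbrev Asc (L : List Pt) : Prop := L.Pairwise (fun a b => a.1 ≤ b.1 ∧ a.2 ≤ b.2)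

/-- The points `(r₁, c₂), (r₂, c₃), …` for a list `(r₁, c₁), (r₂, c₂), …`. -/
def interlace (L : List Pt) : List Pt := List.zipWith (fun a b => (a.1, b.2)) L L.tail

/-- The points `w(B)` for the blocks `B` of an ascending list, by recursion along the list. For
points `(r, c)`, `(R, C)` of `N(v)`, the point `(r, C)` lies in `N(v)` exactly when `C < r`. -/
def tops : List Pt → List Pt
  | [] => []
  | [a] => [a]
  | a :: b :: l =>
    if b.2 < a.1 then (tops (b :: l)).modifyHead (fun T => (T.1, a.2)) else a :: tops (b :: l)

/-- The cut of a list into its blocks. -/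
def cutBlocks (d : ℕ) (v : Finset ℕ) (L : List Pt) : List (List Pt) :=
  L.splitBy (fun a b => decide ((a.1, b.2) ∈ pos d v))

lemma cutBlocks_cons_cons (hv : v ∈ orthoI d) {a b : Pt} (ha : a ∈ pos d v) (hb : b ∈ pos d v)
    (l : List Pt) : cutBlocks d v (a :: b :: l) =
      if b.2 < a.1 then (cutBlocks d v (b :: l)).modifyHead (a :: ·)
      else [a] :: cutBlocks d v (b :: l) := by
  have : (a.1, b.2) ∈ pos d v ↔ b.2 < a.1 := by
    rw [mem_pos_iff hv] at *
    tauto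
  simp [cutBlocks, splitBy_cons_cons, this]

lemma exists_cutBlocks_eq (hv : v ∈ orthoI d) (b : Pt) (l : List Pt)
    (h : ∀ x ∈ b :: l, x ∈ pos d v) : ∃ D Ds, cutBlocks d v (b :: l) = (b :: D) :: Ds := by
  cases l with
  | nil => exact ⟨[], [], rfl⟩
  | cons c l =>
    rw [cutBlocks_cons_cons hv (h b (by simp)) (h c (by simp))]
    split_ifs
    · have : cutBlocks d v (c :: l) ≠ [] := by simp [cutBlocks]
      obtain ⟨D, Ds, h⟩ := List.exists_cons_of_ne_nil this
      exact ⟨D, Ds, by rw [h]; rfl⟩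
    · exact ⟨_, _, rfl⟩

lemma map_blockTop_cutBlocks (hv : v ∈ orthoI d) (L : List Pt) (h : ∀ x ∈ L, x ∈ pos d v) :
    (cutBlocks d v L).map blockTop = tops L := by
  match L, h with
  | [], _ => rfl
  | [a], _ => rfl
  | a :: b :: l, h =>
    have ih := map_blockTop_cutBlocks hv (b :: l) fun x hx => h x (List.mem_cons_of_mem _ hx)
    obtain ⟨D, Ds, hD⟩ := exists_cutBlocks_eq hv b l fun x hx => h x (List.mem_cons_of_mem _ hx)
    rw [cutBlocks_cons_cons hv (h a (by simp)) (h b (by simp)), tops, ← ih, hD]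
    split_ifs
    · simp [blockTop]
    · simp [blockTop]

/-- The interlaced points that straddle a cut between blocks are those outside `N(v)`. -/
lemma flatMap_blockRest_cutBlocks (hv : v ∈ orthoI d) (L : List Pt) (h : ∀ x ∈ L, x ∈ pos d v) :
    (cutBlocks d v L).flatMap blockRest = (interlace L).filter (fun x => x ∈ pos d v) := by
  match L, h with
  | [], _ => rfl
  | [a], _ => rfl
  | a :: b :: l, h =>
    have ih := flatMap_blockRest_cutBlocks hv (b :: l) fun x hx => h x (List.mem_cons_of_mem _ hx)
    obtain ⟨D, Ds, hD⟩ := exists_cutBlocks_eq hv b l fun x hx => h x (List.mem_cons_of_mem _ hx)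
    have hi : interlace (a :: b :: l) = (a.1, b.2) :: interlace (b :: l) := rfl
    have ha := (mem_pos_iff hv).1 (h a (by simp))
    have hb := (mem_pos_iff hv).1 (h b (by simp))
    have : (a.1, b.2) ∈ pos d v ↔ b.2 < a.1 := by
      rw [mem_pos_iff hv]; simp only; tauto
    rw [cutBlocks_cons_cons hv (h a (by simp)) (h b (by simp)), hi]
    split_ifs with hc
    · rw [List.filter_cons_of_pos (by simpa [this] using hc), ← ih, hD]
      rfl
    · rw [List.filter_cons_of_neg (by simpa [this] using hc), ← ih]
      rfl

lemma length_cutBlocks_add (hv : v ∈ orthoI d) (L : List Pt) (h : ∀ x ∈ L, x ∈ pos d v) :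
    (cutBlocks d v L).length + ((cutBlocks d v L).flatMap blockRest).length = L.length := by
  match L, h with
  | [], _ => rfl
  | [a], _ => rfl
  | a :: b :: l, h =>
    have ih := length_cutBlocks_add hv (b :: l) fun x hx => h x (List.mem_cons_of_mem _ hx)
    obtain ⟨D, Ds, hD⟩ := exists_cutBlocks_eq hv b l fun x hx => h x (List.mem_cons_of_mem _ hx)
    rw [cutBlocks_cons_cons hv (h a (by simp)) (h b (by simp))]
    split_ifs with hc
    · rw [hD] at ih ⊢
      simp [blockRest] at ih ⊢
      omega
    · simp [blockRest] at ih ⊢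
      omega

/-- The first block starts at the first element of the list, and all blocks end in later rows. -/
lemma exists_tops_eq (b : Pt) (l : List Pt) (hL : Asc (b :: l)) :
    ∃ T Ts, tops (b :: l) = T :: Ts ∧ T.2 = b.2 ∧ ∀ y ∈ T :: Ts, b.1 ≤ y.1 := by
  induction l generalizing b with
  | nil => exact ⟨b, [], rfl, rfl, by simp⟩
  | cons c l ih =>
    obtain ⟨T, Ts, h1, h2, h3⟩ := ih c hL.of_cons
    have hbc := List.rel_of_pairwise_cons hL (a' := c) (by simp)
    rw [tops, h1]
    split_ifs
    · refine ⟨(T.1, b.2), Ts, rfl, rfl, fun y hy => ?_⟩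
      rcases List.mem_cons.1 hy with rfl | hy
      · exact hbc.1.trans (h3 T (by simp))
      · exact hbc.1.trans (h3 y (by simp [hy]))
    · refine ⟨b, _, rfl, rfl, fun y hy => ?_⟩
      rcases List.mem_cons.1 hy with rfl | hy
      · exact le_rfl
      · exact hbc.1.trans (h3 y hy)

lemma asc_snd_le {b : Pt} {l : List Pt} (hL : Asc (b :: l)) {y : Pt} (hy : y ∈ b :: l) :
    b.1 ≤ y.1 ∧ b.2 ≤ y.2 := by
  rcases List.mem_cons.1 hy with rfl | h
  · exact ⟨le_rfl, le_rfl⟩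
  · exact List.rel_of_pairwise_cons hL h

/-- The blocks of an ascending list cover the same thresholds as its elements, and they do so
without overlap. -/
lemma countP_straddles_tops (t : ℕ) (L : List Pt) (hL : Asc L) (hp : ∀ x ∈ L, x.2 < x.1) :
    (tops L).countP (Straddles t) = if ∃ x ∈ L, Straddles t x then 1 else 0 := by
  match L, hL, hp with
  | [], _, _ => simp [tops]
  | [a], _, _ => simp [tops, List.countP_cons]
  | a :: b :: l, hL, hp =>
    have ih := countP_straddles_tops t (b :: l) hL.of_cons
      fun x hx => hp x (List.mem_cons_of_mem _ hx)
    obtain ⟨T, Ts, h1, h2, h3⟩ := exists_tops_eq b l hL.of_cons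
    have hab := List.rel_of_pairwise_cons hL (a' := b) (by simp)
    have hT := h3 T (by simp)
    have hpa := hp a (by simp)
    have key : t ≤ b.2 → (tops (b :: l)).countP (Straddles t) = 0 := by
      intro h
      rw [ih, if_neg]
      rintro ⟨x, hx, hs⟩
      have := (asc_snd_le hL.of_cons hx).2
      have := hs.1
      omega
    rw [tops]
    have hex : (∃ x ∈ a :: b :: l, Straddles t x) ↔
        (Straddles t a ∨ ∃ x ∈ b :: l, Straddles t x) := by simp
    rw [if_congr hex rfl rfl]
    rw [h1] at ih key ⊢
    split_ifs with hc hs hs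
    · rw [List.modifyHead_cons]
      by_cases hTs : Straddles t T
      · have h4 : Straddles t (T.1, a.2) := by
          unfold Straddles at hTs ⊢; simp only; omega
        rw [List.countP_cons_of_pos (by simpa using h4)]
        rw [List.countP_cons_of_pos (by simpa using hTs)] at ih
        split_ifs at ih; omega
      · rcases hs with hs | hs
        · have htb : t ≤ b.2 := by unfold Straddles at hs hTs; omega
          have := key htb
          have h4 : Straddles t (T.1, a.2) := by
            unfold Straddles at hs ⊢; simp only; omega
          rw [List.countP_cons_of_pos (by simpa using h4)]
          rw [List.countP_cons_of_neg (by simpa using hTs)] at this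
          omega
        · rw [if_pos hs, List.countP_cons_of_neg (by simpa using hTs)] at ih
          by_cases h4 : Straddles t (T.1, a.2)
          · have htb : t ≤ b.2 := by
              unfold Straddles at h4 hTs; simp only at h4; omega
            have := key htb
            rw [List.countP_cons_of_neg (by simpa using hTs)] at this
            omega
          · rw [List.countP_cons_of_neg (by simpa using h4)]
            exact ih
    · rw [not_or] at hs
      rw [if_neg hs.2] at ih
      rw [List.modifyHead_cons]
      by_cases hTs : Straddles t T
      · rw [List.countP_cons_of_pos (by simpa using hTs)] at ih
        omega
      · have h4 : ¬ Straddles t (T.1, a.2) := by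
          have := hs.1
          unfold Straddles at *; simp only; omega
        rw [List.countP_cons_of_neg (by simpa using hTs)] at ih
        rwa [List.countP_cons_of_neg (by simpa using h4)]
    · by_cases ha : Straddles t a
      · have htb : t ≤ b.2 := by have := ha.2; omega
        rw [List.countP_cons_of_pos (by simpa using ha), key htb]
      · rw [List.countP_cons_of_neg (by simpa using ha), ih, if_pos (hs.resolve_left ha)]
    · rw [not_or] at hs
      rw [List.countP_cons_of_neg (by simpa using hs.1), ih, if_neg hs.2]

/-- The columns of the block tops are the columns that lie in none of the intervals `(y.2, y.1]`.
They increase strictly, so there are no repetitions. -/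
lemma tops_snd (L : List Pt) (hL : Asc L) (hp : ∀ x ∈ L, x.2 < x.1)
    (hne : ∀ x ∈ L, ∀ y ∈ L, x.1 ≠ y.2) :
    ((tops L).map Prod.snd).Pairwise (· < ·) ∧
      ∀ c, c ∈ (tops L).map Prod.snd ↔ (∃ x ∈ L, x.2 = c) ∧ ∀ y ∈ L, ¬ Straddles c y := by
  match L, hL, hp, hne with
  | [], _, _, _ => simp [tops]
  | [a], _, _, _ =>
    refine ⟨by simp [tops], fun c => ?_⟩
    simp only [tops, List.map_cons, List.map_nil, List.mem_singleton, exists_eq_left,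
      forall_eq, Straddles]
    omega
  | a :: b :: l, hL, hp, hne =>
    obtain ⟨ih1, ih2⟩ := tops_snd (b :: l) hL.of_cons
      (fun x hx => hp x (List.mem_cons_of_mem _ hx))
      (fun x hx y hy => hne x (List.mem_cons_of_mem _ hx) y (List.mem_cons_of_mem _ hy))
    obtain ⟨T, Ts, h1, h2, h3⟩ := exists_tops_eq b l hL.of_cons
    have hab := List.rel_of_pairwise_cons hL (a' := b) (by simp)
    have hpa := hp a (by simp)
    have hpb := hp b (by simp)
    have hneab := hne a (by simp) b (by simp)
    have hlow : ∀ c ∈ (tops (b :: l)).map Prod.snd, b.2 ≤ c := by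
      intro c hc
      obtain ⟨x, hx, rfl⟩ := ((ih2 c).1 hc).1
      exact (asc_snd_le hL.of_cons hx).2
    have hns : ∀ y ∈ a :: b :: l, ¬ Straddles a.2 y := by
      intro y hy hs
      have := (asc_snd_le hL hy).2
      have := hs.1
      omega
    rw [tops]
    split_ifs with hc
    · rw [h1] at ih1 ih2 ⊢
      rw [List.modifyHead_cons]
      simp only [List.map_cons, h2] at ih1 ih2 ⊢
      have ih1' := List.pairwise_cons.1 ih1
      refine ⟨List.pairwise_cons.2 ⟨fun c hc => ?_, ih1'.2⟩, fun c => ⟨fun hcm => ?_, ?_⟩⟩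
      · have := ih1'.1 c hc; omega
      · rcases List.mem_cons.1 hcm with rfl | hc'
        · exact ⟨⟨a, by simp, rfl⟩, hns⟩
        · obtain ⟨⟨x, hx, hxc⟩, hy⟩ := (ih2 c).1 (List.mem_cons_of_mem _ hc')
          refine ⟨⟨x, List.mem_cons_of_mem _ hx, hxc⟩, fun y hy' => ?_⟩
          rcases List.mem_cons.1 hy' with rfl | hy'
          · intro hs
            refine hy b (by simp) ⟨ih1'.1 c hc', ?_⟩
            have := hs.2; omega
          · exact hy y hy'
      · rintro ⟨⟨x, hx, hxc⟩, hy⟩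
        rcases List.mem_cons.1 hx with rfl | hx
        · simp [hxc]
        · have := (ih2 c).2 ⟨⟨x, hx, hxc⟩, fun y h => hy y (List.mem_cons_of_mem _ h)⟩
          rcases List.mem_cons.1 this with rfl | h
          · have := hy a (by simp)
            have h5 : b.2 = a.2 := by unfold Straddles at this; omega
            simp [h5]
          · exact List.mem_cons_of_mem _ h
    · simp only [List.map_cons]
      refine ⟨List.pairwise_cons.2 ⟨fun c hc => ?_, ih1⟩, fun c => ⟨fun hcm => ?_, ?_⟩⟩
      · have := hlow c hc; omega
      · rcases List.mem_cons.1 hcm with rfl | hc'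
        · exact ⟨⟨a, by simp, rfl⟩, hns⟩
        · obtain ⟨⟨x, hx, hxc⟩, hy⟩ := (ih2 c).1 hc'
          refine ⟨⟨x, List.mem_cons_of_mem _ hx, hxc⟩, fun y hy' => ?_⟩
          rcases List.mem_cons.1 hy' with rfl | hy'
          · intro hs
            have := hlow c hc'
            have h6 := hs.2
            omega
          · exact hy y hy'
      · rintro ⟨⟨x, hx, hxc⟩, hy⟩
        rcases List.mem_cons.1 hx with rfl | hx
        · simp [hxc]
        · exact List.mem_cons_of_mem _
            ((ih2 c).2 ⟨⟨x, hx, hxc⟩, fun y h => hy y (List.mem_cons_of_mem _ h)⟩)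

/-- The analogue of `tops_snd` for rows. -/
lemma tops_fst (L : List Pt) (hL : Asc L) (hp : ∀ x ∈ L, x.2 < x.1)
    (hne : ∀ x ∈ L, ∀ y ∈ L, x.1 ≠ y.2) :
    ((tops L).map Prod.fst).Pairwise (· < ·) ∧
      ∀ r, r ∈ (tops L).map Prod.fst ↔ (∃ x ∈ L, x.1 = r) ∧ ∀ y ∈ L, ¬ Straddles (r + 1) y := by
  match L, hL, hp, hne with
  | [], _, _, _ => simp [tops]
  | [a], _, _, _ =>
    refine ⟨by simp [tops], fun c => ?_⟩
    simp only [tops, List.map_cons, List.map_nil, List.mem_singleton, exists_eq_left,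
      forall_eq, Straddles]
    omega
  | a :: b :: l, hL, hp, hne =>
    obtain ⟨ih1, ih2⟩ := tops_fst (b :: l) hL.of_cons
      (fun x hx => hp x (List.mem_cons_of_mem _ hx))
      (fun x hx y hy => hne x (List.mem_cons_of_mem _ hx) y (List.mem_cons_of_mem _ hy))
    obtain ⟨T, Ts, h1, h2, h3⟩ := exists_tops_eq b l hL.of_cons
    have hab := List.rel_of_pairwise_cons hL (a' := b) (by simp)
    have hpa := hp a (by simp)
    have hpb := hp b (by simp)
    have hneab := hne a (by simp) b (by simp)
    have hlow : ∀ r ∈ (tops (b :: l)).map Prod.fst, b.1 ≤ r := by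
      intro r hr
      obtain ⟨x, hx, rfl⟩ := ((ih2 r).1 hr).1
      exact (asc_snd_le hL.of_cons hx).1
    have hup : ∀ r ∈ (tops (b :: l)).map Prod.fst, (∃ x ∈ a :: b :: l, x.1 = r) ∧
        ∀ y ∈ a :: b :: l, ¬ Straddles (r + 1) y := by
      intro r hr
      obtain ⟨⟨x, hx, hxc⟩, hy⟩ := (ih2 r).1 hr
      refine ⟨⟨x, List.mem_cons_of_mem _ hx, hxc⟩, fun y hy' => ?_⟩
      rcases List.mem_cons.1 hy' with rfl | hy'
      · intro hs
        have := hlow r hr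
        have := hs.2
        omega
      · exact hy y hy'
    rw [tops]
    split_ifs with hc
    · have hm : ((tops (b :: l)).modifyHead (fun T => (T.1, a.2))).map Prod.fst =
          (tops (b :: l)).map Prod.fst := by rw [h1]; rfl
      rw [hm]
      refine ⟨ih1, fun r => ⟨hup r, ?_⟩⟩
      rintro ⟨⟨x, hx, hxc⟩, hy⟩
      have hy' : ∀ y ∈ b :: l, ¬ Straddles (r + 1) y := fun y h => hy y (List.mem_cons_of_mem _ h)
      rcases List.mem_cons.1 hx with rfl | hx
      · have := hy' b (by simp)
        refine (ih2 r).2 ⟨⟨b, by simp, ?_⟩, hy'⟩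
        unfold Straddles at this; omega
      · exact (ih2 r).2 ⟨⟨x, hx, hxc⟩, hy'⟩
    · simp only [List.map_cons]
      refine ⟨List.pairwise_cons.2 ⟨fun c hc => ?_, ih1⟩, fun r => ⟨fun hrm => ?_, ?_⟩⟩
      · have := hlow c hc; omega
      · rcases List.mem_cons.1 hrm with rfl | hrm
        · refine ⟨⟨a, by simp, rfl⟩, fun y hy hs => ?_⟩
          have h8 := hs.1
          have h9 := hs.2
          rcases List.mem_cons.1 hy with rfl | hy
          · omega
          · have := (asc_snd_le hL.of_cons hy).2; omega
        · exact hup r hrm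
      · rintro ⟨⟨x, hx, hxc⟩, hy⟩
        rcases List.mem_cons.1 hx with rfl | hx
        · simp [hxc]
        · exact List.mem_cons_of_mem _
            ((ih2 r).2 ⟨⟨x, hx, hxc⟩, fun y h => hy y (List.mem_cons_of_mem _ h)⟩)

/-! ### The map `π` on a monomial without comparable elements -/

lemma coe_arrange (T : Multiset Pt) : (arrange T : Multiset Pt) = T := by
  rw [arrange, ← Multiset.map_coe, Multiset.sort_eq, Multiset.map_map]
  exact Multiset.map_id T

lemma mem_arrange {T : Multiset Pt} {a : Pt} : a ∈ arrange T ↔ a ∈ T := by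
  rw [← Multiset.mem_coe, coe_arrange]

/-- A monomial without comparable elements. -/
def Incomparable (T : Multiset Pt) : Prop := ∀ a ∈ T, ∀ b ∈ T, ¬ Gt a b

lemma Incomparable.asc_arrange {T : Multiset Pt} (h : Incomparable T) : Asc (arrange T) := by
  have h1 : (arrange T).Pairwise (fun a b => toLex a ≤ toLex b) := by
    rw [arrange, List.pairwise_map]
    exact Multiset.pairwise_sort (T.map toLex) (· ≤ ·)
  refine h1.imp_of_mem fun {a b} ha hb hab => ?_
  rw [mem_arrange] at ha hb
  rcases Prod.Lex.toLex_le_toLex.1 hab with h2 | ⟨h2, h3⟩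
  · refine ⟨h2.le, ?_⟩
    by_contra h3
    exact h b hb a ha ⟨h2, by omega⟩
  · exact ⟨h2.le, h3⟩

lemma asc_eq_of_perm {L L' : List Pt} (h : L.Perm L') (hL : Asc L) (hL' : Asc L') : L = L' :=
  h.eq_of_pairwise (fun _ _ _ _ h1 h2 => Prod.ext (le_antisymm h1.1 h2.1) (le_antisymm h1.2 h2.2))
    hL hL'

lemma Incomparable.depth_eq {T : Multiset Pt} (h : Incomparable T) {a : Pt} (ha : a ∈ T) :
    depth T a = 1 := by
  have : IsChainIn T [a] := ⟨by simp, by simpa using ha⟩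
  refine depth_eq_of_chain this rfl ?_
  have : T.countP (fun x => Gt x a) = 0 := by
    rw [Multiset.countP_eq_zero]; exact fun x hx => h x hx a ha
  simp [this]

/-- All elements have depth one, so only one depth part contributes blocks. -/
lemma Incomparable.allBlocks_eq {T : Multiset Pt} (h : Incomparable T) :
    allBlocks d v T = cutBlocks d v (arrange T) := by
  have hz : ∀ k, k ≠ 1 → blocks d v (depthPart T k) = [] := by
    intro k hk
    have : depthPart T k = 0 := by
      rw [depthPart, Multiset.filter_eq_nil]
      intro a ha h'
      exact hk (h'.symm.trans (h.depth_eq ha))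
    rw [this]; simp [blocks, arrange]
  have h1 : depthPart T 1 = T := by
    rw [depthPart, Multiset.filter_eq_self]
    exact fun a ha => h.depth_eq ha
  have key : ∀ n, 2 ≤ n → (List.range n).flatMap (fun k => blocks d v (depthPart T k)) =
      blocks d v T := by
    intro n hn
    induction n, hn using Nat.le_induction with
    | base => simp [List.range_succ, hz 0, h1]
    | succ n hn ih => rw [List.range_succ, List.flatMap_append, ih]; simp [hz n (by omega)]
  rcases Nat.eq_zero_or_pos T.card with h0 | h0
  · obtain rfl := Multiset.card_eq_zero.1 h0
    simp [allBlocks, List.range_succ, hz 0, cutBlocks, arrange]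
  · exact key _ (by omega)

lemma Incomparable.piTop_eq (hv : v ∈ orthoI d) {T : Multiset Pt} (h : Incomparable T)
    (hp : ∀ x ∈ T, x ∈ pos d v) : piTop d v T = tops (arrange T) := by
  rw [piTop, h.allBlocks_eq, map_blockTop_cutBlocks hv]
  exact fun x hx => hp x (mem_arrange.1 hx)

lemma Incomparable.piRest_eq (hv : v ∈ orthoI d) {T : Multiset Pt} (h : Incomparable T)
    (hp : ∀ x ∈ T, x ∈ pos d v) :
    piRest d v T = (interlace (arrange T)).filter (fun x => x ∈ pos d v) := by
  rw [piRest, h.allBlocks_eq, flatMap_blockRest_cutBlocks hv]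
  exact fun x hx => hp x (mem_arrange.1 hx)

lemma Incomparable.card_piTop_add (hv : v ∈ orthoI d) {T : Multiset Pt} (h : Incomparable T)
    (hp : ∀ x ∈ T, x ∈ pos d v) : (piTop d v T).card + (piRest d v T).card = T.card := by
  have := length_cutBlocks_add hv (arrange T) fun x hx => hp x (mem_arrange.1 hx)
  rw [piTop, piRest, h.allBlocks_eq, Multiset.coe_card, Multiset.coe_card, List.length_map, this,
    ← Multiset.coe_card, coe_arrange]

/-! ### Symmetric monomials without comparable elements -/

/-- The symmetrization of `B` with central part `E`. -/
def sym (d : ℕ) (B E : Multiset Pt) : Multiset Pt := B + B.map (hash d) + E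

/-- `E` is a possible central part for `B`: either there is none and `B` stays below the centre, or
it is one diagonal point lying beyond all elements of `B`. -/
structure Centered (d : ℕ) (v : Finset ℕ) (B E : Multiset Pt) : Prop where
  mem_orthoPos : ∀ x ∈ B, x ∈ orthoPos d v
  incomparable : Incomparable B
  center : (E = 0 ∧ ∀ x ∈ B, x.1 ≤ d) ∨ ∃ δ, E = {δ} ∧ δ ∈ pos d v ∧ δ.1 + δ.2 = 2 * d + 1 ∧
    ∀ x ∈ B, x.1 < δ.1 ∧ x.2 ≤ δ.2

lemma mem_sym {B E : Multiset Pt} {x : Pt} :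
    x ∈ sym d B E ↔ x ∈ B ∨ (∃ a ∈ B, hash d a = x) ∨ x ∈ E := by
  simp [sym, or_assoc]

lemma hash_of_diag {δ : Pt} (h : δ.1 + δ.2 = 2 * d + 1) : hash d δ = δ := by
  apply Prod.ext <;> simp only [hash, star] <;> omega

lemma Centered.isSymm (hv : v ∈ orthoI d) {B E : Multiset Pt} (h : Centered d v B E) :
    IsSymm d v (sym d B E) := by
  have hE : (∀ x ∈ E, x ∈ pos d v) ∧ E.map (hash d) = E := by
    rcases h.center with ⟨rfl, -⟩ | ⟨δ, rfl, h1, h2, -⟩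
    · simp
    · simp [h1, hash_of_diag h2]
  have hB : ∀ x ∈ B, x ∈ pos d v := fun x hx => orthoPos_subset_pos hv (h.mem_orthoPos x hx)
  refine ⟨fun x hx => ?_, ?_⟩
  · rcases mem_sym.1 hx with hx | ⟨a, ha, rfl⟩ | hx
    · exact hB x hx
    · exact hash_mem_pos hv (hB a ha)
    · exact hE.1 x hx
  · have : (B.map (hash d)).map (hash d) = B := by
      rw [Multiset.map_map]
      conv_rhs => rw [← Multiset.map_id B]
      exact Multiset.map_congr rfl fun x hx => hash_hash hv (hB x hx)
    rw [sym, Multiset.map_add, Multiset.map_add, this, hE.2, add_comm B]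

/-- The ascending arrangement of a symmetrization. -/
def symList (d : ℕ) (B E : Multiset Pt) : List Pt :=
  arrange B ++ arrange E ++ ((arrange B).map (hash d)).reverse

lemma coe_symList (B E : Multiset Pt) : (symList d B E : Multiset Pt) = sym d B E := by
  rw [symList, ← Multiset.coe_add, ← Multiset.coe_add, coe_arrange, coe_arrange, sym,
    Multiset.coe_reverse, ← Multiset.map_coe, coe_arrange]
  exact add_right_comm _ _ _

lemma arrange_singleton (δ : Pt) : arrange {δ} = [δ] := by simp [arrange]

lemma Centered.asc_symList (hv : v ∈ orthoI d) {B E : Multiset Pt} (h : Centered d v B E) :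
    Asc (symList d B E) := by
  have hB := h.incomparable.asc_arrange
  have hrev : Asc ((arrange B).map (hash d)).reverse := by
    rw [Asc, List.pairwise_reverse, List.pairwise_map]
    refine hB.imp fun {a b} hab => ?_
    simp only [hash, star]
    omega
  have hh : ∀ y ∈ ((arrange B).map (hash d)).reverse, ∃ b ∈ B, hash d b = y := by
    intro y hy
    rw [List.mem_reverse, List.mem_map] at hy
    obtain ⟨b, hb, rfl⟩ := hy
    exact ⟨b, mem_arrange.1 hb, rfl⟩
  rcases h.center with ⟨rfl, h1⟩ | ⟨δ, rfl, h1, h2, h3⟩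
  · have : arrange 0 = [] := by simp [arrange]
    rw [symList, this, List.append_nil, Asc, List.pairwise_append]
    refine ⟨hB, hrev, fun a ha y hy => ?_⟩
    obtain ⟨b, hb, rfl⟩ := hh y hy
    have ha := mem_arrange.1 ha
    have := h1 a ha
    have := h1 b hb
    have := (mem_orthoPos_iff hv).1 (h.mem_orthoPos a ha)
    have := (mem_orthoPos_iff hv).1 (h.mem_orthoPos b hb)
    simp only [hash, star]
    omega
  · rw [symList, arrange_singleton, Asc, List.pairwise_append, List.pairwise_append]
    refine ⟨⟨hB, by simp, fun a ha y hy => ?_⟩, hrev, fun a ha y hy => ?_⟩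
    · obtain rfl : y = δ := by simpa using hy
      have := h3 a (mem_arrange.1 ha)
      omega
    · obtain ⟨b, hb, rfl⟩ := hh y hy
      have := h3 b hb
      have := (mem_orthoPos_iff hv).1 (h.mem_orthoPos b hb)
      simp only [hash, star]
      rcases List.mem_append.1 ha with ha | ha
      · have := h3 a (mem_arrange.1 ha)
        omega
      · obtain rfl : a = δ := by simpa using ha
        omega

lemma incomparable_of_asc {L : List Pt} (hL : Asc L) : Incomparable (L : Multiset Pt) := by
  intro a ha b hb hab
  have := hab.1
  have := hab.2
  rcases eq_or_ne a b with rfl | hne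
  · omega
  have : (a.1 ≤ b.1 ∧ a.2 ≤ b.2) ∨ (b.1 ≤ a.1 ∧ b.2 ≤ a.2) := by
    have h2 : L.Pairwise (fun a b => (a.1 ≤ b.1 ∧ a.2 ≤ b.2) ∨ (b.1 ≤ a.1 ∧ b.2 ≤ a.2)) :=
      hL.imp fun h => Or.inl h
    have : Std.Symm (fun a b : Pt => (a.1 ≤ b.1 ∧ a.2 ≤ b.2) ∨ (b.1 ≤ a.1 ∧ b.2 ≤ a.2)) :=
      ⟨fun _ _ h => h.symm⟩
    exact h2.forall ha hb hne
  omega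

lemma Centered.incomparable_sym (hv : v ∈ orthoI d) {B E : Multiset Pt} (h : Centered d v B E) :
    Incomparable (sym d B E) := by
  rw [← coe_symList]
  exact incomparable_of_asc (h.asc_symList hv)

lemma Centered.arrange_sym (hv : v ∈ orthoI d) {B E : Multiset Pt} (h : Centered d v B E) :
    arrange (sym d B E) = symList d B E := by
  refine asc_eq_of_perm ?_ (h.incomparable_sym hv).asc_arrange (h.asc_symList hv)
  rw [← Multiset.coe_eq_coe, coe_arrange, coe_symList]

lemma interlace_cons_cons (a b : Pt) (l : List Pt) :
    interlace (a :: b :: l) = (a.1, b.2) :: interlace (b :: l) := rfl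

lemma interlace_append_cons (X : List Pt) (a : Pt) (Y : List Pt) :
    interlace (X ++ a :: Y) = interlace (X ++ [a]) ++ interlace (a :: Y) := by
  match X with
  | [] => rfl
  | [x] => rfl
  | x :: y :: X =>
    have := interlace_append_cons (y :: X) a Y
    simp only [List.cons_append, interlace_cons_cons] at this ⊢
    rw [this]

lemma interlace_map_hash_reverse (X : List Pt) :
    interlace ((X.map (hash d)).reverse) = ((interlace X).map (hash d)).reverse := by
  match X with
  | [] => rfl
  | [x] => rfl
  | x :: y :: X =>
    have := interlace_map_hash_reverse (y :: X)
    rw [interlace_cons_cons, List.map_cons, List.map_cons, List.reverse_cons, List.reverse_cons,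
      List.append_assoc, List.singleton_append, interlace_append_cons, List.map_cons,
      List.reverse_cons, ← this, List.map_cons, List.reverse_cons]
    rfl

/-- An interlaced point comes from two elements `x`, `y` between which there is no other one. -/
lemma mem_interlace {L : List Pt} (hL : Asc L) {b : Pt} (hb : b ∈ interlace L) :
    ∃ x ∈ L.dropLast, ∃ y ∈ L, b = (x.1, y.2) ∧ x.1 ≤ y.1 ∧ x.2 ≤ y.2 ∧
      ∀ z ∈ L, (z.1 ≤ x.1 ∧ z.2 ≤ x.2) ∨ (y.1 ≤ z.1 ∧ y.2 ≤ z.2) := by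
  match L, hL, hb with
  | a :: c :: l, hL, hb =>
    have hac := List.rel_of_pairwise_cons hL (a' := c) (by simp)
    rw [interlace_cons_cons] at hb
    rcases List.mem_cons.1 hb with rfl | hb
    · refine ⟨a, by simp, c, by simp, rfl, hac.1, hac.2, fun z hz => ?_⟩
      rcases List.mem_cons.1 hz with rfl | hz
      · exact Or.inl ⟨le_rfl, le_rfl⟩
      · exact Or.inr (asc_snd_le hL.of_cons hz)
    · obtain ⟨x, hx, y, hy, h1, h2, h3, h4⟩ := mem_interlace hL.of_cons hb
      refine ⟨x, ?_, y, List.mem_cons_of_mem _ hy, h1, h2, h3, fun z hz => ?_⟩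
      · rw [List.dropLast_cons_of_ne_nil (by simp)]
        exact List.mem_cons_of_mem _ hx
      · rcases List.mem_cons.1 hz with rfl | hz
        · have := asc_snd_le hL.of_cons (List.dropLast_subset _ hx)
          omega
        · exact h4 z hz

/-- The interlaced points in `N(v)` of the lower half of a symmetrization, with its centre. By
`Centered.filter_piRest_sym` they form the intersection of the rest of the symmetrization with
`ON(v)`. -/
def lowerRest (v : Finset ℕ) (d : ℕ) (B E : Multiset Pt) : List Pt :=
  (interlace (arrange B ++ arrange E)).filter (fun x => x ∈ pos d v)

lemma Centered.lowerRest_mem (hv : v ∈ orthoI d) {B E : Multiset Pt} (h : Centered d v B E) {b : Pt}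
    (hb : b ∈ lowerRest v d B E) :
    b ∈ orthoPos d v ∧ ∃ x ∈ B, ∃ y ∈ B + E, b = (x.1, y.2) ∧ x.1 ≤ y.1 ∧ x.2 ≤ y.2 ∧
      ∀ z ∈ B + E, (z.1 ≤ x.1 ∧ z.2 ≤ x.2) ∨ (y.1 ≤ z.1 ∧ y.2 ≤ z.2) := by
  have hasc : Asc (arrange B ++ arrange E) :=
    (h.asc_symList hv).sublist (List.sublist_append_left _ _)
  obtain ⟨hb, hbp⟩ := List.mem_filter.1 hb
  have hbp : b ∈ pos d v := by simpa using hbp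
  obtain ⟨x, hx, y, hy, h1, h2, h3, h4⟩ := mem_interlace hasc hb
  have hmem : ∀ z, z ∈ arrange B ++ arrange E ↔ z ∈ B + E := by
    intro z; simp [mem_arrange]
  have hxB : x ∈ B := by
    -- A central part stands last, so it can only be the second of the two elements.
    rcases h.center with ⟨rfl, -⟩ | ⟨δ, rfl, -⟩
    · have := List.dropLast_subset _ hx
      simpa [mem_arrange] using this
    · rw [arrange_singleton, List.dropLast_concat] at hx
      exact mem_arrange.1 hx
  refine ⟨?_, x, hxB, y, (hmem y).1 hy, h1, h2, h3, fun z hz => h4 z ((hmem z).2 hz)⟩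
  have hp := (mem_pos_iff hv).1 hbp
  rw [mem_orthoPos_iff hv]
  refine ⟨hp.1, hp.2.1, ?_, hp.2.2.2⟩
  rw [h1]
  simp only
  rcases Multiset.mem_add.1 ((hmem y).1 hy) with hy | hy
  · have := (mem_orthoPos_iff hv).1 (h.mem_orthoPos y hy)
    omega
  · rcases h.center with ⟨rfl, -⟩ | ⟨δ, rfl, h5, h6, h7⟩
    · simp at hy
    · obtain rfl : y = δ := by simpa using hy
      have := h7 x hxB
      omega

/-- The rest of a symmetrization is symmetric and has no diagonal elements: without central part,
the interlaced point at the centre is `(r, r*)` with `r ≤ d` and hence not in `N(v)`; with a central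
part `δ`, the interlaced points come in pairs on both sides of `δ`. -/
lemma Centered.piRest_sym (hv : v ∈ orthoI d) {B E : Multiset Pt} (h : Centered d v B E) :
    piRest d v (sym d B E) = (lowerRest v d B E : Multiset Pt) +
      (lowerRest v d B E : Multiset Pt).map (hash d) := by
  have hfil : ∀ X : List Pt, (∀ x ∈ X, x.1 ≤ 2 * d ∧ x.2 ≤ 2 * d) →
      ((X.map (hash d)).reverse).filter (fun x => x ∈ pos d v) =
      ((X.filter (fun x => x ∈ pos d v)).map (hash d)).reverse := by
    intro X hX
    rw [List.filter_reverse, List.filter_map]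
    congr 2
    refine List.filter_congr fun x hx => ?_
    have := hX x hx
    have h1 : hash d (hash d x) = x := by
      simp only [hash]
      rw [star_star (by omega), star_star (by omega)]
    have : hash d x ∈ pos d v ↔ x ∈ pos d v :=
      ⟨fun h => h1 ▸ hash_mem_pos hv h, fun h => hash_mem_pos hv h⟩
    simp [this]
  have hsum : ∀ L : List Pt, ((L ++ (L.map (hash d)).reverse : List Pt) : Multiset Pt) =
      (L : Multiset Pt) + (L : Multiset Pt).map (hash d) := by
    intro L
    rw [← Multiset.coe_add, Multiset.coe_reverse, ← Multiset.map_coe]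
  have hbd : ∀ X : List Pt, (∀ x ∈ X, x ∈ pos d v) → ∀ x ∈ interlace X,
      x.1 ≤ 2 * d ∧ x.2 ≤ 2 * d := by
    intro X hX x hx
    obtain ⟨i, hi, rfl⟩ := List.mem_iff_getElem.1 hx
    simp only [interlace, List.getElem_zipWith, List.getElem_tail]
    simp only [interlace, List.length_zipWith, List.length_tail] at hi
    have h1 := (mem_pos_iff hv).1 (hX X[i] (List.getElem_mem _))
    have h2 := (mem_pos_iff hv).1 (hX (X[i + 1]'(by omega)) (List.getElem_mem _))
    omega
  rw [(h.incomparable_sym hv).piRest_eq hv (h.isSymm hv).mem_pos, h.arrange_sym hv]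
  rw [← hsum, Multiset.coe_eq_coe]
  have hBp : ∀ x ∈ arrange B, x ∈ pos d v := fun x hx =>
    orthoPos_subset_pos hv (h.mem_orthoPos x (mem_arrange.1 hx))
  rcases h.center with ⟨rfl, h1⟩ | ⟨δ, rfl, h1, h2, h3⟩
  · have h0 : arrange 0 = [] := by simp [arrange]
    simp only [symList, lowerRest, h0, List.append_nil]
    rcases List.eq_nil_or_concat (arrange B) with hB | ⟨X, x, hB⟩
    · rw [hB]; rfl
    · have hx : x ∈ B := mem_arrange.1 (by simp [hB])
      have hxp := (mem_orthoPos_iff hv).1 (h.mem_orthoPos x hx)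
      have : (x.1, (hash d x).2) ∉ pos d v := by
        have := h1 x hx
        rw [mem_pos_iff hv]
        simp only [hash, star]
        omega
      have hr : ((arrange B).map (hash d)).reverse = hash d x :: (X.map (hash d)).reverse := by
        rw [hB]; simp
      rw [← hfil _ (hbd _ hBp), ← interlace_map_hash_reverse, hr]
      conv_lhs => rw [hB, List.concat_eq_append, List.append_assoc, List.singleton_append,
        interlace_append_cons, interlace_cons_cons, List.filter_append,
        List.filter_cons_of_neg (by simpa using this)]
      rw [hB, List.concat_eq_append]
  · have hδ := hash_of_diag h2
    have hmem : ∀ x ∈ arrange B ++ [δ], x ∈ pos d v := by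
      intro x hx
      rcases List.mem_append.1 hx with hx | hx
      · exact hBp x hx
      · obtain rfl : x = δ := by simpa using hx
        exact h1
    have hr : ((arrange B ++ [δ]).map (hash d)).reverse =
        δ :: ((arrange B).map (hash d)).reverse := by
      simp [hδ]
    simp only [symList, lowerRest, arrange_singleton]
    rw [← hfil _ (hbd _ hmem), ← interlace_map_hash_reverse, hr, List.append_assoc,
      List.singleton_append, interlace_append_cons, List.filter_append]

lemma Centered.filter_piRest_sym (hv : v ∈ orthoI d) {B E : Multiset Pt} (h : Centered d v B E) :
    (piRest d v (sym d B E)).filter (fun a => a ∈ orthoPos d v) = lowerRest v d B E := by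
  rw [h.piRest_sym hv, Multiset.filter_add]
  have h1 : ((lowerRest v d B E : Multiset Pt)).filter (fun a => a ∈ orthoPos d v) =
      lowerRest v d B E := by
    rw [Multiset.filter_eq_self]
    exact fun a ha => (h.lowerRest_mem hv ha).1
  have h2 : (((lowerRest v d B E : Multiset Pt)).map (hash d)).filter
      (fun a => a ∈ orthoPos d v) = 0 := by
    rw [Multiset.filter_eq_nil]
    intro a ha ha'
    obtain ⟨b, hb, rfl⟩ := Multiset.mem_map.1 ha
    have h3 := (mem_orthoPos_iff hv).1 (h.lowerRest_mem hv hb).1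
    have h4 := (mem_orthoPos_iff hv).1 ha'
    simp only [hash, star] at h4
    omega
  rw [h1, h2, add_zero]

lemma Centered.card_piRest_sym (hv : v ∈ orthoI d) {B E : Multiset Pt} (h : Centered d v B E) :
    (piRest d v (sym d B E)).card =
      2 * ((piRest d v (sym d B E)).filter (fun a => a ∈ orthoPos d v)).card := by
  rw [h.filter_piRest_sym hv, h.piRest_sym hv, Multiset.card_add, Multiset.card_map]
  omega

/-! ### The block tops of a symmetric monomial without comparable elements -/

lemma tops_snd_lt_fst (L : List Pt) (hL : Asc L) (hp : ∀ x ∈ L, x.2 < x.1) :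
    ∀ T ∈ tops L, T.2 < T.1 := by
  match L, hL, hp with
  | [], _, _ => simp [tops]
  | [a], _, hp => simpa [tops] using hp
  | a :: b :: l, hL, hp =>
    have ih := tops_snd_lt_fst (b :: l) hL.of_cons fun x hx => hp x (List.mem_cons_of_mem _ hx)
    obtain ⟨T, Ts, h1, h2, h3⟩ := exists_tops_eq b l hL.of_cons
    have hab := List.rel_of_pairwise_cons hL (a' := b) (by simp)
    rw [tops]
    rw [h1] at ih ⊢
    intro y hy
    split_ifs at hy
    · rw [List.modifyHead_cons] at hy
      rcases List.mem_cons.1 hy with rfl | hy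
      · have := ih T (by simp)
        simp only; omega
      · exact ih y (List.mem_cons_of_mem _ hy)
    · rcases List.mem_cons.1 hy with rfl | hy
      · exact hp _ (by simp)
      · exact ih y hy

lemma Incomparable.countP_straddles_piTop (hv : v ∈ orthoI d) {T : Multiset Pt}
    (h : Incomparable T) (hp : ∀ x ∈ T, x ∈ pos d v) (t : ℕ) [Decidable (∃ x ∈ T, Straddles t x)] :
    (piTop d v T).countP (Straddles t) = if ∃ x ∈ T, Straddles t x then 1 else 0 := by
  rw [h.piTop_eq hv hp, Multiset.coe_countP, countP_straddles_tops t _ h.asc_arrange]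
  · simp only [mem_arrange]
  · exact fun x hx => ((mem_pos_iff hv).1 (hp x (mem_arrange.1 hx))).2.1

lemma Incomparable.piTop_snd (hv : v ∈ orthoI d) {T : Multiset Pt}
    (h : Incomparable T) (hp : ∀ x ∈ T, x ∈ pos d v) :
    ((piTop d v T).map Prod.snd).Nodup ∧ ∀ c, c ∈ (piTop d v T).map Prod.snd ↔
      (∃ x ∈ T, x.2 = c) ∧ ∀ y ∈ T, ¬ Straddles c y := by
  have := tops_snd _ h.asc_arrange
    (fun x hx => ((mem_pos_iff hv).1 (hp x (mem_arrange.1 hx))).2.1) fun x hx y hy he =>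
      ((mem_pos_iff hv).1 (hp x (mem_arrange.1 hx))).2.2.2.1
        (he ▸ ((mem_pos_iff hv).1 (hp y (mem_arrange.1 hy))).2.2.2.2)
  rw [h.piTop_eq hv hp]
  refine ⟨?_, fun c => ?_⟩
  · rw [Multiset.map_coe, Multiset.coe_nodup]
    exact this.1.imp fun h => h.ne
  · rw [Multiset.map_coe, Multiset.mem_coe, this.2]
    simp only [mem_arrange]

lemma Incomparable.piTop_fst (hv : v ∈ orthoI d) {T : Multiset Pt}
    (h : Incomparable T) (hp : ∀ x ∈ T, x ∈ pos d v) :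
    ((piTop d v T).map Prod.fst).Nodup ∧ ∀ r, r ∈ (piTop d v T).map Prod.fst ↔
      (∃ x ∈ T, x.1 = r) ∧ ∀ y ∈ T, ¬ Straddles (r + 1) y := by
  have := tops_fst _ h.asc_arrange
    (fun x hx => ((mem_pos_iff hv).1 (hp x (mem_arrange.1 hx))).2.1) fun x hx y hy he =>
      ((mem_pos_iff hv).1 (hp x (mem_arrange.1 hx))).2.2.2.1
        (he ▸ ((mem_pos_iff hv).1 (hp y (mem_arrange.1 hy))).2.2.2.2)
  rw [h.piTop_eq hv hp]
  refine ⟨?_, fun c => ?_⟩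
  · rw [Multiset.map_coe, Multiset.coe_nodup]
    exact this.1.imp fun h => h.ne
  · rw [Multiset.map_coe, Multiset.mem_coe, this.2]
    simp only [mem_arrange]

lemma Incomparable.piTop_mem_pos (hv : v ∈ orthoI d) {T : Multiset Pt}
    (h : Incomparable T) (hp : ∀ x ∈ T, x ∈ pos d v) : ∀ x ∈ piTop d v T, x ∈ pos d v := by
  intro x hx
  obtain ⟨a, ha, hax⟩ := (((h.piTop_snd hv hp).2 x.2).1 (Multiset.mem_map_of_mem _ hx)).1
  obtain ⟨b, hb, hbx⟩ := (((h.piTop_fst hv hp).2 x.1).1 (Multiset.mem_map_of_mem _ hx)).1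
  have ha := (mem_pos_iff hv).1 (hp a ha)
  have hb := (mem_pos_iff hv).1 (hp b hb)
  rw [h.piTop_eq hv hp] at hx
  have := tops_snd_lt_fst _ h.asc_arrange
    (fun x hx => ((mem_pos_iff hv).1 (hp x (mem_arrange.1 hx))).2.1) x hx
  rw [hax] at ha
  rw [hbx] at hb
  exact (mem_pos_iff hv).2 ⟨ha.1, this, hb.2.2.1, hb.2.2.2.1, ha.2.2.2.2⟩

lemma IsSymm.hash_mem {T : Multiset Pt} (hs : IsSymm d v T) {x : Pt} (hx : x ∈ T) :
    hash d x ∈ T := by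
  rw [← hs.map_hash]
  exact Multiset.mem_map_of_mem _ hx

lemma IsSymm.exists_straddles_reflect (hv : v ∈ orthoI d) {T : Multiset Pt} (hs : IsSymm d v T)
    {t : ℕ} (ht : t ≤ 2 * d + 2) (h : ∃ x ∈ T, Straddles t x) :
    ∃ x ∈ T, Straddles (2 * d + 2 - t) x := by
  obtain ⟨x, hx, h⟩ := h
  exact ⟨_, hs.hash_mem hx, (straddles_hash hv (hs.mem_pos x hx) ht).2 h⟩

/-- The block tops of a symmetric monomial are symmetric as well. Only the consequences in
`IsSymmDistinct` are needed, and these follow from the descriptions of columns, rows and straddling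
numbers by the elements of `T`. -/
lemma IsSymm.isSymmDistinct_piTop (hv : v ∈ orthoI d) {T : Multiset Pt} (hs : IsSymm d v T)
    (h : Incomparable T) : IsSymmDistinct d v (piTop d v T) := by
  have hp := hs.mem_pos
  obtain ⟨n1, h1⟩ := h.piTop_fst hv hp
  obtain ⟨n2, h2⟩ := h.piTop_snd hv hp
  refine ⟨h.piTop_mem_pos hv hp, ?_, n2, fun t ht => ?_⟩
  · have hrange : ∀ c ∈ (piTop d v T).map Prod.snd, 1 ≤ c ∧ c ≤ 2 * d := by
      intro c hc
      obtain ⟨⟨x, hx, rfl⟩, -⟩ := (h2 c).1 hc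
      have := (mem_pos_iff hv).1 (hp x hx)
      omega
    have n3 : (((piTop d v T).map Prod.snd).map (star d)).Nodup := by
      refine Multiset.Nodup.map_on (fun x hx y hy hxy => ?_) n2
      have := hrange x hx
      have := hrange y hy
      unfold star at hxy
      omega
    rw [Multiset.Nodup.ext n1 n3]
    intro r
    rw [h1, Multiset.mem_map]
    constructor
    · rintro ⟨⟨x, hx, rfl⟩, hy⟩
      have hxp := (mem_pos_iff hv).1 (hp x hx)
      refine ⟨star d x.1, (h2 _).2 ⟨⟨hash d x, hs.hash_mem hx, rfl⟩, fun y hy' hst => ?_⟩,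
        star_star (by omega)⟩
      have := hs.exists_straddles_reflect hv (by unfold star; omega) ⟨y, hy', hst⟩
      obtain ⟨z, hz, hz'⟩ := this
      refine hy z hz ?_
      convert hz' using 1
      unfold star; omega
    · rintro ⟨c, hc, rfl⟩
      have := hrange c hc
      obtain ⟨⟨x, hx, rfl⟩, hy⟩ := (h2 c).1 hc
      refine ⟨⟨hash d x, hs.hash_mem hx, rfl⟩, fun y hy' hst => ?_⟩
      have := hs.exists_straddles_reflect hv (by unfold star; omega) ⟨y, hy', hst⟩
      obtain ⟨z, hz, hz'⟩ := this
      refine hy z hz ?_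
      convert hz' using 1
      unfold star; omega
  · classical
    rw [h.countP_straddles_piTop hv hp, h.countP_straddles_piTop hv hp]
    congr 1
    refine propext ⟨fun h => ?_, fun h => hs.exists_straddles_reflect hv ht h⟩
    have := hs.exists_straddles_reflect hv (by omega) h
    rwa [show 2 * d + 2 - (2 * d + 2 - t) = t by omega] at this

/-! ### The monomials `S_k` -/

lemma mem_prPart {S : Multiset Pt} {k : ℕ} {a : Pt} :
    a ∈ prPart d v S k ↔ a ∈ S ∧ oDepth d v S a = k := by
  simp [prPart]

lemma oDepth_lt_of_gt (hv : v ∈ orthoI d) {S : Multiset Pt} (hS : ∀ a ∈ S, a ∈ orthoPos d v)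
    {a b : Pt} (ha : a ∈ S) (hb : b ∈ S) (hab : Gt a b) : oDepth d v S a < oDepth d v S b :=
  (lt_step _ a b).trans_le (step_le_oDepth hv hS ha hb hab)

lemma incomparable_prPart (hv : v ∈ orthoI d) {S : Multiset Pt} (hS : ∀ a ∈ S, a ∈ orthoPos d v)
    (k : ℕ) : Incomparable (prPart d v S k) := by
  intro a ha b hb hab
  rw [mem_prPart] at ha hb
  have := oDepth_lt_of_gt hv hS ha.1 hb.1 hab
  omega

/-- By the parity in the rule `step`, an even orthogonal depth `j + 1` is reached from depth `j`
only. -/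
lemma exists_gt_of_even (hv : v ∈ orthoI d) {S : Multiset Pt} (hS : ∀ a ∈ S, a ∈ orthoPos d v)
    {j : ℕ} (hj : Odd j) {b : Pt} (hb : b ∈ prPart d v S (j + 1)) :
    ∃ a ∈ prPart d v S j, Gt a b := by
  rw [mem_prPart] at hb
  have hj0 : 1 ≤ j := hj.pos
  rcases exists_oDepth_eq_step hv hS hb.1 with h | ⟨a, ha, hab, h⟩
  · omega
  · refine ⟨a, mem_prPart.2 ⟨ha, ?_⟩, hab⟩
    rw [hb.2, step] at h
    split_ifs at h with hc
    · obtain ⟨m, hm⟩ := hc.1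
      obtain ⟨n, hn⟩ := hj
      omega
    · omega

/-- A sum of two monomials without comparable elements splits into its parts of depth 1 and 2 if
each element of the second is exceeded by one of the first, and not conversely. -/
lemma depthPart_add {T₁ T₂ : Multiset Pt} (h₁ : Incomparable T₁) (h₂ : Incomparable T₂)
    (h : ∀ y ∈ T₂, ∀ x ∈ T₁, ¬ Gt y x) (h' : ∀ y ∈ T₂, ∃ x ∈ T₁, Gt x y) :
    depthPart (T₁ + T₂) 1 = T₁ ∧ depthPart (T₁ + T₂) 2 = T₂ := by
  have d1 : ∀ x ∈ T₁, depth (T₁ + T₂) x = 1 := by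
    intro x hx
    have hc : IsChainIn (T₁ + T₂) [x] := ⟨by simp, by simp [hx]⟩
    refine depth_eq_of_chain hc rfl ?_
    have : (T₁ + T₂).countP (fun y => Gt y x) = 0 := by
      rw [Multiset.countP_eq_zero]
      intro y hy
      rcases Multiset.mem_add.1 hy with hy | hy
      · exact h₁ y hy x hx
      · exact h y hy x hx
    simp [this]
  have d2 : ∀ y ∈ T₂, depth (T₁ + T₂) y = 2 := by
    intro y hy
    obtain ⟨x, hx, hxy⟩ := h' y hy
    have hc : IsChainIn (T₁ + T₂) [x, y] := ⟨by simpa using hxy, by simp [hx, hy]⟩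
    refine le_antisymm (csSup_le ⟨_, [x, y], hc, rfl, rfl⟩ ?_) (hc.length_le_depth rfl)
    rintro n ⟨C, hC, hl, rfl⟩
    rcases List.eq_nil_or_concat C with rfl | ⟨D, z, rfl⟩
    · simp
    rw [List.concat_eq_append] at hl hC ⊢
    obtain rfl : z = y := by simpa using hl
    have hp := List.pairwise_append.1 hC.1
    have hD : ∀ u ∈ D, u ∈ T₁ := by
      intro u hu
      rcases Multiset.mem_add.1 (hC.2 u (by simp [hu])) with h3 | h3
      · exact h3
      · exact absurd (hp.2.2 u hu z (by simp)) (h₂ u h3 z hy)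
    match D, hp, hD with
    | [], _, _ => simp
    | [u], _, _ => simp
    | u :: u' :: D, hp, hD =>
      exact absurd (List.rel_of_pairwise_cons hp.1 (by simp))
        (h₁ u (hD u (by simp)) u' (hD u' (by simp)))
  constructor
  · rw [depthPart, Multiset.filter_add, Multiset.filter_eq_self.2 d1,
      Multiset.filter_eq_nil.2 fun y hy => by rw [d2 y hy]; decide, add_zero]
  · rw [depthPart, Multiset.filter_add, Multiset.filter_eq_self.2 d2,
      Multiset.filter_eq_nil.2 fun y hy => by rw [d1 y hy]; decide, zero_add]

lemma getLast?_arrange {T : Multiset Pt} (h : Incomparable T) {σ : Pt}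
    (hσ : (arrange T).getLast? = some σ) : σ ∈ T ∧ ∀ a ∈ T, a.1 ≤ σ.1 ∧ a.2 ≤ σ.2 := by
  have hmem := List.mem_of_getLast? hσ
  refine ⟨mem_arrange.1 hmem, fun a ha => ?_⟩
  have hasc := h.asc_arrange
  have ha := mem_arrange.2 ha
  rcases List.eq_nil_or_concat (arrange T) with h0 | ⟨X, z, hX⟩
  · simp [h0] at ha
  · rw [List.concat_eq_append] at hX
    rw [hX] at hσ hasc ha
    obtain rfl : z = σ := by simpa using hσ
    rcases List.mem_append.1 ha with ha | ha
    · exact (List.pairwise_append.1 hasc).2.2 a ha z (by simp)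
    · obtain rfl : a = z := by simpa using ha
      exact ⟨le_rfl, le_rfl⟩

lemma gt_hash_iff (hv : v ∈ orthoI d) {a b : Pt} (ha : a ∈ pos d v) (hb : b ∈ pos d v) :
    Gt (hash d a) (hash d b) ↔ Gt a b := by
  have := (mem_pos_iff hv).1 ha
  have := (mem_pos_iff hv).1 hb
  simp only [Gt, hash, star]
  omega

/-- Splitting a sum of two symmetric monomials without comparable elements into its parts of
depth 1 and 2; it is enough to compare with elements of the non-reflected half. -/
lemma depthPart_sym_add (hv : v ∈ orthoI d) {B₁ E₁ B₂ E₂ : Multiset Pt} (h₁ : Centered d v B₁ E₁)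
    (h₂ : Centered d v B₂ E₂) (h : ∀ y ∈ sym d B₂ E₂, ∀ x ∈ B₁ + E₁, ¬ Gt y x)
    (h' : ∀ y ∈ B₂ + E₂, ∃ x ∈ sym d B₁ E₁, Gt x y) :
    depthPart (sym d B₁ E₁ + sym d B₂ E₂) 1 = sym d B₁ E₁ ∧
      depthPart (sym d B₁ E₁ + sym d B₂ E₂) 2 = sym d B₂ E₂ := by
  have s₁ := h₁.isSymm hv
  have s₂ := h₂.isSymm hv
  have hB : ∀ {B E : Multiset Pt} {x : Pt}, x ∈ B + E → x ∈ sym d B E := by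
    intro B E x hx
    rw [mem_sym]
    rcases Multiset.mem_add.1 hx with hx | hx <;> simp [hx]
  refine depthPart_add (h₁.incomparable_sym hv) (h₂.incomparable_sym hv) ?_ ?_
  · intro y hy x hx
    rcases mem_sym.1 hx with hx | ⟨a, ha, rfl⟩ | hx
    · exact h y hy x (Multiset.mem_add.2 (Or.inl hx))
    · have hap := orthoPos_subset_pos hv (h₁.mem_orthoPos a ha)
      have hyp := s₂.mem_pos y hy
      intro hg
      refine h _ (s₂.hash_mem hy) a (Multiset.mem_add.2 (Or.inl ha)) ?_
      rw [← gt_hash_iff hv (hash_mem_pos hv hyp) hap, hash_hash hv hyp]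
      exact hg
    · exact h y hy x (Multiset.mem_add.2 (Or.inr hx))
  · intro y hy
    rcases mem_sym.1 hy with hy | ⟨a, ha, rfl⟩ | hy
    · exact h' y (Multiset.mem_add.2 (Or.inl hy))
    · obtain ⟨x, hx, hg⟩ := h' a (Multiset.mem_add.2 (Or.inl ha))
      exact ⟨_, s₁.hash_mem hx, (gt_hash_iff hv (s₁.mem_pos x hx)
        (orthoPos_subset_pos hv (h₂.mem_orthoPos a ha))).2 hg⟩
    · exact h' y (Multiset.mem_add.2 (Or.inr hy))

/-- The monomials `S_j`, `S_{j+1}` for odd `j`, when the last element `σ` of orthogonal depth `j`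
has its horizontal projection in `N(v)`. -/
lemma oPart_of_center (hv : v ∈ orthoI d) {S : Multiset Pt} (hS : ∀ a ∈ S, a ∈ orthoPos d v)
    {j : ℕ} (hj : Odd j) {σ : Pt} (hl : (arrange (prPart d v S j)).getLast? = some σ)
    (hσd : d < σ.1) :
    Centered d v ((prPart d v S j).erase σ) {vProj d σ} ∧
    Centered d v (prPart d v S (j + 1)) {hProj d σ} ∧
    oPart d v S j = sym d ((prPart d v S j).erase σ) {vProj d σ} ∧
    oPart d v S (j + 1) = sym d (prPart d v S (j + 1)) {hProj d σ} := by
  obtain ⟨hσ, hmax⟩ := getLast?_arrange (incomparable_prPart hv hS j) hl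
  have hσS := mem_prPart.1 hσ
  have hσO := hS σ hσS.1
  have hσp := (mem_orthoPos_iff hv).1 hσO
  have hhp := (hProj_mem_pos_iff hv hσO).2 hσd
  -- If the column of `b` exceeded that of `p_h(σ)`, the depth of `b` would be at least `j + 2`.
  have hnext : ∀ b ∈ prPart d v S (j + 1), b.1 < σ.1 ∧ b.2 + σ.1 ≤ 2 * d + 1 := by
    intro b hb
    obtain ⟨a, ha, hab⟩ := exists_gt_of_even hv hS hj hb
    have hb' := mem_prPart.1 hb
    have h1 := (hmax a ha).1
    have h2 := hab.1
    refine ⟨by omega, ?_⟩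
    by_contra hlt
    have hg : Gt σ b := ⟨by omega, by omega⟩
    have := step_le_oDepth hv hS hσS.1 hb'.1 hg
    rw [hσS.2, hb'.2, step, if_pos ⟨hj, by omega⟩] at this
    omega
  have c₁ : Centered d v ((prPart d v S j).erase σ) {vProj d σ} := by
    refine ⟨fun x hx => hS x (mem_prPart.1 (Multiset.mem_of_mem_erase hx)).1,
      fun x hx y hy => incomparable_prPart hv hS j x (Multiset.mem_of_mem_erase hx) y
        (Multiset.mem_of_mem_erase hy),
      Or.inr ⟨_, rfl, vProj_mem_pos hv hσO, by simp only [vProj, star]; omega, fun x hx => ?_⟩⟩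
    have := hmax x (Multiset.mem_of_mem_erase hx)
    simp only [vProj, star]
    omega
  have c₂ : Centered d v (prPart d v S (j + 1)) {hProj d σ} := by
    refine ⟨fun x hx => hS x (mem_prPart.1 hx).1, incomparable_prPart hv hS _,
      Or.inr ⟨_, rfl, hhp, by simp only [hProj, star]; omega, fun x hx => ?_⟩⟩
    have := hnext x hx
    simp only [hProj, star]
    omega
  have hsum : symPart d v S j =
      sym d ((prPart d v S j).erase σ) {vProj d σ} + sym d (prPart d v S (j + 1)) {hProj d σ} := by
    simp only [symPart, hl, hhp, if_true]
    have hpair : ({vProj d σ, hProj d σ} : Multiset Pt) = {vProj d σ} + {hProj d σ} := rfl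
    rw [Multiset.erase_add_left_pos _ hσ, Multiset.map_add, sym, sym, hpair]
    abel
  have key := depthPart_sym_add hv c₁ c₂ ?_ ?_
  · refine ⟨c₁, c₂, ?_, ?_⟩
    · rw [oPart, if_pos hj, hsum, key.1]
    · have : ¬ Odd (j + 1) := by rw [Nat.odd_add_one]; simpa using hj
      rw [oPart, if_neg this, Nat.add_sub_cancel, hsum, key.2]
  · intro y hy x hx hg
    have hg1 := hg.1
    have hg2 := hg.2
    have hxσ : x.2 ≤ σ.2 ∧ x.1 + σ.2 ≤ 2 * d + 1 := by
      rcases Multiset.mem_add.1 hx with hx | hx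
      · have := hmax x (Multiset.mem_of_mem_erase hx)
        have := (mem_orthoPos_iff hv).1 (c₁.mem_orthoPos x hx)
        omega
      · obtain rfl : x = vProj d σ := by simpa using hx
        simp only [vProj, star]; omega
    rcases mem_sym.1 hy with hy | ⟨b, hb, rfl⟩ | hy
    · have hyn := hnext y hy
      rcases Multiset.mem_add.1 hx with hx | hx
      · have hx' := mem_prPart.1 (Multiset.mem_of_mem_erase hx)
        have hy' := mem_prPart.1 hy
        have := oDepth_lt_of_gt hv hS hy'.1 hx'.1 hg
        omega
      · obtain rfl : x = vProj d σ := by simpa using hx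
        simp only [vProj, star] at hg1; omega
    · have := hnext b hb
      simp only [hash, star] at hg1 hg2; omega
    · obtain rfl : y = hProj d σ := by simpa using hy
      simp only [hProj, star] at hg1 hg2; omega
  · intro y hy
    rcases Multiset.mem_add.1 hy with hy | hy
    · obtain ⟨a, ha, hab⟩ := exists_gt_of_even hv hS hj hy
      have h1 := hab.1
      have h2 := hab.2
      by_cases haσ : a = σ
      · subst haσ
        refine ⟨vProj d a, mem_sym.2 (by simp), ?_, ?_⟩ <;> simp only [vProj, star] <;> omega
      · exact ⟨a, mem_sym.2 (Or.inl ((Multiset.mem_erase_of_ne haσ).2 ha)), hab⟩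
    · obtain rfl : y = hProj d σ := by simpa using hy
      refine ⟨vProj d σ, mem_sym.2 (by simp), ?_, ?_⟩ <;> simp only [vProj, hProj, star] <;> omega

/-- The monomials `S_j`, `S_{j+1}` for odd `j`, when no horizontal projection of an element of
orthogonal depth `j` is in `N(v)`. -/
lemma oPart_of_no_center (hv : v ∈ orthoI d) {S : Multiset Pt} (hS : ∀ a ∈ S, a ∈ orthoPos d v)
    {j : ℕ} (hj : Odd j) (hd : ∀ a ∈ prPart d v S j, a.1 ≤ d) :
    Centered d v (prPart d v S j) 0 ∧ Centered d v (prPart d v S (j + 1)) 0 ∧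
    oPart d v S j = sym d (prPart d v S j) 0 ∧
    oPart d v S (j + 1) = sym d (prPart d v S (j + 1)) 0 := by
  have hnext : ∀ b ∈ prPart d v S (j + 1), b.1 ≤ d := by
    intro b hb
    obtain ⟨a, ha, hab⟩ := exists_gt_of_even hv hS hj hb
    exact hab.1.le.trans (hd a ha)
  have c : ∀ k, (∀ a ∈ prPart d v S k, a.1 ≤ d) → Centered d v (prPart d v S k) 0 := fun k hk =>
    ⟨fun x hx => hS x (mem_prPart.1 hx).1, incomparable_prPart hv hS k, Or.inl ⟨rfl, hk⟩⟩
  have c₁ := c j hd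
  have c₂ := c (j + 1) hnext
  have hsum : symPart d v S j =
      sym d (prPart d v S j) 0 + sym d (prPart d v S (j + 1)) 0 := by
    have h0 : ∀ P Q : Multiset Pt, P + Q + (P + Q).map (hash d) = sym d P 0 + sym d Q 0 := by
      intro P Q
      simp only [sym, Multiset.map_add, add_zero]
      abel
    rw [symPart]
    rcases hl : (arrange (prPart d v S j)).getLast? with _ | σ
    · exact h0 _ _
    · have hσ := (getLast?_arrange (incomparable_prPart hv hS j) hl).1
      have : hProj d σ ∉ pos d v := by
        rw [hProj_mem_pos_iff hv (hS σ (mem_prPart.1 hσ).1)]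
        have := hd σ hσ
        omega
      simp only [this, if_false]
      exact h0 _ _
  have key := depthPart_sym_add hv c₁ c₂ ?_ ?_
  · refine ⟨c₁, c₂, ?_, ?_⟩
    · rw [oPart, if_pos hj, hsum, key.1]
    · have : ¬ Odd (j + 1) := by rw [Nat.odd_add_one]; simpa using hj
      rw [oPart, if_neg this, Nat.add_sub_cancel, hsum, key.2]
  · intro y hy x hx hg
    have hx : x ∈ prPart d v S j := by simpa using hx
    have hxd := hd x hx
    have hx' := mem_prPart.1 hx
    have hxp := (mem_orthoPos_iff hv).1 (hS x hx'.1)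
    rcases mem_sym.1 hy with hy | ⟨b, hb, rfl⟩ | hy
    · have hy' := mem_prPart.1 hy
      have := oDepth_lt_of_gt hv hS hy'.1 hx'.1 hg
      omega
    · have := hnext b hb
      have hg2 := hg.2
      simp only [hash, star] at hg2; omega
    · simp at hy
  · intro y hy
    have hy : y ∈ prPart d v S (j + 1) := by simpa using hy
    obtain ⟨a, ha, hab⟩ := exists_gt_of_even hv hS hj hy
    exact ⟨a, mem_sym.2 (Or.inl ha), hab⟩

/-- What matters about the monomial `S_k`: it is the symmetrization of a part `B` of the elements of
orthogonal depth `k` with a central part `E`, which consists of `p_v(σ)` for an element `σ` of odd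
depth `k` or of `p_h(σ)` for an element `σ` of odd depth `k - 1`. Conversely, all elements of depth
`k`, and the projections `p_h` in `N(v)` of those of odd depth `k - 1`, lie inside elements of `B +
E`. -/
structure IsLayer (d : ℕ) (v : Finset ℕ) (S : Multiset Pt) (k : ℕ) (B E : Multiset Pt) : Prop where
  eq : oPart d v S k = sym d B E
  centered : Centered d v B E
  mem : ∀ x ∈ B, x ∈ S ∧ oDepth d v S x = k
  center : ∀ δ ∈ E, ∃ σ ∈ S, d < σ.1 ∧ (∀ x ∈ B, x.1 ≤ σ.1) ∧
    ((Odd k ∧ oDepth d v S σ = k ∧ δ = vProj d σ) ∨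
      (Odd (oDepth d v S σ) ∧ oDepth d v S σ + 1 = k ∧ δ = hProj d σ))
  exists_ge : ∀ b ∈ S, oDepth d v S b = k → ∃ x ∈ B + E, b.1 ≤ x.1 ∧ x.2 ≤ b.2
  exists_ge_hProj : ∀ b ∈ S, Odd (oDepth d v S b) → oDepth d v S b + 1 = k → d < b.1 →
    ∃ x ∈ B + E, b.1 ≤ x.1 ∧ x.2 + b.1 ≤ 2 * d + 1

/-- The two possibilities for the layers of the orthogonal depths `j`, `j + 1` with `j` odd. -/
lemma layer_cases (hv : v ∈ orthoI d) {S : Multiset Pt} (hS : ∀ a ∈ S, a ∈ orthoPos d v)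
    (j : ℕ) : (∃ σ, (arrange (prPart d v S j)).getLast? = some σ ∧ d < σ.1) ∨
      ∀ a ∈ prPart d v S j, a.1 ≤ d := by
  rcases hl : (arrange (prPart d v S j)).getLast? with _ | σ
  · right
    rw [List.getLast?_eq_none_iff] at hl
    intro a ha
    rw [← mem_arrange, hl] at ha
    simp at ha
  · by_cases hd : d < σ.1
    · exact Or.inl ⟨σ, rfl, hd⟩
    · right
      intro a ha
      have := ((getLast?_arrange (incomparable_prPart hv hS j) hl).2 a ha).1
      omega

lemma exists_isLayer (hv : v ∈ orthoI d) {S : Multiset Pt} (hS : ∀ a ∈ S, a ∈ orthoPos d v)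
    {k : ℕ} (hk : 1 ≤ k) : ∃ B E, IsLayer d v S k B E := by
  rcases Nat.even_or_odd k with he | ho
  · obtain ⟨j, rfl⟩ : ∃ j, k = j + 1 := ⟨k - 1, by omega⟩
    have hj : Odd j := by
      rw [Nat.even_add_one] at he; simpa using he
    rcases layer_cases hv hS j with ⟨σ, hl, hσd⟩ | hd
    · obtain ⟨-, c, -, e⟩ := oPart_of_center hv hS hj hl hσd
      obtain ⟨hσ, hmax⟩ := getLast?_arrange (incomparable_prPart hv hS j) hl
      have hσS := mem_prPart.1 hσ
      refine ⟨_, _, e, c, fun x hx => mem_prPart.1 hx, ?_, ?_, ?_⟩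
      · intro δ hδ
        obtain rfl : δ = hProj d σ := by simpa using hδ
        refine ⟨σ, hσS.1, hσd, ?_, Or.inr ⟨by rw [hσS.2]; exact hj, by rw [hσS.2], rfl⟩⟩
        intro x hx
        obtain ⟨a, ha, hab⟩ := exists_gt_of_even hv hS hj hx
        exact hab.1.le.trans (hmax a ha).1
      · exact fun b hb hbk =>
          ⟨b, Multiset.mem_add.2 (Or.inl (mem_prPart.2 ⟨hb, hbk⟩)), le_rfl, le_rfl⟩
      · intro b hb _ hbk hbd
        have := hmax b (mem_prPart.2 ⟨hb, by omega⟩)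
        refine ⟨hProj d σ, by simp, this.1, ?_⟩
        have := (mem_orthoPos_iff hv).1 (hS σ hσS.1)
        simp only [hProj, star]; omega
    · obtain ⟨-, c, -, e⟩ := oPart_of_no_center hv hS hj hd
      refine ⟨_, _, e, c, fun x hx => mem_prPart.1 hx, by simp, ?_, ?_⟩
      · exact fun b hb hbk =>
          ⟨b, Multiset.mem_add.2 (Or.inl (mem_prPart.2 ⟨hb, hbk⟩)), le_rfl, le_rfl⟩
      · intro b hb _ hbk hbd
        have := hd b (mem_prPart.2 ⟨hb, by omega⟩)
        omega
  · have hvac : ∀ b, Odd (oDepth d v S b) → oDepth d v S b + 1 = k → False := by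
      rintro b h1 rfl
      rw [Nat.odd_add_one] at ho
      exact ho h1
    rcases layer_cases hv hS k with ⟨σ, hl, hσd⟩ | hd
    · obtain ⟨c, -, e, -⟩ := oPart_of_center hv hS ho hl hσd
      obtain ⟨hσ, hmax⟩ := getLast?_arrange (incomparable_prPart hv hS k) hl
      have hσS := mem_prPart.1 hσ
      refine ⟨_, _, e, c, fun x hx => mem_prPart.1 (Multiset.mem_of_mem_erase hx), ?_, ?_, ?_⟩
      · intro δ hδ
        obtain rfl : δ = vProj d σ := by simpa using hδ
        exact ⟨σ, hσS.1, hσd, fun x hx => (hmax x (Multiset.mem_of_mem_erase hx)).1,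
          Or.inl ⟨ho, hσS.2, rfl⟩⟩
      · intro b hb hbk
        by_cases hbσ : b = σ
        · subst hbσ
          have := (mem_orthoPos_iff hv).1 (hS b hσS.1)
          refine ⟨vProj d b, by simp, ?_, le_rfl⟩
          simp only [vProj, star]; omega
        · exact ⟨b, Multiset.mem_add.2 (Or.inl ((Multiset.mem_erase_of_ne hbσ).2
            (mem_prPart.2 ⟨hb, hbk⟩))), le_rfl, le_rfl⟩
      · exact fun b _ h1 h2 => (hvac b h1 h2).elim
    · obtain ⟨c, -, e, -⟩ := oPart_of_no_center hv hS ho hd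
      refine ⟨_, _, e, c, fun x hx => mem_prPart.1 hx, by simp, ?_, ?_⟩
      · exact fun b hb hbk =>
          ⟨b, Multiset.mem_add.2 (Or.inl (mem_prPart.2 ⟨hb, hbk⟩)), le_rfl, le_rfl⟩
      · exact fun b _ h1 h2 => (hvac b h1 h2).elim

/-- Replacing `σ, σ^#` by `p_v(σ), p_h(σ)` does not affect the number of elements, but may move one
element from `S_j` to `S_{j+1}`. -/
lemma card_oPart_add (hv : v ∈ orthoI d) {S : Multiset Pt} (hS : ∀ a ∈ S, a ∈ orthoPos d v)
    {j : ℕ} (hj : Odd j) : (oPart d v S j).card + (oPart d v S (j + 1)).card =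
      2 * ((prPart d v S j).card + (prPart d v S (j + 1)).card) := by
  rcases layer_cases hv hS j with ⟨σ, hl, hσd⟩ | hd
  · obtain ⟨-, -, e, e'⟩ := oPart_of_center hv hS hj hl hσd
    have hσ := (getLast?_arrange (incomparable_prPart hv hS j) hl).1
    have := Multiset.card_erase_of_mem hσ
    have := Multiset.card_pos_iff_exists_mem.2 ⟨σ, hσ⟩
    simp only [e, e', sym, Multiset.card_add, Multiset.card_map, Multiset.card_singleton]
    rw [Nat.pred_eq_sub_one] at *
    omega
  · obtain ⟨-, -, e, e'⟩ := oPart_of_no_center hv hS hj hd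
    simp only [e, e', sym, Multiset.card_add, Multiset.card_map, Multiset.card_zero]
    omega

/-! ### The regions covered by the monomials `S_k`, and their nesting -/

/-- `t` is covered at level `k`: some element of `S` straddles `t` and either it has orthogonal
depth `k`, or it has odd orthogonal depth `k - 1` and its horizontal projection straddles `t`. For
`t ≤ d + 1` this means that some element of `S_k` straddles `t`, by `IsLayer.exists_straddles_iff`.
-/
def Covers (d : ℕ) (v : Finset ℕ) (S : Multiset Pt) (k t : ℕ) : Prop :=
  ∃ a ∈ S, Straddles t a ∧ (oDepth d v S a = k ∨
    (Odd (oDepth d v S a) ∧ oDepth d v S a + 1 = k ∧ 2 * d + 1 < a.1 + t))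

lemma Covers.le (hv : v ∈ orthoI d) {S : Multiset Pt} (hS : ∀ a ∈ S, a ∈ orthoPos d v) {k t : ℕ}
    (h : Covers d v S k t) : k ≤ 2 * S.card := by
  obtain ⟨a, ha, -, h⟩ := h
  have := oDepth_lt hv hS ha
  omega

/-- The height of an element is the largest level at which it covers `t`. -/
lemma covers_height {S : Multiset Pt} {t : ℕ} {a : Pt} (ha : a ∈ S) (hat : Straddles t a) :
    Covers d v S (height d t (oDepth d v S a) a) t := by
  refine ⟨a, ha, hat, ?_⟩
  unfold height
  split_ifs with h
  · exact Or.inr ⟨h.1, rfl, h.2⟩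
  · exact Or.inl rfl

lemma Covers.exists_le_height {S : Multiset Pt} {k t : ℕ} (h : Covers d v S k t) :
    ∃ a ∈ S, Straddles t a ∧ k ≤ height d t (oDepth d v S a) a := by
  obtain ⟨a, ha, hat, h⟩ := h
  refine ⟨a, ha, hat, ?_⟩
  rcases h with h | ⟨h1, h2, h3⟩
  · exact h ▸ le_height _ _ _
  · rw [height, if_pos ⟨h1, h3⟩, h2]

lemma IsLayer.exists_straddles_iff (hv : v ∈ orthoI d) {S : Multiset Pt}
    (hS : ∀ a ∈ S, a ∈ orthoPos d v) {k : ℕ} {B E : Multiset Pt} (h : IsLayer d v S k B E) {t : ℕ}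
    (ht : t ≤ d + 1) : (∃ x ∈ oPart d v S k, Straddles t x) ↔ Covers d v S k t := by
  rw [h.eq]
  constructor
  · have hB : ∀ x ∈ B, Straddles t x → Covers d v S k t := fun x hx hs =>
      ⟨x, (h.mem x hx).1, hs, Or.inl (h.mem x hx).2⟩
    rintro ⟨x, hx, hs⟩
    rcases mem_sym.1 hx with hx | ⟨b, hb, rfl⟩ | hx
    · exact hB x hx hs
    -- Below the centre, a reflected point straddles less than the point itself.
    · have := (mem_orthoPos_iff hv).1 (h.centered.mem_orthoPos b hb)
      have hs1 := hs.1
      simp only [hash, star] at hs1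
      exact hB b hb ⟨by omega, by omega⟩
    · obtain ⟨σ, hσ, hσd, -, h1⟩ := h.center x hx
      have hσp := (mem_orthoPos_iff hv).1 (hS σ hσ)
      have hs1 := hs.1
      rcases h1 with ⟨-, h2, rfl⟩ | ⟨h2, h3, rfl⟩
      · exact ⟨σ, hσ, ⟨hs1, by omega⟩, Or.inl h2⟩
      · simp only [hProj, star] at hs1
        exact ⟨σ, hσ, ⟨by omega, by omega⟩, Or.inr ⟨h2, h3, by omega⟩⟩
  · have hm : ∀ x ∈ B + E, x ∈ sym d B E := by
      intro x hx
      rw [mem_sym]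
      rcases Multiset.mem_add.1 hx with hx | hx <;> simp [hx]
    rintro ⟨a, ha, hat, h1⟩
    have h2 := hat.1
    have h3 := hat.2
    rcases h1 with h1 | ⟨h1, h1', h1''⟩
    · obtain ⟨x, hx, hx'⟩ := h.exists_ge a ha h1
      exact ⟨x, hm x hx, by omega, by omega⟩
    · obtain ⟨x, hx, hx'⟩ := h.exists_ge_hProj a ha h1 h1' (by omega)
      exact ⟨x, hm x hx, by omega, by omega⟩

/-- An element of orthogonal depth `k + 1` lies, together with its boundary, in the region covered
at level `k`. -/
lemma covers_of_oDepth_eq_succ (hv : v ∈ orthoI d) {S : Multiset Pt}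
    (hS : ∀ a ∈ S, a ∈ orthoPos d v) {k : ℕ} (hk : 1 ≤ k) {a : Pt} (ha : a ∈ S)
    (hak : oDepth d v S a = k + 1) {t : ℕ} (h1 : a.2 ≤ t) (h2 : t ≤ a.1 + 1) :
    Covers d v S k t := by
  rcases exists_oDepth_eq_step hv hS ha with h | ⟨b, hb, hba, h⟩
  · omega
  · have h3 := hba.1
    have h4 := hba.2
    refine ⟨b, hb, ⟨by omega, by omega⟩, ?_⟩
    rw [hak, step] at h
    split_ifs at h with hc
    · exact Or.inr ⟨hc.1, by omega, by omega⟩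
    · exact Or.inl (by omega)

lemma IsLayer.isSymm (hv : v ∈ orthoI d) {S : Multiset Pt} {k : ℕ} {B E : Multiset Pt}
    (h : IsLayer d v S k B E) : IsSymm d v (oPart d v S k) := h.eq ▸ h.centered.isSymm hv

lemma IsLayer.incomparable (hv : v ∈ orthoI d) {S : Multiset Pt} {k : ℕ} {B E : Multiset Pt}
    (h : IsLayer d v S k B E) : Incomparable (oPart d v S k) :=
  h.eq ▸ h.centered.incomparable_sym hv

/-- The analogue of `covers_of_oDepth_eq_succ` for the elements of `S_{k+1}`. -/
lemma covers_of_mem_oPart_succ (hv : v ∈ orthoI d) {S : Multiset Pt}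
    (hS : ∀ a ∈ S, a ∈ orthoPos d v) {k : ℕ} (hk : 1 ≤ k) {x : Pt} (hx : x ∈ oPart d v S (k + 1))
    {t : ℕ} (ht : t ≤ d + 1) (h1 : x.2 ≤ t) (h2 : t ≤ x.1 + 1) : Covers d v S k t := by
  obtain ⟨B, E, h⟩ := exists_isLayer hv hS (k := k + 1) (by omega)
  rw [h.eq] at hx
  rcases mem_sym.1 hx with hx | ⟨b, hb, rfl⟩ | hx
  · exact covers_of_oDepth_eq_succ hv hS hk (h.mem x hx).1 (h.mem x hx).2 h1 h2
  · have := (mem_orthoPos_iff hv).1 (h.centered.mem_orthoPos b hb)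
    simp only [hash, star] at h1 h2
    exact covers_of_oDepth_eq_succ hv hS hk (h.mem b hb).1 (h.mem b hb).2 (by omega) (by omega)
  · obtain ⟨σ, hσ, hσd, -, h3⟩ := h.center x hx
    have hσp := (mem_orthoPos_iff hv).1 (hS σ hσ)
    rcases h3 with ⟨-, h4, rfl⟩ | ⟨h4, h5, rfl⟩
    · exact covers_of_oDepth_eq_succ hv hS hk hσ h4 h1 (by omega)
    · simp only [hProj, star] at h1
      exact ⟨σ, hσ, ⟨by omega, by omega⟩, Or.inl (by omega)⟩

/-- The region covered by `S_{k+1}`, together with its boundary, lies in that covered by `S_k`. -/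
lemma exists_straddles_of_mem_oPart_succ (hv : v ∈ orthoI d) {S : Multiset Pt}
    (hS : ∀ a ∈ S, a ∈ orthoPos d v) {k : ℕ} (hk : 1 ≤ k) {x : Pt} (hx : x ∈ oPart d v S (k + 1))
    {t : ℕ} (h1 : x.2 ≤ t) (h2 : t ≤ x.1 + 1) : ∃ y ∈ oPart d v S k, Straddles t y := by
  obtain ⟨B, E, h⟩ := exists_isLayer hv hS hk
  obtain ⟨B', E', h'⟩ := exists_isLayer hv hS (k := k + 1) (by omega)
  by_cases ht : t ≤ d + 1
  · rw [h.exists_straddles_iff hv hS ht]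
    exact covers_of_mem_oPart_succ hv hS hk hx ht h1 h2
  · have hxp := (mem_pos_iff hv).1 ((h'.isSymm hv).mem_pos x hx)
    have : Covers d v S k (2 * d + 2 - t) := by
      refine covers_of_mem_oPart_succ hv hS hk ((h'.isSymm hv).hash_mem hx) (by omega) ?_ ?_ <;>
        simp only [hash, star] <;> omega
    rw [← h.exists_straddles_iff hv hS (by omega)] at this
    have := (h.isSymm hv).exists_straddles_reflect hv (by omega) this
    rwa [show 2 * d + 2 - (2 * d + 2 - t) = t by omega] at this

lemma exists_straddles_of_mem_oPart (hv : v ∈ orthoI d) {S : Multiset Pt}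
    (hS : ∀ a ∈ S, a ∈ orthoPos d v) {k k' : ℕ} (hk : 1 ≤ k) (hkk : k < k') {x : Pt}
    (hx : x ∈ oPart d v S k') {t : ℕ} (h1 : x.2 ≤ t) (h2 : t ≤ x.1 + 1) :
    ∃ y ∈ oPart d v S k, Straddles t y := by
  induction k', hkk using Nat.le_induction generalizing x with
  | base => exact exists_straddles_of_mem_oPart_succ hv hS hk hx h1 h2
  | succ k' hkk ih =>
    obtain ⟨y, hy, hs⟩ := exists_straddles_of_mem_oPart_succ hv hS (by omega) hx h1 h2
    exact ih hy hs.1.le (hs.2.trans (by omega))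

lemma exists_straddles_anti (hv : v ∈ orthoI d) {S : Multiset Pt}
    (hS : ∀ a ∈ S, a ∈ orthoPos d v) {k k' : ℕ} (hk : 1 ≤ k) (hkk : k ≤ k') {t : ℕ}
    (h : ∃ x ∈ oPart d v S k', Straddles t x) : ∃ y ∈ oPart d v S k, Straddles t y := by
  rcases hkk.eq_or_lt with rfl | hkk
  · exact h
  · obtain ⟨x, hx, hs⟩ := h
    exact exists_straddles_of_mem_oPart hv hS hk hkk hx hs.1.le (hs.2.trans (by omega))

/-! ### The distinguished monomial of `π_O(S)` -/

/-- The union of the distinguished monomials of the `π(S_k)`. -/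
noncomputable def opiTop (d : ℕ) (v : Finset ℕ) (S : Multiset Pt) : Multiset Pt :=
  ∑ k ∈ Finset.Icc 1 (2 * S.card + 1), piTop d v (oPart d v S k)

lemma countP_sum {ι : Type*} (s : Finset ι) (f : ι → Multiset Pt) (p : Pt → Prop)
    [DecidablePred p] : (∑ k ∈ s, f k).countP p = ∑ k ∈ s, (f k).countP p :=
  map_sum (Multiset.countPAddMonoidHom p) f s

lemma nodup_sum {s : Finset ℕ} {f : ℕ → Multiset ℕ} (h : ∀ k ∈ s, (f k).Nodup)
    (h' : ∀ k ∈ s, ∀ k' ∈ s, k < k' → Disjoint (f k) (f k')) : (∑ k ∈ s, f k).Nodup := by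
  induction s using Finset.induction_on with
  | empty => simp
  | insert a s ha ih =>
    rw [Finset.sum_insert ha, Multiset.nodup_add]
    refine ⟨h a (by simp), ih (fun k hk => h k (by simp [hk]))
      (fun k hk k' hk' => h' k (by simp [hk]) k' (by simp [hk'])), ?_⟩
    rw [Multiset.disjoint_left]
    intro x hx hx'
    obtain ⟨k, hk, hxk⟩ := Multiset.mem_sum.1 hx'
    have hak : a ≠ k := by rintro rfl; exact ha hk
    rcases lt_or_gt_of_ne hak with hlt | hlt
    · exact Multiset.disjoint_left.1 (h' a (by simp) k (by simp [hk]) hlt) hx hxk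
    · exact Multiset.disjoint_left.1 (h' k (by simp [hk]) a (by simp) hlt) hxk hx

/-- The columns of the block tops of `S_{k'}` are distinct from those of the block tops of `S_k` for
`k < k'`: by nesting they lie in the region covered by `S_k`, while the latter do not. -/
lemma isSymmDistinct_opiTop (hv : v ∈ orthoI d) {S : Multiset Pt}
    (hS : ∀ a ∈ S, a ∈ orthoPos d v) : IsSymmDistinct d v (opiTop d v S) := by
  have hk : ∀ k ∈ Finset.Icc 1 (2 * S.card + 1), IsSymm d v (oPart d v S k) ∧
      Incomparable (oPart d v S k) := by
    intro k hk
    obtain ⟨B, E, h⟩ := exists_isLayer hv hS (Finset.mem_Icc.1 hk).1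
    exact ⟨h.isSymm hv, h.incomparable hv⟩
  have hd := fun k h => (hk k h).1.isSymmDistinct_piTop hv (hk k h).2
  have hmap : ∀ f : Pt → ℕ, (opiTop d v S).map f =
      ∑ k ∈ Finset.Icc 1 (2 * S.card + 1), (piTop d v (oPart d v S k)).map f := fun f =>
    map_sum (Multiset.mapAddMonoidHom f) _ _
  refine ⟨fun x hx => ?_, ?_, ?_, fun t ht => ?_⟩
  · obtain ⟨k, hk, hx⟩ := Multiset.mem_sum.1 hx
    exact (hd k hk).mem_pos x hx
  · rw [hmap, hmap]
    have hs : (∑ k ∈ Finset.Icc 1 (2 * S.card + 1), (piTop d v (oPart d v S k)).map Prod.snd).map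
        (star d) = ∑ k ∈ Finset.Icc 1 (2 * S.card + 1),
          ((piTop d v (oPart d v S k)).map Prod.snd).map (star d) :=
      map_sum (Multiset.mapAddMonoidHom (star d)) _ _
    rw [hs]
    exact Finset.sum_congr rfl fun k hk => (hd k hk).map_fst
  · rw [hmap]
    refine nodup_sum (fun k hk => (hd k hk).nodup_snd) fun k hkm k' hk' hlt => ?_
    rw [Multiset.disjoint_left]
    intro c hc hc'
    rw [((hk k hkm).2.piTop_snd hv (hk k hkm).1.mem_pos).2] at hc
    rw [((hk k' hk').2.piTop_snd hv (hk k' hk').1.mem_pos).2] at hc'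
    obtain ⟨⟨x, hx, rfl⟩, -⟩ := hc'
    have hxp := (mem_pos_iff hv).1 ((hk k' hk').1.mem_pos x hx)
    obtain ⟨y, hy, hs⟩ := exists_straddles_of_mem_oPart hv hS (Finset.mem_Icc.1 hkm).1 hlt hx
      (t := x.2) le_rfl (by omega)
    exact hc.2 y hy hs
  · rw [opiTop, countP_sum, countP_sum]
    exact Finset.sum_congr rfl fun k hk => (hd k hk).reflect t ht

open scoped Classical in
/-- Each `S_k` with an element straddling `t` has exactly one block top that does. -/
lemma countP_straddles_opiTop (hv : v ∈ orthoI d) {S : Multiset Pt}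
    (hS : ∀ a ∈ S, a ∈ orthoPos d v) (t : ℕ) : (opiTop d v S).countP (Straddles t) =
      ((Finset.Icc 1 (2 * S.card + 1)).filter
        (fun k => ∃ x ∈ oPart d v S k, Straddles t x)).card := by
  rw [opiTop, countP_sum, Finset.card_filter]
  refine Finset.sum_congr rfl fun k hk => ?_
  obtain ⟨B, E, h⟩ := exists_isLayer hv hS (Finset.mem_Icc.1 hk).1
  exact (h.incomparable hv).countP_straddles_piTop hv (h.isSymm hv).mem_pos t

/-- By nesting, the levels with an element straddling `t` form an initial segment. -/
lemma Covers.le_countP_opiTop (hv : v ∈ orthoI d) {S : Multiset Pt}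
    (hS : ∀ a ∈ S, a ∈ orthoPos d v) {k t : ℕ} (ht : t ≤ d + 1) (h : Covers d v S k t) :
    k ≤ (opiTop d v S).countP (Straddles t) := by
  classical
  rcases Nat.eq_zero_or_pos k with rfl | hk
  · omega
  obtain ⟨B, E, hl⟩ := exists_isLayer hv hS hk
  have h1 := (hl.exists_straddles_iff hv hS ht).2 h
  have h2 := h.le hv hS
  rw [countP_straddles_opiTop hv hS]
  calc k = (Finset.Icc 1 k).card := by simp
    _ ≤ _ := Finset.card_le_card fun i hi => by
      rw [Finset.mem_Icc] at hi
      rw [Finset.mem_filter, Finset.mem_Icc]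
      exact ⟨by omega, exists_straddles_anti hv hS hi.1 hi.2 h1⟩

lemma covers_countP_opiTop (hv : v ∈ orthoI d) {S : Multiset Pt}
    (hS : ∀ a ∈ S, a ∈ orthoPos d v) {t : ℕ} (ht : t ≤ d + 1)
    (h0 : 0 < (opiTop d v S).countP (Straddles t)) :
    Covers d v S ((opiTop d v S).countP (Straddles t)) t := by
  classical
  obtain ⟨B, E, hl⟩ := exists_isLayer hv hS h0
  rw [← hl.exists_straddles_iff hv hS ht]
  by_contra hne
  have : (opiTop d v S).countP (Straddles t) ≤
      (Finset.Icc 1 ((opiTop d v S).countP (Straddles t) - 1)).card := by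
    conv_lhs => rw [countP_straddles_opiTop hv hS]
    refine Finset.card_le_card fun i hi => ?_
    rw [Finset.mem_filter, Finset.mem_Icc] at hi
    rw [Finset.mem_Icc]
    refine ⟨hi.1.1, ?_⟩
    by_contra hlt
    exact hne (exists_straddles_anti hv hS h0 (by omega) hi.2)
  simp at this
  omega

lemma sum_Icc_pairs (g : ℕ → ℕ) (n : ℕ) : ∑ k ∈ Finset.Icc 1 (2 * n), g k =
    ∑ i ∈ Finset.range n, (g (2 * i + 1) + g (2 * i + 1 + 1)) := by
  induction n with
  | zero => simp
  | succ n ih =>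
    rw [Finset.sum_range_succ, ← ih, show 2 * (n + 1) = 2 * n + 1 + 1 by ring,
      Finset.sum_Icc_succ_top (by omega), Finset.sum_Icc_succ_top (by omega)]
    ring

/-- The last index in the definition of `opi` contributes nothing, which leaves complete pairs `j`,
`j + 1` with `j` odd. -/
lemma oPart_eq_zero (hv : v ∈ orthoI d) {S : Multiset Pt} (hS : ∀ a ∈ S, a ∈ orthoPos d v) :
    oPart d v S (2 * S.card + 1) = 0 := by
  have h0 : prPart d v S (2 * S.card + 1) = 0 := by
    rw [Multiset.eq_zero_iff_forall_notMem]
    intro a ha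
    rw [mem_prPart] at ha
    have := oDepth_lt hv hS ha.1
    omega
  obtain ⟨-, -, e, -⟩ := oPart_of_no_center hv hS (j := 2 * S.card + 1) ⟨_, rfl⟩ (by simp [h0])
  rw [e, h0]; rfl

/-- The number of elements straddling the centre is even, as `S_j` and `S_{j+1}`, for odd `j`,
either both contain such elements or both do not. -/
lemma even_countP_opiTop (hv : v ∈ orthoI d) {S : Multiset Pt} (hS : ∀ a ∈ S, a ∈ orthoPos d v) :
    Even ((opiTop d v S).countP (Straddles (d + 1))) := by
  classical
  have hz : piTop d v (0 : Multiset Pt) = 0 := by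
    have := Incomparable.card_piTop_add (d := d) (v := v) (T := 0) hv
      (fun a ha => by simp at ha) (by simp)
    exact Multiset.card_eq_zero.1 (by simp at this; simp [this.1])
  rw [opiTop, countP_sum, Finset.sum_Icc_succ_top (by omega), oPart_eq_zero hv hS, hz,
    Multiset.countP_zero, add_zero, sum_Icc_pairs]
  refine Finset.even_sum _ fun i _ => ?_
  have hj : Odd (2 * i + 1) := ⟨i, rfl⟩
  obtain ⟨B, E, h⟩ := exists_isLayer hv hS (k := 2 * i + 1) (by omega)
  obtain ⟨B', E', h'⟩ := exists_isLayer hv hS (k := 2 * i + 1 + 1) (by omega)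
  rw [(h.incomparable hv).countP_straddles_piTop hv (h.isSymm hv).mem_pos,
    (h'.incomparable hv).countP_straddles_piTop hv (h'.isSymm hv).mem_pos]
  have : (∃ x ∈ oPart d v S (2 * i + 1), Straddles (d + 1) x) ↔
      ∃ x ∈ oPart d v S (2 * i + 1 + 1), Straddles (d + 1) x := by
    constructor
    · rw [h.exists_straddles_iff hv hS le_rfl, h'.exists_straddles_iff hv hS le_rfl]
      rintro ⟨a, ha, hat, h1 | ⟨h1, h2, -⟩⟩
      · have := hat.2
        exact ⟨a, ha, hat, Or.inr ⟨by rwa [h1], by omega, by omega⟩⟩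
      · exfalso
        rw [← h2, Nat.odd_add_one] at hj
        exact hj h1
    · exact exists_straddles_anti hv hS (by omega) (by omega)
  rw [if_congr this rfl rfl]
  exact ⟨_, rfl⟩

/-! ### Degrees -/

/-- Partition of a multiset into fibres. -/
lemma sum_card_filter_eq (s : Finset ℕ) (f : Pt → ℕ) (S : Multiset Pt) (h : ∀ a ∈ S, f a ∈ s) :
    ∑ k ∈ s, (S.filter (fun a => f a = k)).card = S.card := by
  induction S using Multiset.induction with
  | empty => simp
  | cons a S ih =>
    rw [Multiset.card_cons, ← ih fun b hb => h b (by simp [hb])]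
    have : ∀ k, ((a ::ₘ S).filter (fun a => f a = k)).card =
        (S.filter (fun a => f a = k)).card + if f a = k then 1 else 0 := by
      intro k
      rw [Multiset.filter_cons]
      split_ifs <;> simp [add_comm]
    simp only [this, Finset.sum_add_distrib, Finset.sum_ite_eq, h a (by simp), if_true]

lemma sum_card_oPart (hv : v ∈ orthoI d) {S : Multiset Pt} (hS : ∀ a ∈ S, a ∈ orthoPos d v) :
    ∑ k ∈ Finset.Icc 1 (2 * S.card + 1), (oPart d v S k).card = 2 * S.card := by
  have h1 : ∑ k ∈ Finset.Icc 1 (2 * S.card), (prPart d v S k).card = S.card := by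
    classical
    refine (Finset.sum_congr rfl fun k _ => ?_).trans <|
      sum_card_filter_eq (Finset.Icc 1 (2 * S.card)) (oDepth d v S) S fun a ha =>
        Finset.mem_Icc.2 ⟨one_le_oDepth hv hS ha, (oDepth_lt hv hS ha).le⟩
    rw [prPart]
  rw [Finset.sum_Icc_succ_top (by omega), oPart_eq_zero hv hS, Multiset.card_zero, add_zero]
  conv_rhs => rw [← h1]
  rw [sum_Icc_pairs, sum_Icc_pairs, Finset.mul_sum]
  exact Finset.sum_congr rfl fun i _ => card_oPart_add hv hS ⟨i, rfl⟩

/-- The second component of `π_O(S)`. -/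
lemma opi_snd (S : Multiset Pt) : (opi d v S).2 = ∑ k ∈ Finset.Icc 1 (2 * S.card + 1),
    (piRest d v (oPart d v S k)).filter (fun a => a ∈ orthoPos d v) := by
  rw [opi]
  induction Finset.Icc 1 (2 * S.card + 1) using Finset.induction_on with
  | empty => simp
  | insert a s ha ih =>
    simp only at ih ⊢
    rw [Finset.sum_insert ha, Finset.sum_insert ha, Multiset.filter_add, ih]

lemma card_opiTop_add (hv : v ∈ orthoI d) {S : Multiset Pt} (hS : ∀ a ∈ S, a ∈ orthoPos d v) :
    (opiTop d v S).card + 2 * (opi d v S).2.card = 2 * S.card := by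
  rw [← sum_card_oPart hv hS, opi_snd, opiTop, Multiset.card_sum, Multiset.card_sum,
    Finset.mul_sum, ← Finset.sum_add_distrib]
  refine Finset.sum_congr rfl fun k hk => ?_
  obtain ⟨B, E, h⟩ := exists_isLayer hv hS (Finset.mem_Icc.1 hk).1
  have h1 := (h.incomparable hv).card_piTop_add hv (h.isSymm hv).mem_pos
  have h2 := h.centered.card_piRest_sym hv
  rw [← h.eq] at h2
  omega

/-- Twice the `v`-degree is the number of points. -/
lemma IsSymmDistinct.card_sdiff_assoc (hv : v ∈ orthoI d) {D : Multiset Pt}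
    (h : IsSymmDistinct d v D) : (v \ assoc v D).card = D.card := by
  have : v \ assoc v D = (D.map Prod.snd).toFinset := by
    ext k
    simp only [assoc, Finset.mem_sdiff, Finset.mem_union, Multiset.mem_toFinset]
    constructor
    · rintro ⟨h1, h2⟩
      tauto
    · intro hk
      have hkv : k ∈ v := by
        obtain ⟨x, hx, rfl⟩ := Multiset.mem_map.1 hk
        exact ((mem_pos_iff hv).1 (h.mem_pos x hx)).2.2.2.2
      refine ⟨hkv, ?_⟩
      rintro (h1 | h1)
      · exact h1.2 hk
      · obtain ⟨x, hx, rfl⟩ := Multiset.mem_map.1 h1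
        exact ((mem_pos_iff hv).1 (h.mem_pos x hx)).2.2.2.1 hkv
  rw [this, Multiset.toFinset_card_of_nodup h.nodup_snd, Multiset.card_map]

/-! ### The levels of the elements of `S'` -/

/-- Elements of depth greater than `k` lie inside some element of `S_k`. -/
lemma exists_ge_of_lt_oDepth (hv : v ∈ orthoI d) {S : Multiset Pt}
    (hS : ∀ a ∈ S, a ∈ orthoPos d v) {k : ℕ} (hk : 1 ≤ k) {B E : Multiset Pt}
    (h : IsLayer d v S k B E) (n : ℕ) : ∀ a ∈ S, oDepth d v S a = n → k < n →
      ∃ x ∈ B + E, a.1 ≤ x.1 ∧ x.2 ≤ a.2 := by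
  induction n using Nat.strong_induction_on with
  | _ n ih =>
    intro a ha han hkn
    have hap := (mem_orthoPos_iff hv).1 (hS a ha)
    rcases exists_oDepth_eq_step hv hS ha with h1 | ⟨b, hb, hba, h1⟩
    · omega
    · have h2 := hba.1
      have h3 := hba.2
      have h4 := oDepth_lt_of_gt hv hS hb ha hba
      rcases lt_trichotomy (oDepth d v S b) k with hlt | heq | hgt
      · rw [step] at h1
        split_ifs at h1 with hc
        · obtain ⟨x, hx, hx'⟩ := h.exists_ge_hProj b hb hc.1 (by omega) (by omega)
          exact ⟨x, hx, by omega, by omega⟩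
        · omega
      · obtain ⟨x, hx, hx'⟩ := h.exists_ge b hb heq
        exact ⟨x, hx, by omega, by omega⟩
      · obtain ⟨x, hx, hx'⟩ := ih _ (by omega) b hb rfl hgt
        exact ⟨x, hx, by omega, by omega⟩

/-- For `k' < k`, the elements of `S'` that come from `S_k` lie inside elements of `S_{k'}`. -/
lemma IsLayer.exists_ge_lowerRest (hv : v ∈ orthoI d) {S : Multiset Pt}
    (hS : ∀ a ∈ S, a ∈ orthoPos d v) {k k' : ℕ} (hk' : 1 ≤ k') {B E B' E' : Multiset Pt}
    (h : IsLayer d v S k B E) (h' : IsLayer d v S k' B' E') (hkk : k' < k) {b : Pt}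
    (hb : b ∈ lowerRest v d B E) : ∃ x ∈ B' + E', b.1 ≤ x.1 ∧ x.2 ≤ b.2 := by
  obtain ⟨-, x, hx, y, hy, rfl, h1, h2, -⟩ := h.centered.lowerRest_mem hv hb
  rcases Multiset.mem_add.1 hy with hy | hy
  · obtain ⟨z, hz, hz'⟩ := exists_ge_of_lt_oDepth hv hS hk' h' k y (h.mem y hy).1 (h.mem y hy).2 hkk
    exact ⟨z, hz, by simp only; omega, hz'.2⟩
  · obtain ⟨σ, hσ, hσd, hBσ, h3⟩ := h.center y hy
    have hσp := (mem_orthoPos_iff hv).1 (hS σ hσ)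
    have hxσ := hBσ x hx
    have hyσ : σ.2 ≤ y.2 := by
      rcases h3 with ⟨-, -, rfl⟩ | ⟨-, -, rfl⟩
      · exact le_rfl
      · simp only [hProj, star]; omega
    -- The depth of `σ` is `k` or `k - 1`, hence at least `k'`.
    have key : k' < oDepth d v S σ ∨ oDepth d v S σ = k' := by omega
    rcases key with h4 | h4
    · obtain ⟨z, hz, hz'⟩ := exists_ge_of_lt_oDepth hv hS hk' h' _ σ hσ rfl h4
      exact ⟨z, hz, by simp only; omega, by simp only; omega⟩
    · obtain ⟨z, hz, hz'⟩ := h'.exists_ge σ hσ h4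
      exact ⟨z, hz, by simp only; omega, by simp only; omega⟩

/-- Along a chain in `S'`, the level `k` of the `S_k'` from which an element is taken grows at least
as fast as orthogonal depth does. Indeed, `b'` is interlaced from successive elements of `S_{k'}`,
so no element `z` of the lower half of `S_{k'}` satisfies `b'.1 < z.1` and `z.2 < b'.2`. If `k'`
were too small, there would be such a `z`: by nesting if `k' < k`, among the two elements from which
`b` arises if `k' = k`, and beyond a horizontal projection if the rule asks for an increase by two
and `k' = k + 1`. -/
lemma step_le_of_lowerRest (hv : v ∈ orthoI d) {S : Multiset Pt}
    (hS : ∀ a ∈ S, a ∈ orthoPos d v) {k k' : ℕ} (hk' : 1 ≤ k') {B E B' E' : Multiset Pt}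
    (h : IsLayer d v S k B E) (h' : IsLayer d v S k' B' E') 
    (hsame : k = k' → B = B' ∧ E = E') {b b' : Pt}
    (hb : b ∈ lowerRest v d B E) (hb' : b' ∈ lowerRest v d B' E') (hbb : Gt b b') :
    step d k b b' ≤ k' := by
  have hg1 := hbb.1
  have hg2 := hbb.2
  obtain ⟨hbO, x, hx, y, hy, hbe, h1, h2, h3⟩ := h.centered.lowerRest_mem hv hb
  obtain ⟨hbO', x', hx', y', hy', hbe', h1', h2', h3'⟩ := h'.centered.lowerRest_mem hv hb'
  have hB' := (mem_orthoPos_iff hv).1 hbO'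
  have e1 : b.1 = x.1 := by rw [hbe]
  have e2 : b.2 = y.2 := by rw [hbe]
  have e1' : b'.1 = x'.1 := by rw [hbe']
  have e2' : b'.2 = y'.2 := by rw [hbe']
  have not_lt : ¬ k' < k := by
    intro hlt
    obtain ⟨z, hz, hz1, hz2⟩ := h.exists_ge_lowerRest hv hS hk' h' hlt hb
    have := h3' z hz
    omega
  have hne : k ≠ k' := by
    intro heq
    obtain ⟨rfl, rfl⟩ := hsame heq
    have := h3' y hy
    omega
  unfold step
  split_ifs with hc
  · have : k + 1 ≠ k' := by
      intro heq
      have hxk := h.mem x hx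
      obtain ⟨z, hz, hz1, hz2⟩ := h'.exists_ge_hProj x hxk.1 (by rw [hxk.2]; exact hc.1)
        (by omega) (by omega)
      have := h3' z hz
      omega
    omega
  · omega

/-! ### Domination -/

/-- The first component of `π_O(S)` dominates `T` if every element `a` of `T` has a level `κ a` that
grows along chains at least as fast as orthogonal depth, such that the thresholds straddled by `a`
are covered by `S` at the level `height d t (κ a) a`. -/
lemma dominates_of_covers (hv : v ∈ orthoI d) {S T : Multiset Pt}
    (hS : ∀ a ∈ S, a ∈ orthoPos d v) (hT : ∀ a ∈ T, a ∈ orthoPos d v) (κ : Pt → ℕ)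
    (h1 : ∀ a ∈ T, 1 ≤ κ a) (hκ : ∀ a ∈ T, ∀ b ∈ T, Gt a b → step d (κ a) a b ≤ κ b)
    (hcov : ∀ a ∈ T, ∀ t, Straddles t a → Covers d v S (height d t (κ a) a) t) :
    Dominates d v (assoc v (opiTop d v S)) T := by
  rintro C ⟨hch, hCT⟩
  have hC : ∀ a ∈ C, a ∈ orthoPos d v := fun a ha => hT a (hCT a ha)
  have hD := isSymmDistinct_chainMonomial hv hC hch
  have hE := isSymmDistinct_opiTop hv hS
  rw [chainElt, hD.le_assoc_iff hv hE]
  refine hD.countP_straddles_le hv hE fun t ht => ?_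
  rcases countP_straddles_chainMonomial_le hv ht κ hC hch (fun x hx => h1 x (hCT x hx))
    (fun x hx y hy => hκ x (hCT x hx) y (hCT y hy)) with h | ⟨a, ha, hat, h⟩
  · omega
  · exact h.trans ((hcov a (hCT a ha) t hat).le_countP_opiTop hv hS ht)

lemma dominates_opiTop (hv : v ∈ orthoI d) {S : Multiset Pt} (hS : ∀ a ∈ S, a ∈ orthoPos d v) :
    Dominates d v (assoc v (opiTop d v S)) S :=
  dominates_of_covers hv hS hS (oDepth d v S) (fun _ ha => one_le_oDepth hv hS ha)
    (fun _ ha _ hb h => step_le_oDepth hv hS ha hb h) fun _ ha _ h => covers_height ha h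

/-- The elements of `S'` get as level the `k` such that they come from `S_k'`. -/
lemma dominates_opi_snd (hv : v ∈ orthoI d) {S : Multiset Pt} (hS : ∀ a ∈ S, a ∈ orthoPos d v) :
    Dominates d v (assoc v (opiTop d v S)) (opi d v S).2 := by
  classical
  choose! B E hBE using fun k (hk : 1 ≤ k) => exists_isLayer hv hS hk
  have hlevel : ∀ a ∈ (opi d v S).2, ∃ k, 1 ≤ k ∧ a ∈ lowerRest v d (B k) (E k) := by
    intro a ha
    rw [opi_snd] at ha
    obtain ⟨k, hk, ha⟩ := Multiset.mem_sum.1 ha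
    have hk := (Finset.mem_Icc.1 hk).1
    rw [(hBE k hk).eq, (hBE k hk).centered.filter_piRest_sym hv] at ha
    exact ⟨k, hk, ha⟩
  choose! κ h1 hκ using hlevel
  refine dominates_of_covers hv hS (fun a ha => ?_) κ h1 (fun a ha b hb h => ?_) fun a ha t hat => ?_
  · exact ((hBE _ (h1 a ha)).centered.lowerRest_mem hv (hκ a ha)).1
  · exact step_le_of_lowerRest hv hS (h1 b hb) (hBE _ (h1 a ha)) (hBE _ (h1 b hb))
      (fun h => by rw [h]; exact ⟨rfl, rfl⟩) (hκ a ha) (hκ b hb) h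
  · obtain ⟨-, x, hx, y, hy, hxy, -, h2, -⟩ :=
      (hBE _ (h1 a ha)).centered.lowerRest_mem hv (hκ a ha)
    obtain ⟨hxS, hxk⟩ := (hBE _ (h1 a ha)).mem x hx
    have e1 : a.1 = x.1 := by rw [hxy]
    have e2 : a.2 = y.2 := by rw [hxy]
    have := covers_height (d := d) (v := v) hxS (t := t) ⟨by have := hat.1; omega,
      by have := hat.2; omega⟩
    rw [hxk] at this
    simpa only [height, e1] using this

/-- Each straddling number of the distinguished monomial of `π_O(S)` is attained by that of a chain
in `S`. This is the reason for minimality, as comparison in `I(d, 2d)` is by straddling numbers. -/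
lemma exists_chain_countP_opiTop (hv : v ∈ orthoI d) {S : Multiset Pt}
    (hS : ∀ a ∈ S, a ∈ orthoPos d v) (t : ℕ) : ∃ C, IsChainIn S C ∧
      (opiTop d v S).countP (Straddles t) ≤ (chainMonomial d v C).countP (Straddles t) := by
  have hD := isSymmDistinct_opiTop hv hS
  have low : ∀ t ≤ d + 1, ∃ C, IsChainIn S C ∧
      (opiTop d v S).countP (Straddles t) ≤ (chainMonomial d v C).countP (Straddles t) := by
    intro t ht
    rcases Nat.eq_zero_or_pos ((opiTop d v S).countP (Straddles t)) with h0 | h0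
    · exact ⟨[], ⟨List.Pairwise.nil, by simp⟩, by omega⟩
    · obtain ⟨a, ha, hat, h⟩ := (covers_countP_opiTop hv hS ht h0).exists_le_height
      obtain ⟨C, hC, he⟩ := exists_chain_height_eq hv hS ht ha hat
      exact ⟨C, hC, he ▸ h⟩
  by_cases h1 : t ≤ d + 1
  · exact low t h1
  by_cases h2 : t ≤ 2 * d + 2
  · obtain ⟨C, hC, h⟩ := low (2 * d + 2 - t) (by omega)
    rw [hD.reflect t h2, (isSymmDistinct_chainMonomial hv (fun a ha => hS a (hC.2 a ha)) hC.1).reflect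
      t h2] at h
    exact ⟨C, hC, h⟩
  · refine ⟨[], ⟨List.Pairwise.nil, by simp⟩, ?_⟩
    rw [Multiset.countP_eq_zero.2]
    · exact Nat.zero_le _
    · intro x hx hs
      have := (mem_pos_iff hv).1 (hD.mem_pos x hx)
      have := hs.2
      omega

lemma le_of_dominates (hv : v ∈ orthoI d) {S : Multiset Pt} (hS : ∀ a ∈ S, a ∈ orthoPos d v)
    {x : Finset ℕ} (hx : x ∈ orthoI d) (h : Dominates d v x S) :
    Le (assoc v (opiTop d v S)) x := by
  have hD := isSymmDistinct_opiTop hv hS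
  have hxc := card_of_mem_orthoI hx
  rw [le_iff_card_filter (by rw [hD.card_assoc hv, hxc])]
  intro t
  obtain ⟨C, hC, hle⟩ := exists_chain_countP_opiTop hv hS t
  have hCm := isSymmDistinct_chainMonomial hv (fun a ha => hS a (hC.2 a ha)) hC.1
  have h1 := h C hC
  rw [chainElt, le_iff_card_filter (by rw [hCm.card_assoc hv, hxc])] at h1
  have h2 := h1 t
  rw [hCm.card_filter_assoc hv] at h2
  rw [hD.card_filter_assoc hv]
  omega

end OrthoGrass

theorem proposition4p1 (d : ℕ) (v : Finset ℕ) (hv : v ∈ OrthoGrass.orthoI d)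
    (S : Multiset OrthoGrass.Pt) (hS : ∀ a ∈ S, a ∈ OrthoGrass.orthoPos d v) (hS0 : S ≠ 0)
    (w : Finset ℕ) (S' : Multiset OrthoGrass.Pt) (hw : OrthoGrass.opi d v S = (w, S')) :
    OrthoGrass.Le v w ∧
    OrthoGrass.vDegree v w + (S'.card : ℚ) = (S.card : ℚ) ∧
    OrthoGrass.Dominates d v w S' ∧
    (w ∈ OrthoGrass.orthoI d ∧ OrthoGrass.Dominates d v w S ∧
      ∀ x ∈ OrthoGrass.orthoI d, OrthoGrass.Dominates d v x S → OrthoGrass.Le w x) := by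
  have hD := OrthoGrass.isSymmDistinct_opiTop hv hS
  obtain rfl : OrthoGrass.assoc v (OrthoGrass.opiTop d v S) = w := congrArg Prod.fst hw
  obtain rfl : (OrthoGrass.opi d v S).2 = S' := congrArg Prod.snd hw
  refine ⟨?_, ?_, OrthoGrass.dominates_opi_snd hv hS,
    hD.assoc_mem_orthoI hv (OrthoGrass.even_countP_opiTop hv hS),
    OrthoGrass.dominates_opiTop hv hS, fun x hx h => OrthoGrass.le_of_dominates hv hS hx h⟩
  · rw [OrthoGrass.le_iff_card_filter
      (by rw [hD.card_assoc hv, OrthoGrass.card_of_mem_orthoI hv])]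
    intro t
    rw [hD.card_filter_assoc hv]
    exact Nat.le_add_right _ _
  · rw [OrthoGrass.vDegree, hD.card_sdiff_assoc hv]
    have h : ((OrthoGrass.opiTop d v S).card : ℚ) + 2 * ((OrthoGrass.opi d v S).2.card : ℚ) =
        2 * (S.card : ℚ) := by exact_mod_cast OrthoGrass.card_opiTop_add hv hS
    linarith
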